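/- **Jacobi diagrams.** A Jacobi diagram is a finite graph with univalent and trivalent vertices, whose edges join distinct vertices (several edges may join the same two vertices), with a total order on the univalent vertices. Its degree is half its number of vertices. A numbering of a degree $k$ Jacobi diagram $\Gamma$ is an injection $j$ from its set of edges $E(\Gamma)$ to $\{1,\dots,3k\}$. A vertex-orientation is a cyclic order on the three half-edges at each trivalent vertex. The product $\Gamma_1\Gamma_2$ is the disjoint union in which the univalent vertices of $\Gamma_1$ precede those of $\Gamma_2$. Let $\mathcal A=\bigoplus_{k\ge 0}\mathcal A_k$ be the real vector space spanned by the isomorphism classes of vertex-oriented Jacobi diagrams modulo the relations AS (reversing the orientation of one trivalent vertex changes the sign), IHX ($[\Gamma_1]+[\Gamma_2]+[\Gamma_3]=0$ if the diagrams differ only near an edge joining two trivalent vertices with cyclic orders $(g,x,y)$ and $(g,z,o)$, where $g$ is this edge, by a cyclic permutation of the half-edges attached at $x,y,z$) and STU. Here STU reads $[\Gamma]=[\Gamma_1]-[\Gamma_2]$, where $v$ immediately precedes $w$ among the univalent vertices of $\Gamma_1$, the diagram $\Gamma_2$ is $\Gamma_1$ with $v$ and $w$ exchanged, and in $\Gamma$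 the edge $e$ of $\Gamma_1$ ending at $v$, the edge $f$ of $\Gamma_1$ ending at $w$ and a new edge $h$ meet at a new trivalent vertex with cyclic order $(e,h,f)$; the other end of $h$ is a univalent vertex at the place of $v,w$. **Weight systems.** The Conway weight system $w_C$ is the linear form on $\mathcal A$ that vanishes on diagrams with a connected component without univalent vertices, and takes on a diagram without trivalent vertices the value $1$ or $0$ according to whether the following surgery of $\mathbb R$ along its edges is connected or not: put the univalent vertices on $\mathbb R$ in increasing order, cut $\mathbb R$ there, and, for each edge with ends $x$ and $y$, glue the arc arriving at $x$ to the arc leaving $y$ and the arc arriving at $y$ to the arc leaving $x$. Let $\mathcal P\subset\mathcal A$ be spanned by the connected diagrams with a univalent vertex, $\mathcal N$ by the empty diagram and the products of two non-empty diagrams all of whose components have univalent vertices, and $\mathcal T$ by the diagrams with a component without univalent vertices. Let $p^c(x)$ be the $\mathcal P$-component of $x\in\mathcal A=\mathcal P\oplus\mathcal N\oplus\mathcal T$, and $w'_C=w_C\circ p^c$. **BCR diagrams.** A BCR diagram is a non-empty finite connected oriented graph $\Gamma$ whose vertices are internal or external and whose edges are ordered pairs of distinct vertices, each either internal or external, such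 that every vertex is of one of the following types: (1) external, with two incoming external edges, exactly one of which comes from a univalent vertex, and one outgoing external edge; (2) internal trivalent, with one incoming and one outgoing internal edge, and one incoming external edge, which comes from a univalent vertex; (3) internal univalent, with one outgoing external edge; (4) internal bivalent, with one incoming external and one outgoing internal edge; (5) internal bivalent, with one incoming internal and one outgoing external edge. A total order $\rho$ on the internal vertices induces a vertex-oriented Jacobi diagram $\Gamma_\rho$: its univalent vertices are the internal vertices, ordered by $\rho$, its trivalent vertices are the external vertices, and its edges are the external edges; the cyclic order at an external vertex is (incoming edge not coming from a univalent vertex, incoming edge coming from a univalent vertex, outgoing edge). A numbering $\sigma$ of a degree $k$ BCR diagram (one with $2k$ vertices), which is an injection from its external edges to $\{1,\dots,3k\}$, induces a numbering $j_{\rho,\sigma}$ of $\Gamma_\rho$. Let $\epsilon(\Gamma)=(-1)^{a+b}$, where $a$ is the number of external edges and $b$ the number of trivalent (internal or external) vertices of $\Gamma$, and let $\epsilon_2(\Gamma,\rho)=\prod_{(v,w)}\mathrm{sgn}(\rho(w)-\rho(v))$, the product being over the internal edges. **The weight.** For a degree $k$ vertex-oriented Jacobi diagram $\Gamma_J$ with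 a numbering $j$, let $\mathcal G(\Gamma_J,j)$ be the set of ordered and numbered BCR diagrams $(\Gamma,\sigma,\rho)$ such that $(\Gamma_\rho,j_{\rho,\sigma})$ coincides with $(\Gamma_J,j)$ up to the orientations of trivalent vertices and edges. For such a triple, let $\epsilon_3(\Gamma_J,\Gamma,\rho)=(-1)^m$, where $m$ is the number of trivalent vertices where the orientations of $\Gamma_\rho$ and $\Gamma_J$ differ, so that $[\Gamma_\rho]=\epsilon_3(\Gamma_J,\Gamma,\rho)[\Gamma_J]$. Set $$w_{BCR}(\Gamma_J,j)=\sum_{(\Gamma,\sigma,\rho)\in\mathcal G(\Gamma_J,j)}\frac{\epsilon(\Gamma)\,\epsilon_2(\Gamma,\rho)\,\epsilon_3(\Gamma_J,\Gamma,\rho)}{2^{2k-|E(\Gamma_J)|}}.$$ **Proposition.** The linear form $w_C$ exists and is uniquely determined by the above conditions; every element of $\mathcal A$ lies in $\mathcal P+\mathcal N+\mathcal T$, and $w_C$ takes the same value on all its possible $\mathcal P$-components, so that $w'_C$ is well defined. For every vertex-oriented Jacobi diagram $\Gamma_J$ and every numbering $j$ of $\Gamma_J$, $$w_{BCR}(\Gamma_J,j)=-\,w'_C([\Gamma_J]).$$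 In particular $w_{BCR}(\Gamma_J,j)$ does not depend on $j$. -/

import Mathlib

noncomputable section

namespace BCR

/-! ## Jacobi diagrams -/

/-- Half-edges of a unitrivalent graph with univalent vertices `U` and trivalent vertices `T`:
one at each univalent vertex, three, labelled by `Fin 3`, at each trivalent vertex. -/
abbrev HalfEdge (U T : Type) : Type := U ⊕ T × Fin 3

/-- The vertex at which a half-edge is attached. -/
def HalfEdge.vertex {U T : Type} : HalfEdge U T → U ⊕ T :=
  Sum.map id Prod.fst

/-- A vertex-oriented Jacobi diagram. `U` is the totally ordered set of univalent vertices, `T` the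
set of trivalent vertices, and `opp` exchanges the two halves of every edge. Edges join distinct
vertices; several edges may join the same two vertices (as in the wheel with two legs).
The orientation of the trivalent vertex `t` is the cyclic order
`(t, 0) → (t, 1) → (t, 2) → (t, 0)` of its half-edges. Only this cyclic order matters:
see `JacobiDiagram.Iso`. -/
structure JacobiDiagram : Type 1 where
  U : Type
  T : Type
  [linU : LinearOrder U]
  [finU : Fintype U]
  [finT : Fintype T]
  opp : HalfEdge U T → HalfEdge U T
  opp_opp : ∀ h, opp (opp h) = h
  no_loop : ∀ h, (opp h).vertex ≠ h.vertex

attribute [instance] JacobiDiagram.linU JacobiDiagram.finU JacobiDiagram.finT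

namespace JacobiDiagram

/-- The set of vertices. -/
abbrev Vertex (Γ : JacobiDiagram) : Type := Γ.U ⊕ Γ.T

/-- The degree: half the number of vertices (this number is always even). -/
def degree (Γ : JacobiDiagram) : ℕ := Fintype.card Γ.Vertex / 2

/-- Edges, as unordered pairs of opposite half-edges. -/
def Edge (Γ : JacobiDiagram) : Type :=
  {e : Sym2 (HalfEdge Γ.U Γ.T) // ∃ h, e = s(h, Γ.opp h)}

/-- The edge containing a half-edge. -/
def edge (Γ : JacobiDiagram) (h : HalfEdge Γ.U Γ.T) : Γ.Edge := ⟨s(h, Γ.opp h), h, rfl⟩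

/-- A numbering of a degree `k` Jacobi diagram: an injection from its edges to a set with
`3 k` elements. -/
abbrev Numbering (Γ : JacobiDiagram) : Type := Γ.Edge ↪ Fin (3 * Γ.degree)

/-- Isomorphism of vertex-oriented Jacobi diagrams: `f` and `g` are bijections between the
vertices, `f` is increasing, and the induced bijection between the half-edges, which preserves the
cyclic order at each trivalent vertex (rotation by `r t` at `t`), preserves the edges. -/
def Iso (Γ Γ' : JacobiDiagram) : Prop :=
  ∃ (f : Γ.U ≃o Γ'.U) (g : Γ.T ≃ Γ'.T) (r : Γ.T → Fin 3),
    let φ : HalfEdge Γ.U Γ.T → HalfEdge Γ'.U Γ'.T := Sum.map f (fun p => (g p.1, p.2 + r p.1))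
    ∀ h, Γ'.opp (φ h) = φ (Γ.opp h)

/-- The graph underlying a Jacobi diagram. -/
def graph (Γ : JacobiDiagram) : SimpleGraph Γ.Vertex :=
  SimpleGraph.fromRel fun v w => ∃ h, HalfEdge.vertex h = v ∧ (Γ.opp h).vertex = w

/-- Some connected component has only trivalent vertices. -/
def HasTrivalentComponent (Γ : JacobiDiagram) : Prop :=
  ∃ c : Γ.graph.ConnectedComponent, ∀ u : Γ.U, Γ.graph.connectedComponentMk (Sum.inl u) ≠ c

/-- The diagram obtained by moving every end `h` of an edge to the place of the half-edge `φ h`,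
provided that this creates no loop. -/
def rewire (Γ : JacobiDiagram) (φ : Equiv.Perm (HalfEdge Γ.U Γ.T))
    (hφ : ∀ h, (φ (Γ.opp h)).vertex ≠ (φ h).vertex) : JacobiDiagram where
  U := Γ.U
  T := Γ.T
  opp := fun h => φ (Γ.opp (φ.symm h))
  opp_opp := fun h => by simp [Γ.opp_opp]
  no_loop := fun h => by simpa using hφ (φ.symm h)

open Classical in
/-- Reversal of the cyclic order at the trivalent vertex `t`, on half-edges. -/
def reversal {U T : Type} (t : T) : Equiv.Perm (HalfEdge U T) :=
  Equiv.swap (Sum.inr (t, 1)) (Sum.inr (t, 2))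

open Classical in
/-- The cyclic permutation `(a, 1) ↦ (a, 2) ↦ (b, 1) ↦ (a, 1)` of half-edges. -/
def threeCycle {U T : Type} (a b : T) : Equiv.Perm (HalfEdge U T) :=
  Equiv.swap (Sum.inr (a, 1)) (Sum.inr (a, 2)) * Equiv.swap (Sum.inr (a, 2)) (Sum.inr (b, 1))

open Classical in
/-- Exchange of the positions of two univalent vertices, on half-edges. -/
def legSwap {U T : Type} (v w : U) : Equiv.Perm (HalfEdge U T) :=
  Equiv.swap (Sum.inl v) (Sum.inl w)

open Classical in
/-- Where the half-edges of a diagram go when its univalent vertices `v`, `w` are merged into a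
new trivalent vertex `none`: the end at `w` becomes `(none, 1)`, the end at `v` becomes
`(none, 2)`. -/
def mergeHalf {U T : Type} (v w : U) : HalfEdge U T → HalfEdge {x : U // x ≠ w} (Option T)
  | Sum.inl x =>
      if hw : x = w then Sum.inr (none, 1)
      else if x = v then Sum.inr (none, 2)
      else Sum.inl ⟨x, hw⟩
  | Sum.inr (t, i) => Sum.inr (some t, i)

open Classical in
/-- The opposite half-edges in the diagram obtained by merging `v` and `w`: the third half-edge
`(none, 0)` of the new trivalent vertex is joined to a univalent vertex put at the
place of `v`. -/
def mergeOpp {U T : Type} (opp : HalfEdge U T → HalfEdge U T) (v w : U) (hvw : v ≠ w) :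
    HalfEdge {x : U // x ≠ w} (Option T) → HalfEdge {x : U // x ≠ w} (Option T)
  | Sum.inl x => if x.1 = v then Sum.inr (none, 0) else mergeHalf v w (opp (Sum.inl x.1))
  | Sum.inr (none, i) =>
      if i = 0 then Sum.inl ⟨v, hvw⟩
      else if i = 1 then mergeHalf v w (opp (Sum.inl w))
      else mergeHalf v w (opp (Sum.inl v))
  | Sum.inr (some t, i) => mergeHalf v w (opp (Sum.inr (t, i)))

theorem mergeOpp_opp {U T : Type} (opp : HalfEdge U T → HalfEdge U T) (v w : U) (hvw : v ≠ w)
    (h1 : ∀ h, opp (opp h) = h) (h) :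
    mergeOpp opp v w hvw (mergeOpp opp v w hvw h) = h := by
  have key : ∀ h : HalfEdge U T, mergeOpp opp v w hvw (mergeHalf v w h) = mergeHalf v w (opp h) := by
    rintro (x | ⟨t, i⟩)
    · by_cases hw : x = w
      · subst hw; simp [mergeHalf, mergeOpp]
      · by_cases hv : x = v
        · subst hv; simp [mergeHalf, mergeOpp, hw]
        · simp [mergeHalf, mergeOpp, hw, hv]
    · simp [mergeHalf, mergeOpp]
  rcases h with ⟨x, hx⟩ | ⟨_ | t, i⟩
  · by_cases hv : x = v
    · subst hv; simp [mergeOpp]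
    · have e : mergeOpp opp v w hvw (Sum.inl ⟨x, hx⟩) = mergeHalf v w (opp (Sum.inl x)) := by
        simp [mergeOpp, hv]
      rw [e, key, h1]
      simp [mergeHalf, hx, hv]
  · fin_cases i
    · simp [mergeOpp]
    · have e : mergeOpp opp v w hvw (Sum.inr (none, 1)) = mergeHalf v w (opp (Sum.inl w)) := by
        simp [mergeOpp]
      exact (congrArg _ e).trans (by rw [key, h1]; simp [mergeHalf])
    · have e : mergeOpp opp v w hvw (Sum.inr (none, 2)) = mergeHalf v w (opp (Sum.inl v)) := by
        simp [mergeOpp]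
      exact (congrArg _ e).trans (by rw [key, h1]; simp [mergeHalf, hvw])
  · have e : mergeOpp opp v w hvw (Sum.inr (some t, i)) =
        mergeHalf v w (opp (Sum.inr (t, i))) := by
      simp [mergeOpp]
    rw [e, key, h1]
    simp [mergeHalf]

theorem mergeOpp_no_loop {U T : Type} (opp : HalfEdge U T → HalfEdge U T) (v w : U) (hvw : v ≠ w)
    (h1 : ∀ h, opp (opp h) = h)
    (h2 : opp (Sum.inl v) ≠ Sum.inl w) (h3 : ∀ h, (opp h).vertex ≠ h.vertex) (h) :
    (mergeOpp opp v w hvw h).vertex ≠ h.vertex := by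
  have h4 : opp (Sum.inl w) ≠ Sum.inl v := fun e => h2 (by rw [← e, h1])
  rcases h with ⟨x, hx⟩ | ⟨_ | t, i⟩
  · by_cases hv : x = v
    · subst hv; simp [mergeOpp, HalfEdge.vertex]
    · have := h3 (Sum.inl x)
      simp only [mergeOpp, hv, if_false]
      rcases hh : opp (Sum.inl x) with y | ⟨t, i⟩
      · rw [hh] at this
        simp only [mergeHalf]
        split_ifs <;> simp_all [HalfEdge.vertex]
      · simp [mergeHalf, HalfEdge.vertex]
  · fin_cases i
    · simp [mergeOpp, HalfEdge.vertex]
    · have hw := h3 (Sum.inl w)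
      rcases hh : opp (Sum.inl w) with y | ⟨t, i⟩
      · have hyw : y ≠ w := fun e => hw (by rw [hh, e])
        have hyv : y ≠ v := fun e => h4 (by rw [hh, e])
        simp [mergeOpp, mergeHalf, HalfEdge.vertex, hh, hyw, hyv]
      · simp [mergeOpp, mergeHalf, HalfEdge.vertex, hh]
    · have hv := h3 (Sum.inl v)
      rcases hh : opp (Sum.inl v) with y | ⟨t, i⟩
      · have hyv : y ≠ v := fun e => hv (by rw [hh, e])
        have hyw : y ≠ w := fun e => h2 (by rw [hh, e])
        simp [mergeOpp, mergeHalf, HalfEdge.vertex, hh, hyw, hyv]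
      · simp [mergeOpp, mergeHalf, HalfEdge.vertex, hh]
  · have := h3 (Sum.inr (t, i))
    rcases hh : opp (Sum.inr (t, i)) with y | ⟨s, k⟩
    · simp only [mergeOpp, hh, mergeHalf]
      split_ifs <;> simp [HalfEdge.vertex]
    · simp_all [mergeOpp, mergeHalf, HalfEdge.vertex]

open Classical in
/-- The diagram obtained by merging two univalent vertices `v`, `w` that are not joined by an
edge; it is used for `v` immediately before `w`. The cyclic order at the new trivalent
vertex is: the edge that ended at `v`, the new edge to the line, the edge that ended at `w`. -/
def merge (Γ : JacobiDiagram) (v w : Γ.U) (hvw : v ≠ w)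
    (hne : Γ.opp (Sum.inl v) ≠ Sum.inl w) : JacobiDiagram where
  U := {x : Γ.U // x ≠ w}
  T := Option Γ.T
  opp := mergeOpp Γ.opp v w hvw
  opp_opp := mergeOpp_opp Γ.opp v w hvw Γ.opp_opp
  no_loop := mergeOpp_no_loop Γ.opp v w hvw Γ.opp_opp hne Γ.no_loop

open Classical in
theorem vertex_reversal {U T : Type} (t : T) (h : HalfEdge U T) :
    (reversal t h).vertex = h.vertex := by
  unfold reversal
  by_cases h1 : h = Sum.inr (t, 1)
  · subst h1; simp [HalfEdge.vertex]
  · by_cases h2 : h = Sum.inr (t, 2)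
    · subst h2; simp [HalfEdge.vertex]
    · rw [Equiv.swap_apply_of_ne_of_ne h1 h2]

open Classical in
theorem vertex_legSwap {U T : Type} (v w : U) (h : HalfEdge U T) :
    (legSwap v w h).vertex = Equiv.swap (Sum.inl v) (Sum.inl w) h.vertex := by
  unfold legSwap
  rcases h with x | ⟨t, i⟩
  · by_cases h1 : x = v
    · subst h1; simp [HalfEdge.vertex]
    · by_cases h2 : x = w
      · subst h2; simp [HalfEdge.vertex]
      · rw [Equiv.swap_apply_of_ne_of_ne (by simpa using h1) (by simpa using h2)]
        simp only [HalfEdge.vertex, Sum.map_inl, id]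
        rw [Equiv.swap_apply_of_ne_of_ne (by simpa using h1) (by simpa using h2)]
  · rw [Equiv.swap_apply_of_ne_of_ne (by simp) (by simp)]
    simp only [HalfEdge.vertex, Sum.map_inr]
    rw [Equiv.swap_apply_of_ne_of_ne (by simp) (by simp)]

/-- The diagram with the opposite orientation at the trivalent vertex `t`. -/
def reverse (Γ : JacobiDiagram) (t : Γ.T) : JacobiDiagram :=
  Γ.rewire (reversal t) fun h => by
    rw [vertex_reversal, vertex_reversal]; exact Γ.no_loop h

/-- The diagram in which the univalent vertices `v` and `w` have exchanged their positions. -/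
def swapLegs (Γ : JacobiDiagram) (v w : Γ.U) : JacobiDiagram :=
  Γ.rewire (legSwap v w) fun h => by
    rw [vertex_legSwap, vertex_legSwap]; exact fun e => Γ.no_loop h (Equiv.injective _ e)

/-- The half-edges of a product, seen from the first factor. -/
def prodInl {U₁ T₁ U₂ T₂ : Type} : HalfEdge U₁ T₁ → HalfEdge (U₁ ⊕ₗ U₂) (T₁ ⊕ T₂) :=
  Sum.map (fun u => toLex (Sum.inl u)) (fun p => (Sum.inl p.1, p.2))

/-- The half-edges of a product, seen from the second factor. -/
def prodInr {U₁ T₁ U₂ T₂ : Type} : HalfEdge U₂ T₂ → HalfEdge (U₁ ⊕ₗ U₂) (T₁ ⊕ T₂) :=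
  Sum.map (fun u => toLex (Sum.inr u)) (fun p => (Sum.inr p.1, p.2))

/-- The opposite half-edges in a product. -/
def prodOpp {U₁ T₁ U₂ T₂ : Type} (o₁ : HalfEdge U₁ T₁ → HalfEdge U₁ T₁)
    (o₂ : HalfEdge U₂ T₂ → HalfEdge U₂ T₂) :
    HalfEdge (U₁ ⊕ₗ U₂) (T₁ ⊕ T₂) → HalfEdge (U₁ ⊕ₗ U₂) (T₁ ⊕ T₂)
  | Sum.inl x => match ofLex x with
    | Sum.inl u => prodInl (o₁ (Sum.inl u))
    | Sum.inr u => prodInr (o₂ (Sum.inl u))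
  | Sum.inr (Sum.inl t, i) => prodInl (o₁ (Sum.inr (t, i)))
  | Sum.inr (Sum.inr t, i) => prodInr (o₂ (Sum.inr (t, i)))

section prod

variable {U₁ T₁ U₂ T₂ : Type} (o₁ : HalfEdge U₁ T₁ → HalfEdge U₁ T₁)
  (o₂ : HalfEdge U₂ T₂ → HalfEdge U₂ T₂)

theorem prodOpp_inl (h : HalfEdge U₁ T₁) : prodOpp o₁ o₂ (prodInl h) = prodInl (o₁ h) := by
  rcases h with u | ⟨t, i⟩ <;> rfl

theorem prodOpp_inr (h : HalfEdge U₂ T₂) : prodOpp o₁ o₂ (prodInr h) = prodInr (o₂ h) := by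
  rcases h with u | ⟨t, i⟩ <;> rfl

theorem prod_cases (h : HalfEdge (U₁ ⊕ₗ U₂) (T₁ ⊕ T₂)) :
    (∃ k : HalfEdge U₁ T₁, h = prodInl k) ∨ (∃ k : HalfEdge U₂ T₂, h = prodInr k) := by
  rcases h with (u | u) | ⟨t | t, i⟩
  · exact Or.inl ⟨Sum.inl u, rfl⟩
  · exact Or.inr ⟨Sum.inl u, rfl⟩
  · exact Or.inl ⟨Sum.inr (t, i), rfl⟩
  · exact Or.inr ⟨Sum.inr (t, i), rfl⟩

theorem vertex_prodInl (h k : HalfEdge U₁ T₁)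
    (e : (prodInl h : HalfEdge (U₁ ⊕ₗ U₂) (T₁ ⊕ T₂)).vertex = (prodInl k).vertex) :
    h.vertex = k.vertex := by
  rcases h with u | ⟨t, i⟩ <;> rcases k with u' | ⟨t', i'⟩ <;>
    simp_all [prodInl, HalfEdge.vertex]

theorem vertex_prodInr (h k : HalfEdge U₂ T₂)
    (e : (prodInr h : HalfEdge (U₁ ⊕ₗ U₂) (T₁ ⊕ T₂)).vertex = (prodInr k).vertex) :
    h.vertex = k.vertex := by
  rcases h with u | ⟨t, i⟩ <;> rcases k with u' | ⟨t', i'⟩ <;>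
    simp_all [prodInr, HalfEdge.vertex]

end prod

/-- The product of two Jacobi diagrams: their disjoint union, with the univalent vertices of the
first one before those of the second one. -/
def prod (Γ₁ Γ₂ : JacobiDiagram) : JacobiDiagram where
  U := Γ₁.U ⊕ₗ Γ₂.U
  T := Γ₁.T ⊕ Γ₂.T
  finU := inferInstanceAs (Fintype (Γ₁.U ⊕ Γ₂.U))
  opp := prodOpp Γ₁.opp Γ₂.opp
  opp_opp := fun h => by
    rcases prod_cases h with ⟨k, rfl⟩ | ⟨k, rfl⟩
    · rw [prodOpp_inl, prodOpp_inl, Γ₁.opp_opp]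
    · rw [prodOpp_inr, prodOpp_inr, Γ₂.opp_opp]
  no_loop := fun h => by
    rcases prod_cases h with ⟨k, rfl⟩ | ⟨k, rfl⟩
    · rw [prodOpp_inl]; exact fun e => Γ₁.no_loop k (vertex_prodInl _ _ e)
    · rw [prodOpp_inr]; exact fun e => Γ₂.no_loop k (vertex_prodInr _ _ e)

/-! ## The number of edges, existence of numberings -/

theorem opp_ne (Γ : JacobiDiagram) (h : HalfEdge Γ.U Γ.T) : Γ.opp h ≠ h :=
  fun e => Γ.no_loop h (by rw [e])

theorem edge_eq_iff (Γ : JacobiDiagram) (a h : HalfEdge Γ.U Γ.T) :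
    Γ.edge a = Γ.edge h ↔ a = h ∨ a = Γ.opp h := by
  constructor
  · intro e
    rcases Sym2.eq_iff.1 (congrArg Subtype.val e) with ⟨h1, -⟩ | ⟨h1, -⟩
    · exact Or.inl h1
    · exact Or.inr h1
  · rintro (rfl | rfl)
    · rfl
    · exact Subtype.ext (Sym2.eq_iff.2 (Or.inr ⟨rfl, Γ.opp_opp h⟩))

/-- Every Jacobi diagram has a numbering. -/
theorem nonempty_numbering (Γ : JacobiDiagram) : Nonempty Γ.Numbering := by
  classical
  have hsurj : Function.Surjective Γ.edge := by
    rintro ⟨_, h, rfl⟩; exact ⟨h, rfl⟩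
  have : Finite Γ.Edge := Finite.of_surjective _ hsurj
  have : Fintype Γ.Edge := Fintype.ofFinite _
  have key : Fintype.card (HalfEdge Γ.U Γ.T) = Fintype.card Γ.Edge * 2 := by
    rw [← Finset.card_univ, ← Finset.card_univ]
    rw [Finset.card_eq_sum_card_fiberwise (f := Γ.edge) (t := Finset.univ) (by simp)]
    rw [Finset.sum_const_nat]
    intro e _
    obtain ⟨h, rfl⟩ := hsurj e
    have : Finset.univ.filter (fun a => Γ.edge a = Γ.edge h) = {h, Γ.opp h} := by
      ext a
      rw [Finset.mem_filter, Finset.mem_insert, Finset.mem_singleton, Γ.edge_eq_iff]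
      simp
    rw [this, Finset.card_pair (Γ.opp_ne h).symm]
  refine Function.Embedding.nonempty_of_card_le ?_
  simp only [Fintype.card_sum, Fintype.card_prod, Fintype.card_fin] at key
  simp only [Fintype.card_fin, degree, Fintype.card_sum]
  omega

/-! ## The space of Jacobi diagrams -/

/-- The relations between vertex-oriented Jacobi diagrams. -/
inductive IsRelation : (JacobiDiagram →₀ ℝ) → Prop
  /-- Isomorphic diagrams are identified. -/
  | iso (Γ Γ' : JacobiDiagram) (h : Γ.Iso Γ') :
      IsRelation (Finsupp.single Γ 1 - Finsupp.single Γ' 1)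
  /-- AS: reversing the orientation of one trivalent vertex changes the sign. -/
  | as (Γ : JacobiDiagram) (t : Γ.T) :
      IsRelation (Finsupp.single (Γ.reverse t) 1 + Finsupp.single Γ 1)
  /-- IHX: an edge joins `a` to `b`; the other half-edges at `a` and one of the other two at `b`
  are permuted cyclically. -/
  | ihx (Γ : JacobiDiagram) (a b : Γ.T) (hab : Γ.opp (Sum.inr (a, 0)) = Sum.inr (b, 0))
      (h₁ : ∀ h, (threeCycle a b (Γ.opp h)).vertex ≠ (threeCycle a b h).vertex)
      (h₂ : ∀ h, ((threeCycle a b).symm (Γ.opp h)).vertex ≠ ((threeCycle a b).symm h).vertex) :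
      IsRelation (Finsupp.single Γ 1 + Finsupp.single (Γ.rewire (threeCycle a b) h₁) 1 +
        Finsupp.single (Γ.rewire (threeCycle a b).symm h₂) 1)
  /-- STU: `v` is immediately before `w` on the line, and the edges that end there are merged. -/
  | stu (Γ : JacobiDiagram) (v w : Γ.U) (hvw : v ⋖ w) (hne : Γ.opp (Sum.inl v) ≠ Sum.inl w) :
      IsRelation (Finsupp.single (Γ.merge v w hvw.ne hne) 1 -
        (Finsupp.single Γ 1 - Finsupp.single (Γ.swapLegs v w) 1))

end JacobiDiagram

open JacobiDiagram

/-- The direct sum over all degrees `k` of the spaces of degree `k` Jacobi diagrams: the real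
vector space spanned by the vertex-oriented Jacobi diagrams modulo AS, IHX and STU (all of these
relations are homogeneous for the degree). -/
abbrev DiagramSpace : Type 1 :=
  (JacobiDiagram →₀ ℝ) ⧸ Submodule.span ℝ {x : JacobiDiagram →₀ ℝ | IsRelation x}

/-- The class of a vertex-oriented Jacobi diagram. -/
def cls (Γ : JacobiDiagram) : DiagramSpace := Submodule.Quotient.mk (Finsupp.single Γ 1)

/-- The span of the classes of connected diagrams with at least one univalent vertex. -/
def connectedSpan : Submodule ℝ DiagramSpace :=
  Submodule.span ℝ {x | ∃ Γ : JacobiDiagram, x = cls Γ ∧ Γ.graph.Connected ∧ Nonempty Γ.U}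

/-- The span of the class of the empty diagram and of the classes of the products of two non-empty
diagrams all of whose components have univalent vertices. -/
def productSpan : Submodule ℝ DiagramSpace :=
  Submodule.span ℝ
    ({x | ∃ Γ : JacobiDiagram, x = cls Γ ∧ IsEmpty Γ.Vertex} ∪
     {x | ∃ Γ₁ Γ₂ : JacobiDiagram, x = cls (Γ₁.prod Γ₂) ∧ Nonempty Γ₁.Vertex ∧
        Nonempty Γ₂.Vertex ∧ ¬ Γ₁.HasTrivalentComponent ∧ ¬ Γ₂.HasTrivalentComponent})

/-- The span of the classes of diagrams with at least one trivalent component. -/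
def trivalentSpan : Submodule ℝ DiagramSpace :=
  Submodule.span ℝ {x | ∃ Γ : JacobiDiagram, x = cls Γ ∧ Γ.HasTrivalentComponent}

/-! ## The Conway weight system and its logarithm -/

/-- The surgery on the line defined by a chord diagram. The univalent vertices cut the line into
arcs: `⊥` is the arc that comes from `-∞`, and `u` is the arc that starts at `u`. The surgery
along the chords continues the arc that ends at `y` by the arc that starts at the other end of the
chord at `y`. -/
def JacobiDiagram.surgeryRel (Γ : JacobiDiagram) (a b : WithBot Γ.U) : Prop :=
  ∃ y z : Γ.U, a ⋖ (y : WithBot Γ.U) ∧ Γ.opp (Sum.inl y) = Sum.inl z ∧ b = (z : WithBot Γ.U)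

/-- The number of circles in the surgered line: all its components but one. -/
def JacobiDiagram.circleCount (Γ : JacobiDiagram) : ℕ := Nat.card (Quot Γ.surgeryRel) - 1

/-- `w` is the Conway weight system: it takes the value `1` or `0` on a chord diagram according to
whether the surgered line is connected, and vanishes on diagrams with a trivalent component. -/
structure IsConwayWeightSystem (w : DiagramSpace →ₗ[ℝ] ℝ) : Prop where
  chord : ∀ Γ : JacobiDiagram, IsEmpty Γ.T → w (cls Γ) = if Γ.circleCount = 0 then 1 else 0
  trivalent : ∀ Γ : JacobiDiagram, Γ.HasTrivalentComponent → w (cls Γ) = 0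

/-- The Conway weight system. -/
def conwayWeight : DiagramSpace →ₗ[ℝ] ℝ := Classical.epsilon IsConwayWeightSystem

/-- `p` is the component of `x` in the space of connected diagrams, in the splitting of the space
of diagrams into connected diagrams, products and diagrams with trivalent components. -/
def IsConnectedPart (x p : DiagramSpace) : Prop :=
  p ∈ connectedSpan ∧ ∃ n ∈ productSpan, ∃ t ∈ trivalentSpan, x = p + n + t

/-- The projection to the space of connected diagrams. -/
def connectedPart (x : DiagramSpace) : DiagramSpace := Classical.epsilon (IsConnectedPart x)

/-- The logarithmic Conway weight system. -/
def logConwayWeight (x : DiagramSpace) : ℝ := conwayWeight (connectedPart x)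

/-! ## BCR diagrams -/

/-- The number of edges of `E` that arrive at `v`. -/
def inDeg {V : Type} (E : Set (V × V)) (v : V) : ℕ := {e ∈ E | e.2 = v}.ncard

/-- The number of edges of `E` that leave `v`. -/
def outDeg {V : Type} (E : Set (V × V)) (v : V) : ℕ := {e ∈ E | e.1 = v}.ncard

/-- The valency of `v` in a graph with internal edges `Ei` and external edges `Ee`. -/
def valency {V : Type} (Ei Ee : Set (V × V)) (v : V) : ℕ :=
  inDeg Ei v + outDeg Ei v + inDeg Ee v + outDeg Ee v

/-- The five admissible behaviours at a vertex, for internal edges `Ei` and external edges `Ee`.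
-/
inductive VertexRule {I X : Type} (Ei Ee : Set ((I ⊕ X) × (I ⊕ X))) : I ⊕ X → Prop
  /-- External; two incoming external edges, one outgoing external edge, and exactly one of the
  incoming edges comes from a univalent vertex. -/
  | externalTrivalent (x : X) (h₁ : inDeg Ei (Sum.inr x) = 0) (h₂ : outDeg Ei (Sum.inr x) = 0)
      (h₃ : inDeg Ee (Sum.inr x) = 2) (h₄ : outDeg Ee (Sum.inr x) = 1)
      (h₅ : {e ∈ Ee | e.2 = Sum.inr x ∧ valency Ei Ee e.1 = 1}.ncard = 1) :
      VertexRule Ei Ee (Sum.inr x)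
  /-- Internal; one incoming and one outgoing internal edge, one incoming external edge, which
  comes from a univalent vertex. -/
  | internalTrivalent (v : I) (h₁ : inDeg Ei (Sum.inl v) = 1) (h₂ : outDeg Ei (Sum.inl v) = 1)
      (h₃ : inDeg Ee (Sum.inl v) = 1) (h₄ : outDeg Ee (Sum.inl v) = 0)
      (h₅ : ∀ e ∈ Ee, e.2 = Sum.inl v → valency Ei Ee e.1 = 1) :
      VertexRule Ei Ee (Sum.inl v)
  /-- Internal and univalent; one outgoing external edge. -/
  | univalent (v : I) (h₁ : inDeg Ei (Sum.inl v) = 0) (h₂ : outDeg Ei (Sum.inl v) = 0)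
      (h₃ : inDeg Ee (Sum.inl v) = 0) (h₄ : outDeg Ee (Sum.inl v) = 1) :
      VertexRule Ei Ee (Sum.inl v)
  /-- Internal and bivalent; one incoming external edge, one outgoing internal edge. -/
  | externalToInternal (v : I) (h₁ : inDeg Ei (Sum.inl v) = 0) (h₂ : outDeg Ei (Sum.inl v) = 1)
      (h₃ : inDeg Ee (Sum.inl v) = 1) (h₄ : outDeg Ee (Sum.inl v) = 0) :
      VertexRule Ei Ee (Sum.inl v)
  /-- Internal and bivalent; one incoming internal edge, one outgoing external edge. -/
  | internalToExternal (v : I) (h₁ : inDeg Ei (Sum.inl v) = 1) (h₂ : outDeg Ei (Sum.inl v) = 0)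
      (h₃ : inDeg Ee (Sum.inl v) = 0) (h₄ : outDeg Ee (Sum.inl v) = 1) :
      VertexRule Ei Ee (Sum.inl v)

/-- A BCR diagram with set of internal vertices `I` and set of external vertices `X`. Edges are
ordered pairs of distinct vertices. (`SimpleGraph.Connected` includes non-emptiness.) -/
structure BCRDiagram (I X : Type) where
  internalEdges : Set ((I ⊕ X) × (I ⊕ X))
  externalEdges : Set ((I ⊕ X) × (I ⊕ X))
  disjoint : Disjoint internalEdges externalEdges
  ne : ∀ e ∈ internalEdges ∪ externalEdges, e.1 ≠ e.2
  connected : (SimpleGraph.fromRel fun v w => (v, w) ∈ internalEdges ∪ externalEdges).Connected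
  rule : ∀ v, VertexRule internalEdges externalEdges v

namespace BCRDiagram

variable {I X : Type} (G : BCRDiagram I X)

/-- A vertex is univalent. -/
def IsUnivalent (v : I ⊕ X) : Prop := valency G.internalEdges G.externalEdges v = 1

/-- The number of trivalent (internal or external) vertices. -/
def trivalentCount : ℕ := {v | valency G.internalEdges G.externalEdges v = 3}.ncard

/-- The sign `ε(G)`. -/
def sign₁ : ℝ := (-1) ^ (G.externalEdges.ncard + G.trivalentCount)

open Classical in
/-- For internal vertices `v ≠ w`, the sign of `ρ(w) - ρ(v)`, where `ρ` is the increasing numbering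
of the internal vertices. (The endpoints of internal edges are internal vertices.) -/
def orderSign [LinearOrder I] : I ⊕ X → I ⊕ X → ℝ
  | Sum.inl v, Sum.inl w => if v < w then 1 else -1
  | _, _ => 1

/-- The sign `ε₂(G, ρ)`, where `ρ` is given by the total order on the internal vertices. -/
def sign₂ [LinearOrder I] : ℝ := ∏ᶠ e ∈ G.internalEdges, orderSign e.1 e.2

/-- The half-edge of the induced Jacobi diagram which is the tail of an external edge: around an
external vertex, the outgoing edge has label `2`. -/
def tail (e : G.externalEdges) : HalfEdge I X :=
  match e.1.1 with
  | Sum.inl v => Sum.inl v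
  | Sum.inr x => Sum.inr (x, 2)

open Classical in
/-- The half-edge of the induced Jacobi diagram which is the head of an external edge: around an
external vertex, the incoming edge of the cycle has label `0`, and the leg has label `1`. -/
def head (e : G.externalEdges) : HalfEdge I X :=
  match e.1.2 with
  | Sum.inl v => Sum.inl v
  | Sum.inr x => Sum.inr (x, if G.IsUnivalent e.1.1 then 1 else 0)

/-- The two ends of the external edges. -/
def ends (p : G.externalEdges × Bool) : HalfEdge I X := if p.2 then G.head p.1 else G.tail p.1

theorem vertex_tail (e : G.externalEdges) : (G.tail e).vertex = e.1.1 := by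
  unfold tail
  split <;> simp_all [HalfEdge.vertex]

theorem vertex_head (e : G.externalEdges) : (G.head e).vertex = e.1.2 := by
  unfold head
  split <;> simp_all [HalfEdge.vertex]

theorem eq_of_ncard {V : Type} {S : Set V} (h : S.ncard = 1) {a b : V} (ha : a ∈ S)
    (hb : b ∈ S) : a = b := by
  obtain ⟨c, rfl⟩ := Set.ncard_eq_one.1 h
  simp_all

theorem exists_of_ncard {V : Type} {S : Set V} (h : S.ncard = 1) : ∃ a, a ∈ S := by
  obtain ⟨c, rfl⟩ := Set.ncard_eq_one.1 h
  exact ⟨c, rfl⟩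

theorem rule_inl (v : I) :
    (inDeg G.externalEdges (Sum.inl v) = 1 ∧ outDeg G.externalEdges (Sum.inl v) = 0) ∨
    (inDeg G.externalEdges (Sum.inl v) = 0 ∧ outDeg G.externalEdges (Sum.inl v) = 1) := by
  cases G.rule (Sum.inl v) <;> simp_all

theorem rule_inr (x : X) : inDeg G.externalEdges (Sum.inr x) = 2 ∧
    outDeg G.externalEdges (Sum.inr x) = 1 ∧
    {e ∈ G.externalEdges | e.2 = Sum.inr x ∧ G.IsUnivalent e.1}.ncard = 1 := by
  cases G.rule (Sum.inr x) with
  | externalTrivalent _ h₁ h₂ h₃ h₄ h₅ => exact ⟨h₃, h₄, h₅⟩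

section ends

variable [Finite I] [Finite X]

theorem false_of_ncard {V : Type} [Finite V] {S : Set V} (h : S.ncard = 0) {a : V}
    (ha : a ∈ S) : False := by
  rw [Set.ncard_eq_zero (Set.toFinite S)] at h
  simp [h] at ha

theorem rule_inr_cycle (x : X) :
    {e ∈ G.externalEdges | e.2 = Sum.inr x ∧ ¬ G.IsUnivalent e.1}.ncard = 1 := by
  obtain ⟨h₁, -, h₂⟩ := G.rule_inr x
  have h₃ := Set.ncard_sdiff_add_ncard_of_subset
    (s := {e ∈ G.externalEdges | e.2 = Sum.inr x ∧ G.IsUnivalent e.1})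
    (t := {e ∈ G.externalEdges | e.2 = Sum.inr x}) (fun e he => ⟨he.1, he.2.1⟩) (Set.toFinite _)
  have h₄ : {e ∈ G.externalEdges | e.2 = Sum.inr x} \
      {e ∈ G.externalEdges | e.2 = Sum.inr x ∧ G.IsUnivalent e.1} =
      {e ∈ G.externalEdges | e.2 = Sum.inr x ∧ ¬ G.IsUnivalent e.1} := by
    ext e
    simp only [Set.mem_sdiff, Set.mem_ofPred_eq]
    tauto
  rw [h₄] at h₃
  unfold inDeg at h₁
  omega

theorem out_unique (e e' : G.externalEdges) (h : e.1.1 = e'.1.1) : e = e' := by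
  have m : e.1 ∈ {a ∈ G.externalEdges | a.1 = e.1.1} := ⟨e.2, rfl⟩
  have m' : e'.1 ∈ {a ∈ G.externalEdges | a.1 = e.1.1} := ⟨e'.2, h.symm⟩
  apply Subtype.ext
  rcases hv : e.1.1 with v | x <;> rw [hv] at m m'
  · rcases G.rule_inl v with ⟨-, h₀⟩ | ⟨-, h₁⟩
    · exact (false_of_ncard h₀ m).elim
    · exact eq_of_ncard h₁ m m'
  · exact eq_of_ncard (G.rule_inr x).2.1 m m'

theorem head_injective : Function.Injective G.head := by
  intro e e' h
  have hv : e.1.2 = e'.1.2 := by rw [← vertex_head, h, vertex_head]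
  apply Subtype.ext
  rcases hx : e'.1.2 with v | x
  · have m : e.1 ∈ {a ∈ G.externalEdges | a.2 = Sum.inl v} := ⟨e.2, hv.trans hx⟩
    have m' : e'.1 ∈ {a ∈ G.externalEdges | a.2 = Sum.inl v} := ⟨e'.2, hx⟩
    rcases G.rule_inl v with ⟨h₁, -⟩ | ⟨h₀, -⟩
    · exact eq_of_ncard h₁ m m'
    · exact (false_of_ncard h₀ m).elim
  · have hl : G.IsUnivalent e.1.1 ↔ G.IsUnivalent e'.1.1 := by
      unfold head at h
      rw [hv, hx] at h
      simp only [Sum.inr.injEq, Prod.mk.injEq, true_and] at h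
      by_cases h₁ : G.IsUnivalent e.1.1 <;> by_cases h₂ : G.IsUnivalent e'.1.1 <;> simp_all
    by_cases h₂ : G.IsUnivalent e'.1.1
    · exact eq_of_ncard (G.rule_inr x).2.2 ⟨e.2, hv.trans hx, hl.2 h₂⟩ ⟨e'.2, hx, h₂⟩
    · exact eq_of_ncard (G.rule_inr_cycle x) ⟨e.2, hv.trans hx, fun h₃ => h₂ (hl.1 h₃)⟩
        ⟨e'.2, hx, h₂⟩

theorem tail_ne_head (e e' : G.externalEdges) : G.tail e ≠ G.head e' := by
  intro h
  have hv : e.1.1 = e'.1.2 := by rw [← vertex_tail, h, vertex_head]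
  rcases hx : e'.1.2 with v | x
  · have m : e.1 ∈ {a ∈ G.externalEdges | a.1 = Sum.inl v} := ⟨e.2, hv.trans hx⟩
    have m' : e'.1 ∈ {a ∈ G.externalEdges | a.2 = Sum.inl v} := ⟨e'.2, hx⟩
    rcases G.rule_inl v with ⟨-, h₀⟩ | ⟨h₀, -⟩
    · exact false_of_ncard h₀ m
    · exact false_of_ncard h₀ m'
  · unfold head tail at h
    rw [hv, hx] at h
    simp only [Sum.inr.injEq, Prod.mk.injEq, true_and] at h
    split_ifs at h <;> simp at h

theorem ends_bijective : Function.Bijective G.ends := by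
  constructor
  · rintro ⟨e, b⟩ ⟨e', b'⟩ h
    cases b <;> cases b' <;> simp only [ends, if_true, Bool.false_eq_true, if_false] at h
    · rw [G.out_unique e e' (by rw [← vertex_tail, h, vertex_tail])]
    · exact (G.tail_ne_head _ _ h).elim
    · exact (G.tail_ne_head _ _ h.symm).elim
    · rw [G.head_injective h]
  · have ht : ∀ e : G.externalEdges, G.ends (e, false) = G.tail e := fun e => by simp [ends]
    have hh : ∀ e : G.externalEdges, G.ends (e, true) = G.head e := fun e => by simp [ends]
    rintro (v | ⟨x, i⟩)
    · rcases G.rule_inl v with ⟨h₁, -⟩ | ⟨-, h₁⟩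
      · obtain ⟨e, he, hv⟩ := exists_of_ncard h₁
        exact ⟨(⟨e, he⟩, true), by rw [hh]; simp [head, hv]⟩
      · obtain ⟨e, he, hv⟩ := exists_of_ncard h₁
        exact ⟨(⟨e, he⟩, false), by rw [ht]; simp [tail, hv]⟩
    · fin_cases i
      · obtain ⟨e, he, hv, hu⟩ := exists_of_ncard (G.rule_inr_cycle x)
        exact ⟨(⟨e, he⟩, true), by rw [hh]; simp [head, hv, hu]⟩
      · obtain ⟨e, he, hv, hu⟩ := exists_of_ncard (G.rule_inr x).2.2
        exact ⟨(⟨e, he⟩, true), by rw [hh]; simp [head, hv, hu]⟩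
      · obtain ⟨e, he, hv⟩ := exists_of_ncard (G.rule_inr x).2.1
        exact ⟨(⟨e, he⟩, false), by rw [ht]; simp [tail, hv]⟩

end ends

/-- The ends of the external edges are the half-edges of the induced Jacobi diagram. -/
def endsEquiv [Finite I] [Finite X] : G.externalEdges × Bool ≃ HalfEdge I X :=
  Equiv.ofBijective G.ends G.ends_bijective

/-- The vertex-oriented Jacobi diagram `G_ρ` induced by a BCR diagram `G` with a total order on its
internal vertices: its edges are the external edges of `G`, its univalent (trivalent) vertices are
the internal (external) vertices of `G`. The cyclic order at an external vertex is: incoming edge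
of the cycle, leg, outgoing edge of the cycle. -/
abbrev toJacobi [LinearOrder I] [Fintype I] [Fintype X] : JacobiDiagram where
  U := I
  T := X
  opp := fun h => G.ends (Prod.map id not (G.endsEquiv.symm h))
  opp_opp := fun h => by
    obtain ⟨⟨a, b⟩, rfl⟩ := G.endsEquiv.surjective h
    have e : ∀ q, G.endsEquiv.symm (G.ends q) = q := G.endsEquiv.symm_apply_apply
    rw [Equiv.symm_apply_apply, e]
    simp [endsEquiv]
  no_loop := fun h => by
    obtain ⟨⟨e, b⟩, rfl⟩ := G.endsEquiv.surjective h
    rw [Equiv.symm_apply_apply]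
    have hne := G.ne e.1 (Or.inr e.2)
    cases b <;> simp [endsEquiv, ends, vertex_head, vertex_tail, hne, hne.symm]

end BCRDiagram

/-! ## The weight of a Jacobi diagram -/

/-- The permutation of half-edges that acts by `π t` around each trivalent vertex `t`. -/
def shuffle {U T : Type} (π : T → Equiv.Perm (Fin 3)) : HalfEdge U T → HalfEdge U T :=
  Sum.map id (fun p => (p.1, π p.1 p.2))

/-- The ordered numbered BCR diagrams `(G, σ, ρ)` such that `(G_ρ, j_{ρ,σ})` coincides with `(Γ, j)`
up to the orientation of the trivalent vertices and the orientation of the edges. As `G_ρ` and `Γ`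
coincide, the internal and external vertices of `G` are the univalent and trivalent vertices of `Γ`,
and `ρ` is the order of `Γ.U`. The coincidence is expressed by relabellings `perm t` of the three
half-edges around each trivalent vertex `t`, which are determined by `(G, σ)`: see `Lift.eq_of_diagram_number`. -/
structure Lift (Γ : JacobiDiagram) (j : Γ.Numbering) where
  diagram : BCRDiagram Γ.U Γ.T
  number : diagram.externalEdges ↪ Fin (3 * Γ.degree)
  perm : Γ.T → Equiv.Perm (Fin 3)
  opp_eq : ∀ h, Γ.opp (shuffle perm h) = shuffle perm (diagram.toJacobi.opp h)
  number_eq : ∀ e, j (Γ.edge (shuffle perm (diagram.tail e))) = number e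

namespace Lift

variable {Γ : JacobiDiagram} {j : Γ.Numbering}

theorem eq_of_diagram_number (L L' : Lift Γ j) (h₁ : L.diagram = L'.diagram)
    (h₂ : HEq L.number L'.number) : L = L' := by
  obtain ⟨G, σ, π, hπ, hσ⟩ := L
  obtain ⟨G', σ', π', hπ', hσ'⟩ := L'
  obtain rfl : G = G' := h₁
  obtain rfl : σ = σ' := eq_of_heq h₂
  have hv : ∀ (ϖ : Γ.T → Equiv.Perm (Fin 3)) (h : HalfEdge Γ.U Γ.T),
      (shuffle ϖ h).vertex = h.vertex := by
    rintro ϖ (u | ⟨t, i⟩) <;> rfl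
  have key : ∀ h : HalfEdge Γ.U Γ.T, shuffle π h = shuffle π' h := by
    have ht : ∀ e, shuffle π (G.tail e) = shuffle π' (G.tail e) := by
      intro e
      rcases (Γ.edge_eq_iff _ _).1 (j.injective ((hσ e).trans (hσ' e).symm)) with h | h
      · exact h
      · exact (Γ.no_loop _ (by rw [← h, hv, hv])).elim
    intro h
    obtain ⟨⟨e, b⟩, rfl⟩ := G.endsEquiv.surjective h
    have e₁ : G.endsEquiv (e, false) = G.tail e := by simp [BCRDiagram.endsEquiv, BCRDiagram.ends]
    cases b
    · rw [e₁]; exact ht e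
    · have e₂ : G.toJacobi.opp (G.tail e) = G.endsEquiv (e, true) := by
        rw [← e₁]
        simp [BCRDiagram.endsEquiv]
      rw [← e₂, ← hπ, ← hπ', ht]
  have : π = π' := by
    funext t
    ext i
    have := key (Sum.inr (t, i))
    simp only [shuffle, Sum.map_inr, Sum.inr.injEq, Prod.mk.injEq, true_and] at this
    rw [this]
  subst this
  rfl

instance finite_diagram (I X : Type) [Finite I] [Finite X] : Finite (BCRDiagram I X) :=
  Finite.of_injective (fun G : BCRDiagram I X => (G.internalEdges, G.externalEdges)) (by
    rintro ⟨⟩ ⟨⟩ h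
    simp_all)

instance : Finite (Lift Γ j) := by
  refine Finite.of_injective
    (β := Σ G : BCRDiagram Γ.U Γ.T, (G.externalEdges ↪ Fin (3 * Γ.degree)))
    (fun L => ⟨L.diagram, L.number⟩) fun L L' h => ?_
  exact eq_of_diagram_number L L' (congrArg Sigma.fst h) (Sigma.mk.inj h).2

/-- The sign `ε₃(Γ, G, ρ)`: `-1` to the number of trivalent vertices at which the orientations of
`G_ρ` and of `Γ` differ, so that `[G_ρ] = ε₃(Γ, G, ρ) [Γ]`. -/
def sign₃ (L : Lift Γ j) : ℝ := ∏ t : Γ.T, ((Equiv.Perm.sign (L.perm t) : ℤ) : ℝ)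

end Lift

/-- The weight `w_BCR(Γ, j)`. -/
def weightBCR (Γ : JacobiDiagram) (j : Γ.Numbering) : ℝ :=
  ∑ᶠ L : Lift Γ j, L.diagram.sign₁ * L.diagram.sign₂ * L.sign₃ /
    (2 : ℝ) ^ (2 * (Γ.degree : ℤ) - (Nat.card Γ.Edge : ℤ))

end BCR

end

noncomputable section

namespace BCR

open JacobiDiagram

/-! ## State sums -/

/-! Both sides of the formula are state sums of the same shape. A state of a diagram gives every
half-edge a status (head or tail, leg or part of a cycle) and adds internal edges between univalent
vertices; its weight is a product of local signs times `f c`, where `c` is the number of components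
after the internal edges are added. For `f = indicatorOne` only connected states count, and those of
nonzero weight are exactly the lifts of the diagram to BCR diagrams (`weightBCR_eq`). For `f n =
(-1) ^ n` the sum is the Conway weight system (`isConwayWeightSystem_stateLinear`).

For every `f` the normalized sum respects isomorphism, AS, IHX and STU, so it descends to a linear
form `stateLinear f`. In IHX the terms cancel after adding the states in which the distinguished
edge is reversed (`triSign_ihx`). In STU, exchanging adjacent univalent vertices `v`, `w` changes
the sign of precisely the states with exactly one internal edge between them; contracting that edge
gives the states of the merged diagram (`stateSum_stu`).

On a chord diagram a state is a permutation of the chords together with two choices of an end on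
each chord, and its components are the cycles of the permutation. Summing over the ends leaves
products of entries of the antisymmetric intersection matrix (`stateSum_chord`). With `f n = (-1) ^
n` the result is the determinant of this matrix. The identity `det (1 + A B) = det (1 + B A)` turns
it into the determinant of a matrix recording which arc of the surgered line continues which; this
is `1` if the surgered line is connected and `0` otherwise (`det_intersection`,
`stateForm_chord_conway`).

The two forms are then compared on the three summands. On a connected diagram every state has one
component, so they differ by the factor `f 1 = -1` (`stateForm_of_connected`). On products the form
for `indicatorOne` vanishes: STU reduces the claim to chord diagrams, where chords of different
factors do not intersect (`IsSplit.stateForm_eq_zero`). On diagrams with a trivalent component all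
weights vanish, because a leg would have to start inside that component. The three summands span, by
sorting the univalent vertices with STU (`cls_mem_sup`). Directness of the splitting is not needed:
`stateLinear_of_isConnectedPart` yields the same value for every possible connected component `p` of
`x`. -/

/-- The status of a half-edge of a diagram. At a univalent vertex, the two entries say whether an
internal edge leaves and whether an internal edge arrives. Along the cycles, heads of edges have
status `(true, false)` and tails `(false, true)`; heads of legs have status `(true, true)` and
tails of legs `(false, false)`. -/
abbrev Status : Type := Bool × Bool

/-- The status of the other half of an edge. -/
def Status.opposite (x : Status) : Status := (!x.1, !x.2)

/-- The sign of the orientation at a trivalent vertex, whose half-edges must be an incoming edge, a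
leg and an outgoing edge. -/
def triSign (x y z : Status) : ℤ :=
  if (x, y, z) = ((true, false), (true, true), (false, true)) ∨
     (x, y, z) = ((true, true), (false, true), (true, false)) ∨
     (x, y, z) = ((false, true), (true, false), (true, true)) then 1
  else if (x, y, z) = ((false, true), (true, true), (true, false)) ∨
     (x, y, z) = ((true, true), (true, false), (false, true)) ∨
     (x, y, z) = ((true, false), (false, true), (true, true)) then -1
  else 0

/-- The sign of an internal trivalent vertex, at a univalent vertex of the Jacobi diagram. -/
def legSign (x : Status) : ℝ := if x = (true, true) then -1 else 1

/-- The sign of `q - p`. -/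
def stepSign {U : Type} [LinearOrder U] (p q : U) : ℝ := if p < q then 1 else if q < p then -1 else 0

/-- `E` is the graph of a bijection between the elements whose status has first entry `true` and
those whose status has second entry `true`. -/
structure IsMatching {U : Type} (s : U → Status) (E : Finset (U × U)) : Prop where
  src : ∀ p, (s p).1 = true ↔ ∃ q, (p, q) ∈ E
  tgt : ∀ q, (s q).2 = true ↔ ∃ p, (p, q) ∈ E
  src_unique : ∀ p q q', (p, q) ∈ E → (p, q') ∈ E → q = q'
  tgt_unique : ∀ p p' q, (p, q) ∈ E → (p', q) ∈ E → p = p'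

/-- Adjacency of vertices by the edges of a diagram and by the additional edges `E`. -/
def VertexRel {U T : Type} (opp : HalfEdge U T → HalfEdge U T) (E : Finset (U × U))
    (a b : U ⊕ T) : Prop :=
  (∃ h : HalfEdge U T, h.vertex = a ∧ (opp h).vertex = b) ∨
    ∃ e ∈ E, a = Sum.inl e.1 ∧ b = Sum.inl e.2

/-- The number of components of the graph with additional edges `E`. -/
def componentCount {U T : Type} (opp : HalfEdge U T → HalfEdge U T) (E : Finset (U × U)) : ℕ :=
  Nat.card (Quot (VertexRel opp E))

/-- Statuses that are opposite on the two halves of every edge, with a matching. -/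
def IsState {U T : Type} (opp : HalfEdge U T → HalfEdge U T) (s : HalfEdge U T → Status)
    (E : Finset (U × U)) : Prop :=
  (∀ h, s (opp h) = (s h).opposite) ∧ IsMatching (fun u => s (Sum.inl u)) E

section
open Classical

/-- The contribution of a state. -/
def stateWeight {U T : Type} [LinearOrder U] [Fintype U] [Fintype T] (f : ℕ → ℝ)
    (opp : HalfEdge U T → HalfEdge U T) (s : HalfEdge U T → Status) (E : Finset (U × U)) : ℝ :=
  if IsState opp s E then
    (∏ t : T, (triSign (s (Sum.inr (t, 0))) (s (Sum.inr (t, 1))) (s (Sum.inr (t, 2))) : ℝ)) *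
      (∏ u : U, legSign (s (Sum.inl u))) * (∏ e ∈ E, stepSign e.1 e.2) * f (componentCount opp E)
  else 0

/-- The unnormalized state sum. -/
def stateSum {U T : Type} [LinearOrder U] [Fintype U] [Fintype T] (f : ℕ → ℝ)
    (opp : HalfEdge U T → HalfEdge U T) : ℝ :=
  ∑ x : (HalfEdge U T → Status) × Finset (U × U), stateWeight f opp x.1 x.2

end

/-- The number of edges of a diagram with `n` univalent and `t` trivalent vertices. -/
def edgeNumber (n t : ℕ) : ℕ := (n + 3 * t) / 2

/-- The normalization of the state sum. -/
def normalization (n t : ℕ) : ℝ :=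
  (-1) ^ (edgeNumber n t + t) * (2 : ℝ) ^ ((edgeNumber n t : ℤ) - (n + t))

/-- The state sum of a Jacobi diagram, in which every component of a state gives one factor of the
argument of `f`. -/
def stateForm (f : ℕ → ℝ) (Γ : JacobiDiagram) : ℝ :=
  normalization (Fintype.card Γ.U) (Fintype.card Γ.T) * stateSum f Γ.opp

/-! ### Transport of states -/

/-- Only the generated equivalence relations have to correspond. This leeway is used when half-edges
move between vertices of the same component. -/
theorem card_quot_eq {X X' : Type} (V : X ≃ X') {r : X → X → Prop} {r' : X' → X' → Prop}
    (h : ∀ a b, r a b → Relation.EqvGen r' (V a) (V b))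
    (h' : ∀ a b, r' a b → Relation.EqvGen r (V.symm a) (V.symm b)) :
    Nat.card (Quot r) = Nat.card (Quot r') := by
  refine Nat.card_congr
    ⟨Quot.lift (fun a => Quot.mk r' (V a)) fun a b hab => Quot.eqvGen_sound (h a b hab),
      Quot.lift (fun a => Quot.mk r (V.symm a)) fun a b hab => Quot.eqvGen_sound (h' a b hab),
      ?_, ?_⟩
  · rintro ⟨a⟩; simp
  · rintro ⟨a⟩; simp

section transport

variable {U T U' T' : Type} {opp : HalfEdge U T → HalfEdge U T}
  {opp' : HalfEdge U' T' → HalfEdge U' T'} (a : U ≃ U') (φ : HalfEdge U T ≃ HalfEdge U' T')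

/-- The transport of a matching along a bijection. -/
abbrev mapMatching (a : U ≃ U') : Finset (U × U) ≃ Finset (U' × U') :=
  (a.prodCongr a).finsetCongr

theorem mem_mapMatching (E : Finset (U × U)) (p q : U) :
    (a p, a q) ∈ mapMatching a E ↔ (p, q) ∈ E := by
  simp [mapMatching]

theorem mapMatching_refl (E : Finset (U × U)) : mapMatching (Equiv.refl U) E = E := by
  ext ⟨p, q⟩
  exact mem_mapMatching (Equiv.refl U) E p q

theorem isMatching_map (s : U → Status) (E : Finset (U × U)) :
    IsMatching (fun u => s (a.symm u)) (mapMatching a E) ↔ IsMatching s E := by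
  have key : ∀ p q, (p, q) ∈ mapMatching a E ↔ (a.symm p, a.symm q) ∈ E := fun p q => by
    rw [← mem_mapMatching a]; simp
  constructor
  · rintro ⟨h1, h2, h3, h4⟩
    refine ⟨fun p => ?_, fun q => ?_, fun p q q' h h' => ?_, fun p p' q h h' => ?_⟩
    · simpa [key, a.symm.surjective.exists] using h1 (a p)
    · simpa [key, a.symm.surjective.exists] using h2 (a q)
    · exact a.injective (h3 (a p) (a q) (a q') (by simpa [key]) (by simpa [key]))
    · exact a.injective (h4 (a p) (a p') (a q) (by simpa [key]) (by simpa [key]))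
  · rintro ⟨h1, h2, h3, h4⟩
    refine ⟨fun p => ?_, fun q => ?_, fun p q q' h h' => ?_, fun p p' q h h' => ?_⟩
    · rw [h1]; simp [a.surjective.exists]
    · rw [h2]; simp [a.surjective.exists]
    · exact a.symm.injective (h3 _ _ _ ((key _ _).1 h) ((key _ _).1 h'))
    · exact a.symm.injective (h4 _ _ _ ((key _ _).1 h) ((key _ _).1 h'))

theorem isState_map (ha : ∀ u, φ (Sum.inl u) = Sum.inl (a u)) (ho : ∀ h, opp' (φ h) = φ (opp h))
    (s : HalfEdge U T → Status) (E : Finset (U × U)) :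
    IsState opp' (s ∘ φ.symm) (mapMatching a E) ↔ IsState opp s E := by
  have ha' : ∀ u, φ.symm (Sum.inl u) = Sum.inl (a.symm u) := fun u => by
    rw [Equiv.symm_apply_eq, ha]; simp
  unfold IsState
  simp only [Function.comp_apply, ha']
  rw [isMatching_map a (fun u => s (Sum.inl u))]
  refine and_congr_left fun _ => ?_
  rw [← φ.forall_congr_right]
  simp [ho]

open Classical in
theorem stateSum_map [LinearOrder U] [Fintype U] [Fintype T] [LinearOrder U'] [Fintype U']
    [Fintype T'] (f : ℕ → ℝ) :
    stateSum f opp' = ∑ x : (HalfEdge U T → Status) × Finset (U × U),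
      stateWeight f opp' (x.1 ∘ φ.symm) (mapMatching a x.2) := by
  unfold stateSum
  exact (Fintype.sum_equiv ((Equiv.arrowCongr φ (Equiv.refl _)).prodCongr (mapMatching a)) _ _
    fun x => rfl).symm

/-- The map `φ` on half-edges need not be compatible with `V`: it suffices that it keeps each
half-edge in the same component. IHX needs this, since there half-edges pass from one vertex to
another. -/
theorem componentCount_map (V : U ⊕ T ≃ U' ⊕ T') (ho : ∀ h, opp' (φ h) = φ (opp h))
    (hV : ∀ u, V (Sum.inl u) = Sum.inl (a u))
    (E : Finset (U × U))
    (h₁ : ∀ h : HalfEdge U T, Relation.EqvGen (VertexRel opp E) (V.symm (φ h).vertex) h.vertex)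
    (h₂ : ∀ h : HalfEdge U T, Relation.EqvGen (VertexRel opp' (mapMatching a E)) (φ h).vertex
      (V h.vertex)) :
    componentCount opp' (mapMatching a E) = componentCount opp E := by
  symm
  apply card_quot_eq V
  · rintro x y (⟨h, rfl, rfl⟩ | ⟨e, he, rfl, rfl⟩)
    · refine ((h₂ h).symm).trans _ _ _ (.trans _ _ _ (.rel _ _ (Or.inl ⟨φ h, rfl, rfl⟩)) ?_)
      rw [ho]; exact h₂ _
    · refine .rel _ _ (Or.inr ⟨(a e.1, a e.2), (mem_mapMatching a E _ _).2 he, ?_, ?_⟩)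
      · simp [hV]
      · simp [hV]
  · have hV' : ∀ u, V.symm (Sum.inl u) = Sum.inl (a.symm u) := fun u => by
      rw [Equiv.symm_apply_eq, hV]; simp
    rintro x y (⟨h, rfl, rfl⟩ | ⟨e, he, rfl, rfl⟩)
    · obtain ⟨h, rfl⟩ := φ.surjective h
      refine (h₁ h).trans _ _ _ (.trans _ _ _ (.rel _ _ (Or.inl ⟨h, rfl, rfl⟩)) ?_)
      rw [ho]; exact (h₁ _).symm
    · obtain ⟨p, hp⟩ := a.surjective e.1
      obtain ⟨q, hq⟩ := a.surjective e.2
      refine .rel _ _ (Or.inr ⟨(p, q), (mem_mapMatching a E _ _).1 ?_, ?_, ?_⟩)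
      · rw [hp, hq]; exact he
      · rw [← hp, hV']; simp
      · rw [← hq, hV']; simp

theorem componentCount_map_of_vertex (V : U ⊕ T ≃ U' ⊕ T') (ho : ∀ h, opp' (φ h) = φ (opp h))
    (hV : ∀ u, V (Sum.inl u) = Sum.inl (a u)) (hφ : ∀ h, (φ h).vertex = V h.vertex)
    (E : Finset (U × U)) :
    componentCount opp' (mapMatching a E) = componentCount opp E := by
  apply componentCount_map a φ V ho hV E
  · intro h; rw [hφ]; simp only [Equiv.symm_apply_apply]; exact .refl _
  · intro h; rw [hφ]; exact .refl _

theorem prod_mapMatching [LinearOrder U] [LinearOrder U'] (g : U' × U' → ℝ) (E : Finset (U × U)) :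
    ∏ e ∈ mapMatching a E, g e = ∏ e ∈ E, g (a e.1, a e.2) := by
  simp [mapMatching, Prod.map]

theorem prod_legSign_map [Fintype U] [Fintype U'] (ha : ∀ u, φ (Sum.inl u) = Sum.inl (a u))
    (s : HalfEdge U T → Status) :
    ∏ u, legSign ((s ∘ φ.symm) (Sum.inl u)) = ∏ u, legSign (s (Sum.inl u)) := by
  refine (Fintype.prod_equiv a _ _ fun u => ?_).symm
  rw [← ha]; simp

end transport

/-! ### Local signs; invariance under isomorphism and AS. -/

theorem triSign_rotate (x y z : Status) : triSign y z x = triSign x y z := by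
  revert x y z; decide

theorem triSign_sub (y : Fin 3 → Status) (k : Fin 3) :
    triSign (y (0 - k)) (y (1 - k)) (y (2 - k)) = triSign (y 0) (y 1) (y 2) := by
  fin_cases k
  · rfl
  · exact (triSign_rotate (y 2) (y 0) (y 1)).symm
  · exact triSign_rotate (y 0) (y 1) (y 2)

theorem triSign_swap (x y z : Status) : triSign x z y = - triSign x y z := by
  revert x y z; decide

/-- For a fixed status `g` the three products need not add up to zero. They do once the terms with
`g` replaced by its opposite, that is with the middle edge reversed, are included. -/
theorem triSign_ihx (g x y z o : Status) :
    (triSign g x y * triSign g.opposite z o + triSign g z x * triSign g.opposite y o +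
      triSign g y z * triSign g.opposite x o) +
    (triSign g.opposite x y * triSign g z o + triSign g.opposite z x * triSign g y o +
      triSign g.opposite y z * triSign g x o) = 0 := by
  revert g x y z o; decide

theorem stateForm_iso (f : ℕ → ℝ) {Γ Γ' : JacobiDiagram} (h : Γ.Iso Γ') :
    stateForm f Γ = stateForm f Γ' := by
  obtain ⟨a, g, r, ho⟩ := h
  let φ : HalfEdge Γ.U Γ.T ≃ HalfEdge Γ'.U Γ'.T := Equiv.sumCongr a.toEquiv
    ⟨fun p => (g p.1, p.2 + r p.1), fun p => (g.symm p.1, p.2 - r (g.symm p.1)),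
      fun p => by simp, fun p => by simp⟩
  have ho' : ∀ h, Γ'.opp (φ h) = φ (Γ.opp h) := ho
  have hT : ∀ t i, φ.symm (Sum.inr (g t, i)) = Sum.inr (t, i - r t) := fun t i => by
    simp [φ]
  unfold stateForm
  rw [Fintype.card_congr a.toEquiv, Fintype.card_congr g, stateSum_map (opp' := Γ'.opp) a.toEquiv φ]
  congr 1
  refine Finset.sum_congr rfl fun x _ => ?_
  unfold stateWeight
  rw [isState_map a.toEquiv φ (fun u => rfl) ho', prod_legSign_map a.toEquiv φ (fun u => rfl),
    prod_mapMatching a.toEquiv, componentCount_map_of_vertex (opp := Γ.opp) a.toEquiv φ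
      (Equiv.sumCongr a.toEquiv g) ho' (fun u => rfl)]
  · congr 4
    · refine Fintype.prod_equiv g _ _ fun t => ?_
      symm
      simp only [Function.comp_apply, hT]
      exact congrArg _ (triSign_sub (fun i => x.1 (Sum.inr (t, i))) (r t))
    · funext e
      simp [stepSign]
  · rintro (u | ⟨t, i⟩) <;> rfl

open Classical in
theorem reversal_symm {U T : Type} (t : T) :
    (reversal t).symm = (reversal t : Equiv.Perm (HalfEdge U T)) := by
  unfold reversal
  rw [Equiv.symm_swap]

theorem reversal_apply {U T : Type} (t : T) :
    reversal t (Sum.inr (t, 0)) = (Sum.inr (t, 0) : HalfEdge U T) ∧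
    reversal t (Sum.inr (t, 1)) = (Sum.inr (t, 2) : HalfEdge U T) ∧
    reversal t (Sum.inr (t, 2)) = (Sum.inr (t, 1) : HalfEdge U T) := by
  simp [reversal, Equiv.swap_apply_def]

theorem reversal_apply_of_ne {U T : Type} (t : T) {h : HalfEdge U T}
    (hh : h.vertex ≠ Sum.inr t) : reversal t h = h := by
  rcases h with u | ⟨t', i⟩
  · simp [reversal, Equiv.swap_apply_def]
  · simp only [HalfEdge.vertex, Sum.map_inr, ne_eq, Sum.inr.injEq] at hh
    simp [reversal, Equiv.swap_apply_def, hh]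

open Classical in
theorem stateForm_reverse (f : ℕ → ℝ) (Γ : JacobiDiagram) (t : Γ.T) :
    stateForm f (Γ.reverse t) = - stateForm f Γ := by
  unfold stateForm
  rw [← mul_neg]
  congr 1
  have hφ : ∀ u : Γ.U, reversal t (Sum.inl u) = Sum.inl u := fun u =>
    reversal_apply_of_ne t (by simp [HalfEdge.vertex])
  have ho : ∀ h, (Γ.reverse t).opp (reversal t h) = reversal t (Γ.opp h) := fun h =>
    congrArg (fun k => reversal t (Γ.opp k)) (Equiv.symm_apply_apply _ _)
  rw [show stateSum f (Γ.reverse t).opp = _ from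
    stateSum_map (U := Γ.U) (T := Γ.T) (U' := Γ.U) (T' := Γ.T) (Equiv.refl _) (reversal t) f]
  unfold stateSum
  rw [← Finset.sum_neg_distrib]
  refine Finset.sum_congr rfl fun x _ => ?_
  unfold stateWeight
  rw [isState_map (opp := Γ.opp) (Equiv.refl _) (reversal t) hφ ho,
    prod_legSign_map (Equiv.refl _) (reversal t) hφ, componentCount_map_of_vertex (opp := Γ.opp)
      (Equiv.refl _) (reversal t) (Equiv.refl _) ho (fun u => rfl) (vertex_reversal t)]
  split_ifs
  · rw [← neg_mul, ← neg_mul, ← neg_mul]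
    congr 3
    · rw [← Finset.mul_prod_erase _ _ (Finset.mem_univ t),
        ← Finset.mul_prod_erase _ _ (Finset.mem_univ t), ← neg_mul]
      congr 1
      · simp only [Function.comp_apply, reversal_symm, reversal_apply]
        rw [triSign_swap]
        push_cast; rfl
      · refine Finset.prod_congr rfl fun t' ht' => ?_
        have hne : t' ≠ t := Finset.ne_of_mem_erase ht'
        have : ∀ i, (reversal t).symm (Sum.inr (t', i)) = (Sum.inr (t', i) : HalfEdge Γ.U Γ.T) :=
          fun i => by
            rw [reversal_symm]; exact reversal_apply_of_ne t (by simp [HalfEdge.vertex, hne])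
        simp only [Function.comp_apply, this]
    · rw [mapMatching_refl]
  · simp

/-! ### The IHX relation for state sums. -/

section ihx

variable {U T : Type}

theorem threeCycle_apply {a b : T} (hab : a ≠ b) (i : Fin 3) :
    threeCycle a b (Sum.inr (a, i)) = (if i = 0 then Sum.inr (a, 0) else
      if i = 1 then Sum.inr (a, 2) else Sum.inr (b, 1) : HalfEdge U T) ∧
    threeCycle a b (Sum.inr (b, i)) = (if i = 1 then Sum.inr (a, 1) else Sum.inr (b, i) :
      HalfEdge U T) := by
  classical
  unfold threeCycle
  fin_cases i <;> simp [Equiv.swap_apply_def, hab, hab.symm]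

theorem threeCycle_symm_apply {a b : T} (hab : a ≠ b) (i : Fin 3) :
    (threeCycle a b).symm (Sum.inr (a, i)) = (if i = 0 then Sum.inr (a, 0) else
      if i = 1 then Sum.inr (b, 1) else Sum.inr (a, 1) : HalfEdge U T) ∧
    (threeCycle a b).symm (Sum.inr (b, i)) = (if i = 1 then Sum.inr (a, 2) else Sum.inr (b, i) :
      HalfEdge U T) := by
  simp only [Equiv.symm_apply_eq]
  fin_cases i <;> simp [threeCycle_apply hab]

theorem threeCycle_apply_of_ne {a b : T} {h : HalfEdge U T} (ha : h.vertex ≠ Sum.inr a)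
    (hb : h.vertex ≠ Sum.inr b) : threeCycle a b h = h := by
  classical
  unfold threeCycle
  rcases h with u | ⟨t, i⟩
  · simp [Equiv.swap_apply_def]
  · simp only [HalfEdge.vertex, Sum.map_inr, ne_eq, Sum.inr.injEq] at ha hb
    simp [Equiv.swap_apply_def, ha, hb]

/-- A permutation of the half-edges at `a` and `b`. -/
structure IsLocal (a b : T) (φ : Equiv.Perm (HalfEdge U T)) : Prop where
  of_ne : ∀ h : HalfEdge U T, h.vertex ≠ Sum.inr a → h.vertex ≠ Sum.inr b → φ h = h
  fix_left : φ (Sum.inr (a, 0)) = Sum.inr (a, 0)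
  fix_right : φ (Sum.inr (b, 0)) = Sum.inr (b, 0)

theorem IsLocal.symm {a b : T} {φ : Equiv.Perm (HalfEdge U T)} (h : IsLocal a b φ) :
    IsLocal a b φ.symm where
  of_ne k h₁ h₂ := by rw [Equiv.symm_apply_eq, h.of_ne k h₁ h₂]
  fix_left := by rw [Equiv.symm_apply_eq, h.fix_left]
  fix_right := by rw [Equiv.symm_apply_eq, h.fix_right]

theorem isLocal_threeCycle {a b : T} (hab : a ≠ b) :
    IsLocal a b (threeCycle a b : Equiv.Perm (HalfEdge U T)) where
  of_ne _ h₁ h₂ := threeCycle_apply_of_ne h₁ h₂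
  fix_left := by simp [threeCycle_apply hab]
  fix_right := by simp [threeCycle_apply hab]

theorem IsLocal.vertex {a b : T} {φ : Equiv.Perm (HalfEdge U T)} (hφ : IsLocal a b φ)
    (h : HalfEdge U T) : (φ h).vertex = h.vertex ∨
      ((h.vertex = Sum.inr a ∨ h.vertex = Sum.inr b) ∧
        ((φ h).vertex = Sum.inr a ∨ (φ h).vertex = Sum.inr b)) := by
  by_cases h₁ : h.vertex = Sum.inr a ∨ h.vertex = Sum.inr b
  · by_cases h₂ : (φ h).vertex = Sum.inr a ∨ (φ h).vertex = Sum.inr b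
    · exact Or.inr ⟨h₁, h₂⟩
    · push Not at h₂
      have := hφ.of_ne _ h₂.1 h₂.2
      rw [φ.injective this]
      exact Or.inl rfl
  · push Not at h₁
    rw [hφ.of_ne _ h₁.1 h₁.2]
    exact Or.inl rfl

/-- The edge between `a` and `b` puts them in one component, so moving half-edges from one to the
other does not affect components. -/
theorem IsLocal.eqvGen {a b : T} {φ : Equiv.Perm (HalfEdge U T)} (hφ : IsLocal a b φ)
    {r : U ⊕ T → U ⊕ T → Prop} (hr : r (Sum.inr a) (Sum.inr b)) (h : HalfEdge U T) :
    Relation.EqvGen r (φ h).vertex h.vertex := by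
  rcases hφ.vertex h with e | ⟨e₁ | e₁, e₂ | e₂⟩
  · rw [e]; exact .refl _
  all_goals rw [e₁, e₂]
  · exact .refl _
  · exact .symm _ _ (.rel _ _ hr)
  · exact .rel _ _ hr
  · exact .refl _

end ihx

theorem prod_tri_eq {T : Type} [Fintype T] [DecidableEq T] {a b : T} (hab : a ≠ b) (g : T → ℝ) :
    ∏ t, g t = (g a * g b) * ∏ t ∈ (Finset.univ.erase a).erase b, g t := by
  rw [← Finset.mul_prod_erase _ _ (Finset.mem_univ a), ← Finset.mul_prod_erase (Finset.univ.erase a)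
    _ (Finset.mem_erase.2 ⟨hab.symm, Finset.mem_univ b⟩), mul_assoc]

open Classical in
-- Writes the sum of the rewired diagram over the states of the original one, so that the three sums
-- in IHX can be added term by term. Only the signs at `a` and `b` depend on `φ`.
theorem stateSum_rewire (f : ℕ → ℝ) (Γ : JacobiDiagram) {a b : Γ.T} (hne : a ≠ b)
    (hab : Γ.opp (Sum.inr (a, 0)) = Sum.inr (b, 0)) (φ : Equiv.Perm (HalfEdge Γ.U Γ.T))
    (hloc : IsLocal a b φ) (h₁ : ∀ h, (φ (Γ.opp h)).vertex ≠ (φ h).vertex) :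
    stateSum f (Γ.rewire φ h₁).opp = ∑ x : (HalfEdge Γ.U Γ.T → Status) × Finset (Γ.U × Γ.U),
      if IsState Γ.opp x.1 x.2 then
        (((triSign (x.1 (φ.symm (Sum.inr (a, 0)))) (x.1 (φ.symm (Sum.inr (a, 1))))
          (x.1 (φ.symm (Sum.inr (a, 2)))) *
         triSign (x.1 (φ.symm (Sum.inr (b, 0)))) (x.1 (φ.symm (Sum.inr (b, 1))))
          (x.1 (φ.symm (Sum.inr (b, 2)))) : ℤ) : ℝ) *
        ∏ t ∈ (Finset.univ.erase a).erase b, (triSign (x.1 (Sum.inr (t, 0)))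
          (x.1 (Sum.inr (t, 1))) (x.1 (Sum.inr (t, 2))) : ℝ)) *
        (∏ u, legSign (x.1 (Sum.inl u))) * (∏ e ∈ x.2, stepSign e.1 e.2) *
          f (componentCount Γ.opp x.2)
      else 0 := by
  have hφ : ∀ u : Γ.U, φ (Sum.inl u) = Sum.inl u := fun u =>
    hloc.of_ne _ (by simp [HalfEdge.vertex]) (by simp [HalfEdge.vertex])
  have ho : ∀ h, (Γ.rewire φ h₁).opp (φ h) = φ (Γ.opp h) := fun h =>
    congrArg (fun k => φ (Γ.opp k)) (Equiv.symm_apply_apply _ _)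
  rw [show stateSum f (Γ.rewire φ h₁).opp = _ from
    stateSum_map (U := Γ.U) (T := Γ.T) (U' := Γ.U) (T' := Γ.T) (Equiv.refl _) φ f]
  refine Finset.sum_congr rfl fun x _ => ?_
  unfold stateWeight
  rw [isState_map (opp := Γ.opp) (Equiv.refl _) φ hφ ho, prod_legSign_map (Equiv.refl _) φ hφ,
    componentCount_map (opp := Γ.opp) (Equiv.refl _) φ (Equiv.refl _) ho (fun u => rfl)]
  · rw [prod_tri_eq hne]
    push_cast
    congr 4
    · congr 1
      refine Finset.prod_congr rfl fun t ht => ?_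
      simp only [Finset.mem_erase] at ht
      have : ∀ i, φ.symm (Sum.inr (t, i)) = Sum.inr (t, i) := fun i =>
        hloc.symm.of_ne _ (by simp [HalfEdge.vertex, ht.2.1]) (by simp [HalfEdge.vertex, ht.1])
      simp only [Function.comp_apply, this]
    · rw [mapMatching_refl]
  · intro h
    exact hloc.eqvGen (Or.inl ⟨Sum.inr (a, 0), rfl, by rw [hab]; rfl⟩) h
  · intro h
    refine hloc.eqvGen (Or.inl ⟨Sum.inr (a, 0), rfl, ?_⟩) h
    have := ho (Sum.inr (a, 0))
    rw [hloc.fix_left, hab, hloc.fix_right] at this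
    rw [this]; rfl

open Classical in
theorem stateForm_ihx (f : ℕ → ℝ) (Γ : JacobiDiagram) (a b : Γ.T)
    (hab : Γ.opp (Sum.inr (a, 0)) = Sum.inr (b, 0))
    (h₁ : ∀ h, (threeCycle a b (Γ.opp h)).vertex ≠ (threeCycle a b h).vertex)
    (h₂ : ∀ h, ((threeCycle a b).symm (Γ.opp h)).vertex ≠ ((threeCycle a b).symm h).vertex) :
    stateForm f Γ + stateForm f (Γ.rewire (threeCycle a b) h₁) +
      stateForm f (Γ.rewire (threeCycle a b).symm h₂) = 0 := by
  have hne : a ≠ b := fun e => Γ.no_loop (Sum.inr (a, 0)) (by rw [hab, e])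
  have h₀ : ∀ h : HalfEdge Γ.U Γ.T, (Equiv.refl _ (Γ.opp h)).vertex ≠ (Equiv.refl _ h).vertex :=
    Γ.no_loop
  -- The first diagram is treated as its rewiring by the identity, which gives all three sums the
  -- same form.
  have e₀ : stateForm f Γ = stateForm f (Γ.rewire (Equiv.refl _) h₀) := rfl
  rw [e₀]
  unfold stateForm
  have hU : ∀ φ h, (Γ.rewire φ h).U = Γ.U := fun _ _ => rfl
  rw [stateSum_rewire f Γ hne hab _ ⟨fun _ _ _ => rfl, rfl, rfl⟩,
    stateSum_rewire f Γ hne hab _ (isLocal_threeCycle hne),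
    stateSum_rewire f Γ hne hab _ (isLocal_threeCycle hne).symm]
  change normalization (Fintype.card Γ.U) (Fintype.card Γ.T) * _ +
    normalization (Fintype.card Γ.U) (Fintype.card Γ.T) * _ +
    normalization (Fintype.card Γ.U) (Fintype.card Γ.T) * _ = 0
  rw [← mul_add, ← mul_add, ← Finset.sum_add_distrib, ← Finset.sum_add_distrib]
  apply mul_eq_zero_of_right
  -- `τ` exchanges the statuses of the two halves of the middle edge. It preserves states, and the
  -- total contribution of a state cancels that of its image.
  let τ : Equiv.Perm (HalfEdge Γ.U Γ.T) := Equiv.swap (Sum.inr (a, 0)) (Sum.inr (b, 0))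
  let F := (Equiv.arrowCongr τ (Equiv.refl Status)).prodCongr (Equiv.refl (Finset (Γ.U × Γ.U)))
  have half : ∀ g : (HalfEdge Γ.U Γ.T → Status) × Finset (Γ.U × Γ.U) → ℝ,
      (∀ x, g x + g (F x) = 0) → ∑ x, g x = 0 := fun g hg => by
    have h1 := Fintype.sum_equiv F (fun x => g (F x)) g fun x => rfl
    have h2 : ∑ x, g x + ∑ x, g (F x) = 0 := by
      rw [← Finset.sum_add_distrib]; exact Finset.sum_eq_zero fun x _ => hg x
    linarith
  apply half
  rintro ⟨s, E⟩
  have hF : F (s, E) = (fun h => s (τ h), E) := by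
    simp only [F, Equiv.prodCongr_apply, Prod.map, Equiv.refl_apply, Prod.mk.injEq, and_true]
    funext h
    simp [τ]
  have hba : Γ.opp (Sum.inr (b, 0)) = Sum.inr (a, 0) := by rw [← hab, Γ.opp_opp]
  have hτ : ∀ h, Γ.opp (τ h) = τ (Γ.opp h) := fun h => by
    by_cases h1 : h = Sum.inr (a, 0)
    · rw [h1, hab]; simp [τ, hba]
    by_cases h2 : h = Sum.inr (b, 0)
    · rw [h2, hba]; simp [τ, hab]
    have h3 : Γ.opp h ≠ Sum.inr (a, 0) := fun e => h2 (by rw [← Γ.opp_opp h, e, hab])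
    have h4 : Γ.opp h ≠ Sum.inr (b, 0) := fun e => h1 (by rw [← Γ.opp_opp h, e, hba])
    rw [Equiv.swap_apply_of_ne_of_ne h1 h2, Equiv.swap_apply_of_ne_of_ne h3 h4]
  have hS : IsState Γ.opp (fun h => s (τ h)) E ↔ IsState Γ.opp s E := by
    unfold IsState
    refine and_congr ?_ (by simp [τ, Equiv.swap_apply_def])
    rw [← τ.forall_congr_right]
    simp only [hτ]
    simp [τ]
  rw [hF]
  by_cases hx : IsState Γ.opp s E
  · simp only [hS, hx, if_true]
    have hb : s (Sum.inr (b, 0)) = (s (Sum.inr (a, 0))).opposite := by rw [← hab, hx.1]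
    have key := triSign_ihx (s (Sum.inr (a, 0))) (s (Sum.inr (a, 1))) (s (Sum.inr (a, 2)))
      (s (Sum.inr (b, 1))) (s (Sum.inr (b, 2)))
    rw [← hb] at key
    have key' := congrArg (Int.cast : ℤ → ℝ) key
    have hP : ∏ t ∈ (Finset.univ.erase a).erase b, (triSign (s (τ (Sum.inr (t, 0))))
          (s (τ (Sum.inr (t, 1)))) (s (τ (Sum.inr (t, 2)))) : ℝ) =
        ∏ t ∈ (Finset.univ.erase a).erase b, (triSign (s (Sum.inr (t, 0)))
          (s (Sum.inr (t, 1))) (s (Sum.inr (t, 2))) : ℝ) := by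
      refine Finset.prod_congr rfl fun t ht => ?_
      simp only [Finset.mem_erase] at ht
      simp [τ, Equiv.swap_apply_def, ht.1, ht.2.1]
    have hu : ∀ u, τ (Sum.inl u) = Sum.inl u := fun u => by simp [τ, Equiv.swap_apply_def]
    have ha0 : τ (Sum.inr (a, 0)) = Sum.inr (b, 0) := by simp [τ]
    have hb0 : τ (Sum.inr (b, 0)) = Sum.inr (a, 0) := by simp [τ]
    have ha1 : τ (Sum.inr (a, 1)) = Sum.inr (a, 1) := by simp [τ, Equiv.swap_apply_def]
    have ha2 : τ (Sum.inr (a, 2)) = Sum.inr (a, 2) := by simp [τ, Equiv.swap_apply_def]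
    have hb1 : τ (Sum.inr (b, 1)) = Sum.inr (b, 1) := by simp [τ, Equiv.swap_apply_def]
    have hb2 : τ (Sum.inr (b, 2)) = Sum.inr (b, 2) := by simp [τ, Equiv.swap_apply_def]
    rw [hP]
    simp only [hu, Equiv.symm_symm, Equiv.refl_symm, Equiv.refl_apply, (threeCycle_apply hne _).1,
      (threeCycle_apply hne _).2, (threeCycle_symm_apply hne _).1,
      (threeCycle_symm_apply hne _).2, if_true, Fin.reduceEq, if_false, ha0, ha1, ha2, hb0, hb1,
      hb2]
    push_cast at key' ⊢
    -- All six terms share every factor except the two signs at `a` and `b`; what remains after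
    -- factoring is `triSign_ihx`.
    rw [← add_mul, ← add_mul, ← add_mul, ← add_mul, ← add_mul, ← add_mul, ← add_mul, ← add_mul,
      ← add_mul, ← add_mul, ← add_mul, ← add_mul, ← add_mul, ← add_mul, ← add_mul, ← add_mul,
      ← add_mul, ← add_mul, ← add_mul, ← add_mul]
    rw [key']
    simp
  · simp [hS, hx]

/-! ### The STU relation for state sums -/

/-- `F` need not be an involution: reindexing shows that twice the sum is zero. -/
theorem sum_eq_zero_of_equiv {X : Type*} [Fintype X] (F : X ≃ X) (g : X → ℝ)
    (h : ∀ x, g x + g (F x) = 0) : ∑ x, g x = 0 := by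
  have h1 := Fintype.sum_equiv F (fun x => g (F x)) g fun x => rfl
  have h2 : ∑ x, g x + ∑ x, g (F x) = 0 := by
    rw [← Finset.sum_add_distrib]; exact Finset.sum_eq_zero fun x _ => h x
  linarith

/-! ### Adding an edge to a matching and removing it. -/

section matching

variable {U U' : Type} [DecidableEq U] {σ ρ : U' ↪ U} {p q : U}

/-- The matching with the additional edge `(p, q)`, whose other edges are given by `E`. -/
abbrev insertEdge (σ ρ : U' ↪ U) (p q : U) (E : Finset (U' × U')) : Finset (U × U) :=
  insert (p, q) (E.map (σ.prodMap ρ))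

theorem mem_insertEdge (hσ : ∀ x, σ x ≠ p) (E : Finset (U' × U')) (x y : U') :
    (σ x, ρ y) ∈ insertEdge σ ρ p q E ↔ (x, y) ∈ E := by
  simp [hσ]

/-- The embedding `σ` misses exactly `p` and `ρ` misses exactly `q`, so they enumerate the sources
and the targets left free by the edge `(p, q)`. Two embeddings are needed because contraction glues
the free source at `q` to the free target at `p`. -/
theorem isMatching_insertEdge (hσ : ∀ x, σ x ≠ p) (hσ' : ∀ x, x ≠ p → ∃ y, σ y = x)
    (hρ : ∀ x, ρ x ≠ q) (hρ' : ∀ x, x ≠ q → ∃ y, ρ y = x) (s : U → Status) (s' : U' → Status)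
    (h₁ : ∀ x, (s' x).1 = (s (σ x)).1) (h₂ : ∀ x, (s' x).2 = (s (ρ x)).2)
    (hp : (s p).1 = true) (hq : (s q).2 = true) (E : Finset (U' × U')) :
    IsMatching s (insertEdge σ ρ p q E) ↔ IsMatching s' E := by
  have mem : ∀ x y, (x, y) ∈ insertEdge σ ρ p q E ↔
      (x = p ∧ y = q) ∨ ∃ x' y', (x', y') ∈ E ∧ σ x' = x ∧ ρ y' = y := fun x y => by
    simp
  constructor
  · rintro ⟨a, b, c, d⟩
    refine ⟨fun x => ?_, fun y => ?_, fun x y y' h h' => ?_, fun x x' y h h' => ?_⟩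
    · rw [h₁, a]
      constructor
      · rintro ⟨y, h⟩
        rcases (mem _ _).1 h with ⟨e, -⟩ | ⟨x', y', h, e, -⟩
        · exact (hσ _ e).elim
        · exact ⟨y', by rwa [σ.injective e] at h⟩
      · rintro ⟨y, h⟩
        exact ⟨ρ y, (mem_insertEdge hσ E x y).2 h⟩
    · rw [h₂, b]
      constructor
      · rintro ⟨x, h⟩
        rcases (mem _ _).1 h with ⟨-, e⟩ | ⟨x', y', h, -, e⟩
        · exact (hρ _ e).elim
        · exact ⟨x', by rwa [ρ.injective e] at h⟩
      · rintro ⟨x, h⟩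
        exact ⟨σ x, (mem_insertEdge hσ E x y).2 h⟩
    · exact ρ.injective (c (σ x) _ _ ((mem_insertEdge hσ E _ _).2 h)
        ((mem_insertEdge hσ E _ _).2 h'))
    · exact σ.injective (d _ _ (ρ y) ((mem_insertEdge hσ E _ _).2 h)
        ((mem_insertEdge hσ E _ _).2 h'))
  · rintro ⟨a, b, c, d⟩
    refine ⟨fun x => ?_, fun y => ?_, fun x y y' h h' => ?_, fun x x' y h h' => ?_⟩
    · by_cases hx : x = p
      · subst hx
        exact ⟨fun _ => ⟨q, by simp⟩, fun _ => hp⟩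
      · obtain ⟨x, rfl⟩ := hσ' x hx
        rw [← h₁, a]
        constructor
        · rintro ⟨y, h⟩
          exact ⟨ρ y, (mem_insertEdge hσ E x y).2 h⟩
        · rintro ⟨y, h⟩
          rcases (mem _ _).1 h with ⟨e, -⟩ | ⟨x', y', h, e, -⟩
          · exact (hσ _ e).elim
          · exact ⟨y', by rwa [σ.injective e] at h⟩
    · by_cases hy : y = q
      · subst hy
        exact ⟨fun _ => ⟨p, by simp⟩, fun _ => hq⟩
      · obtain ⟨y, rfl⟩ := hρ' y hy
        rw [← h₂, b]
        constructor
        · rintro ⟨x, h⟩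
          exact ⟨σ x, (mem_insertEdge hσ E x y).2 h⟩
        · rintro ⟨x, h⟩
          rcases (mem _ _).1 h with ⟨-, e⟩ | ⟨x', y', h, -, e⟩
          · exact (hρ _ e).elim
          · exact ⟨x', by rwa [ρ.injective e] at h⟩
    · rcases (mem _ _).1 h with ⟨e, e'⟩ | ⟨x₁, y₁, k, e, e'⟩ <;>
        rcases (mem _ _).1 h' with ⟨f, f'⟩ | ⟨x₂, y₂, l, f, f'⟩
      · rw [e', f']
      · exact (hσ x₂ (f.trans e)).elim
      · exact (hσ x₁ (e.trans f)).elim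
      · obtain rfl : x₁ = x₂ := σ.injective (e.trans f.symm)
        rw [← e', ← f', c _ _ _ k l]
    · rcases (mem _ _).1 h with ⟨e, e'⟩ | ⟨x₁, y₁, k, e, e'⟩ <;>
        rcases (mem _ _).1 h' with ⟨f, f'⟩ | ⟨x₂, y₂, l, f, f'⟩
      · rw [e, f]
      · exact (hρ y₂ (f'.trans e')).elim
      · exact (hρ y₁ (e'.trans f')).elim
      · obtain rfl : y₁ = y₂ := ρ.injective (e'.trans f'.symm)
        rw [← e, ← f, d _ _ _ k l]

open Classical in
/-- The edges of a matching other than `(p, q)`. -/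
def removeEdge [Fintype U'] (σ ρ : U' ↪ U) (E : Finset (U × U)) : Finset (U' × U') :=
  Finset.univ.filter fun e => (σ e.1, ρ e.2) ∈ E

theorem mem_removeEdge [Fintype U'] (E : Finset (U × U)) (x y : U') :
    (x, y) ∈ removeEdge σ ρ E ↔ (σ x, ρ y) ∈ E := by
  simp [removeEdge]

theorem removeEdge_insertEdge [Fintype U'] (hσ : ∀ x, σ x ≠ p) (E : Finset (U' × U')) :
    removeEdge σ ρ (insertEdge σ ρ p q E) = E := by
  ext ⟨x, y⟩
  rw [mem_removeEdge, mem_insertEdge hσ]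

theorem insertEdge_removeEdge [Fintype U'] (hσ' : ∀ x, x ≠ p → ∃ y, σ y = x)
    (hρ' : ∀ x, x ≠ q → ∃ y, ρ y = x) {s : U → Status} {E : Finset (U × U)} (hE : IsMatching s E)
    (hpq : (p, q) ∈ E) : insertEdge σ ρ p q (removeEdge σ ρ E) = E := by
  ext ⟨x, y⟩
  simp only [Finset.mem_insert, Prod.mk.injEq, Finset.mem_map, Prod.exists, mem_removeEdge]
  constructor
  · rintro (⟨rfl, rfl⟩ | ⟨x', y', h, e⟩)
    · exact hpq
    · simp only [Function.Embedding.prodMap, Function.Embedding.coeFn_mk, Prod.map,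
        Prod.mk.injEq] at e
      rwa [e.1, e.2] at h
  · intro h
    by_cases hx : x = p
    · subst hx
      exact Or.inl ⟨rfl, hE.src_unique _ _ _ h hpq⟩
    · have hy : y ≠ q := fun e => hx (hE.tgt_unique _ _ _ (e ▸ h) hpq)
      obtain ⟨x, rfl⟩ := hσ' x hx
      obtain ⟨y, rfl⟩ := hρ' y hy
      exact Or.inr ⟨x, y, h, rfl⟩

end matching

/-! ### Contraction of an internal edge between two adjacent univalent vertices. -/

section stu

variable {U T : Type}

section
open Classical

/-- A section of the identification of `v` and `w`, which takes the value `x` at the double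
point. -/
def splitPoint {v w x : U} (hx : x = v ∨ x = w) : {y : U // y ≠ w} ↪ U where
  toFun y := if y.1 = v then x else y.1
  inj' := by
    rintro ⟨y, hy⟩ ⟨z, hz⟩ h
    ext
    dsimp only at h ⊢
    split_ifs at h with h₁ h₂ h₂
    · rw [h₁, h₂]
    · rcases hx with rfl | rfl
      · exact (h₂ h.symm).elim
      · exact (hz h.symm).elim
    · rcases hx with rfl | rfl
      · exact (h₁ h).elim
      · exact (hy h).elim
    · exact h

theorem splitPoint_apply {v w x : U} (hx : x = v ∨ x = w) (y : {y : U // y ≠ w}) :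
    splitPoint hx y = if y.1 = v then x else y.1 := rfl

/-- The status of the half-edges after the fusion of two univalent vertices. -/
def mergeStatus (v w : U) (s : HalfEdge U T → Status) :
    HalfEdge {x : U // x ≠ w} (Option T) → Status
  | Sum.inl x => if x.1 = v then
      Status.opposite (xor (s (Sum.inl v)).1 (s (Sum.inl w)).1,
        xor (s (Sum.inl v)).2 (s (Sum.inl w)).2)
      else s (Sum.inl x.1)
  | Sum.inr (none, i) => if i = 0 then (xor (s (Sum.inl v)).1 (s (Sum.inl w)).1,
        xor (s (Sum.inl v)).2 (s (Sum.inl w)).2)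
      else if i = 1 then s (Sum.inl w) else s (Sum.inl v)
  | Sum.inr (some t, i) => s (Sum.inr (t, i))

end

theorem mergeStatus_mergeHalf (v w : U) (s : HalfEdge U T → Status) (h : HalfEdge U T) :
    mergeStatus v w s (mergeHalf v w h) = s h := by
  rcases h with x | ⟨t, i⟩
  · by_cases hw : x = w
    · subst hw; simp [mergeHalf, mergeStatus]
    · by_cases hv : x = v
      · subst hv; simp [mergeHalf, mergeStatus, hw]
      · simp [mergeHalf, mergeStatus, hw, hv]
  · rfl

theorem mergeOpp_mergeHalf (opp : HalfEdge U T → HalfEdge U T) (v w : U) (hvw : v ≠ w)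
    (h : HalfEdge U T) : mergeOpp opp v w hvw (mergeHalf v w h) = mergeHalf v w (opp h) := by
  rcases h with x | ⟨t, i⟩
  · by_cases hw : x = w
    · subst hw; simp [mergeHalf, mergeOpp]
    · by_cases hv : x = v
      · subst hv; simp [mergeHalf, mergeOpp, hw]
      · simp [mergeHalf, mergeOpp, hw, hv]
  · simp [mergeHalf, mergeOpp]

theorem mergeHalf_cases (v w : U) (hvw : v ≠ w) (h : HalfEdge {x : U // x ≠ w} (Option T)) :
    h = Sum.inl ⟨v, hvw⟩ ∨ h = Sum.inr (none, 0) ∨ ∃ k, h = mergeHalf v w k := by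
  rcases h with ⟨x, hx⟩ | ⟨_ | t, i⟩
  · by_cases hv : x = v
    · subst hv; exact Or.inl rfl
    · exact Or.inr (Or.inr ⟨Sum.inl x, by simp [mergeHalf, hx, hv]⟩)
  · fin_cases i
    · exact Or.inr (Or.inl rfl)
    · exact Or.inr (Or.inr ⟨Sum.inl w, by simp [mergeHalf]⟩)
    · exact Or.inr (Or.inr ⟨Sum.inl v, by simp [mergeHalf, hvw]⟩)
  · exact Or.inr (Or.inr ⟨Sum.inr (t, i), by simp [mergeHalf]⟩)

open Classical in
theorem mergeOpp_new (opp : HalfEdge U T → HalfEdge U T) (v w : U) (hvw : v ≠ w) :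
    mergeOpp opp v w hvw (Sum.inl ⟨v, hvw⟩) = Sum.inr (none, 0) ∧
    mergeOpp opp v w hvw (Sum.inr (none, 0)) = Sum.inl ⟨v, hvw⟩ := by
  simp [mergeOpp]

/-- A status function on the merged diagram comes from the original one, if the statuses are
opposite on the new edge and have sum zero at the new vertex. -/
theorem mergeStatus_comp (v w : U) (hvw : v ≠ w)
    (s : HalfEdge {x : U // x ≠ w} (Option T) → Status)
    (h₀ : s (Sum.inl ⟨v, hvw⟩) = (s (Sum.inr (none, 0))).opposite)
    (h₁ : s (Sum.inr (none, 0)) =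
      (xor (s (Sum.inr (none, 2))).1 (s (Sum.inr (none, 1))).1,
        xor (s (Sum.inr (none, 2))).2 (s (Sum.inr (none, 1))).2)) :
    mergeStatus v w (s ∘ mergeHalf v w) = s := by
  have e₁ : mergeHalf v w (Sum.inl w : HalfEdge U T) = Sum.inr (none, 1) := by simp [mergeHalf]
  have e₂ : mergeHalf v w (Sum.inl v : HalfEdge U T) = Sum.inr (none, 2) := by
    simp [mergeHalf, hvw]
  funext h
  rcases mergeHalf_cases v w hvw h with rfl | rfl | ⟨k, rfl⟩
  · rw [h₀, h₁]
    simp [mergeStatus, e₁, e₂]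
  · rw [h₁]
    simp [mergeStatus, e₁, e₂]
  · rw [mergeStatus_mergeHalf]; rfl

theorem vertex_mergeHalf (v w : U) (hvw : v ≠ w) (h : HalfEdge U T) :
    ((h.vertex = Sum.inl v ∨ h.vertex = Sum.inl w) ∧ (mergeHalf v w h).vertex = Sum.inr none) ∨
    (∃ x : {x : U // x ≠ w}, x.1 ≠ v ∧ h.vertex = Sum.inl x.1 ∧
      (mergeHalf v w h).vertex = Sum.inl x) ∨
    ∃ t, h.vertex = Sum.inr t ∧ (mergeHalf v w h).vertex = Sum.inr (some t) := by
  rcases h with x | ⟨t, i⟩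
  · by_cases hw : x = w
    · subst hw; exact Or.inl ⟨Or.inr rfl, by simp [mergeHalf, HalfEdge.vertex]⟩
    · by_cases hv : x = v
      · subst hv; exact Or.inl ⟨Or.inl rfl, by simp [mergeHalf, HalfEdge.vertex, hw]⟩
      · exact Or.inr (Or.inl ⟨⟨x, hw⟩, hv, rfl, by simp [mergeHalf, HalfEdge.vertex, hw, hv]⟩)
  · exact Or.inr (Or.inr ⟨t, rfl, rfl⟩)

/-- The vertices of the merged diagram, seen in the original diagram. -/
def unmergeVertex (v w : U) : {x : U // x ≠ w} ⊕ Option T → U ⊕ T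
  | Sum.inl x => Sum.inl x.1
  | Sum.inr none => Sum.inl v
  | Sum.inr (some t) => Sum.inr t

open Classical in
/-- The vertices of a diagram, seen in the merged diagram. -/
def mergeVertex (v w : U) : U ⊕ T → {x : U // x ≠ w} ⊕ Option T
  | Sum.inl x => if h : x = w then Sum.inr none else if x = v then Sum.inr none
      else Sum.inl ⟨x, h⟩
  | Sum.inr t => Sum.inr (some t)

theorem mergeVertex_vertex (v w : U) (h : HalfEdge U T) :
    mergeVertex v w h.vertex = (mergeHalf v w h).vertex := by
  rcases h with x | ⟨t, i⟩
  · simp only [HalfEdge.vertex, Sum.map_inl, id, mergeVertex, mergeHalf]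
    split_ifs <;> rfl
  · rfl

/-- The edge `(p, q)` joins `v` to `w` in one graph; in the other, the new edge joins the fused
univalent vertex to the new trivalent vertex. The maps `mergeVertex` and `unmergeVertex` are not
inverse on vertices, but they become so on components. -/
theorem componentCount_merge [DecidableEq U] (opp : HalfEdge U T → HalfEdge U T) {v w p q : U} (hvw : v ≠ w)
    (hpq : (p = v ∧ q = w) ∨ (p = w ∧ q = v)) (hp : p = v ∨ p = w) (hq : q = v ∨ q = w)
    (E : Finset ({x : U // x ≠ w} × {x : U // x ≠ w})) :
    componentCount (mergeOpp opp v w hvw) E =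
      componentCount opp (insertEdge (splitPoint hq) (splitPoint hp) p q E) := by
  set E₁ := insertEdge (splitPoint hq) (splitPoint hp) p q E with hE₁
  set r := VertexRel opp E₁
  set r' := VertexRel (mergeOpp opp v w hvw) E
  have hr : Relation.EqvGen r (Sum.inl v) (Sum.inl w) := by
    have : Relation.EqvGen r (Sum.inl p) (Sum.inl q) :=
      .rel _ _ (Or.inr ⟨(p, q), by simp [hE₁], rfl, rfl⟩)
    rcases hpq with ⟨rfl, rfl⟩ | ⟨rfl, rfl⟩
    · exact this
    · exact this.symm
  have hr' : Relation.EqvGen r' (Sum.inl ⟨v, hvw⟩) (Sum.inr none) :=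
    .rel _ _ (Or.inl ⟨Sum.inl ⟨v, hvw⟩, rfl, by rw [(mergeOpp_new opp v w hvw).1]; rfl⟩)
  have hsp : ∀ {x : U} (hx : x = v ∨ x = w) (y : {y : U // y ≠ w}),
      Relation.EqvGen r (Sum.inl y.1) (Sum.inl (splitPoint hx y)) := by
    intro x hx y
    rw [splitPoint_apply]
    split_ifs with h
    · rw [h]
      rcases hx with rfl | rfl
      · exact .refl _
      · exact hr
    · exact .refl _
  have hsp' : ∀ {x : U} (hx : x = v ∨ x = w) (y : {y : U // y ≠ w}),
      Relation.EqvGen r' (Sum.inl y) (mergeVertex v w (Sum.inl (splitPoint hx y))) := by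
    intro x hx y
    rw [splitPoint_apply]
    split_ifs with h
    · obtain ⟨y, hy⟩ := y
      dsimp only at h
      subst h
      have : mergeVertex y w (Sum.inl x : U ⊕ T) = Sum.inr none := by
        rcases hx with rfl | rfl
        · simp [mergeVertex]
        · simp [mergeVertex]
      rw [this]
      exact hr'
    · rw [show mergeVertex v w (Sum.inl y.1 : U ⊕ T) = Sum.inl y by
        simp [mergeVertex, h, y.2]]
      exact .refl _
  have hun : ∀ h : HalfEdge U T,
      Relation.EqvGen r (unmergeVertex v w (mergeHalf v w h).vertex) h.vertex := by
    intro h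
    rcases vertex_mergeHalf v w hvw h with ⟨e | e, e'⟩ | ⟨x, -, e, e'⟩ | ⟨t, e, e'⟩ <;> rw [e, e']
    · exact .refl _
    · exact hr
    · exact .refl _
    · exact .refl _
  refine Nat.card_congr ⟨Quot.lift (fun a => Quot.mk r (unmergeVertex v w a)) ?_,
    Quot.lift (fun a => Quot.mk r' (mergeVertex v w a)) ?_, ?_, ?_⟩
  · rintro x y (⟨h, rfl, rfl⟩ | ⟨e, he, rfl, rfl⟩)
    · rcases mergeHalf_cases v w hvw h with rfl | rfl | ⟨k, rfl⟩
      · rw [(mergeOpp_new opp v w hvw).1]; rfl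
      · rw [(mergeOpp_new opp v w hvw).2]; rfl
      · rw [mergeOpp_mergeHalf]
        exact Quot.eqvGen_sound ((hun k).trans _ _ _ (.trans _ _ _
          (.rel _ _ (Or.inl ⟨k, rfl, rfl⟩)) (hun (opp k)).symm))
    · refine Quot.eqvGen_sound ((hsp hq e.1).trans _ _ _ (.trans _ _ _ (.rel _ _ (Or.inr
        ⟨(splitPoint hq e.1, splitPoint hp e.2), ?_, rfl, rfl⟩)) (hsp hp e.2).symm))
      exact Finset.mem_insert_of_mem (Finset.mem_map_of_mem _ he)
  · rintro x y (⟨h, rfl, rfl⟩ | ⟨e, he, rfl, rfl⟩)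
    · refine Quot.eqvGen_sound (.rel _ _ (Or.inl ⟨mergeHalf v w h, ?_, ?_⟩))
      · rw [mergeVertex_vertex]
      · rw [mergeOpp_mergeHalf, mergeVertex_vertex]
    · rcases Finset.mem_insert.1 he with rfl | he
      · have : mergeVertex v w (Sum.inl p : U ⊕ T) = mergeVertex v w (Sum.inl q) := by
          rcases hpq with ⟨rfl, rfl⟩ | ⟨rfl, rfl⟩ <;> simp [mergeVertex]
        rw [this]
      · obtain ⟨⟨x, y⟩, hxy, rfl⟩ := Finset.mem_map.1 he
        exact Quot.eqvGen_sound ((hsp' hq x).symm.trans _ _ _ (.trans _ _ _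
          (.rel _ _ (Or.inr ⟨(x, y), hxy, rfl, rfl⟩)) (hsp' hp y)))
  · rintro ⟨x | _ | t⟩
    · refine Quot.eqvGen_sound ?_
      by_cases hx : x.1 = v
      · obtain ⟨x, hx'⟩ := x
        dsimp only at hx
        subst hx
        simpa [unmergeVertex, mergeVertex] using hr'.symm
      · simp only [unmergeVertex, mergeVertex, x.2, hx, dif_neg, if_false, not_false_eq_true]
        exact .refl _
    · simp only [unmergeVertex, mergeVertex, if_true, dif_neg hvw]; rfl
    · rfl
  · rintro ⟨x | t⟩
    · refine Quot.eqvGen_sound ?_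
      by_cases hw : x = w
      · subst hw
        simpa [unmergeVertex, mergeVertex] using hr
      · by_cases hv : x = v
        · subst hv
          simp only [unmergeVertex, mergeVertex, dif_neg hw, if_true]
          exact .refl _
        · simp only [unmergeVertex, mergeVertex, dif_neg hw, hv, if_false]
          exact .refl _
    · rfl

/-- The edge `(p, q)` occupies the outgoing place of `p` and the incoming place of `q`. Any other
edge at the fused vertex must leave from `q` or arrive at `p`, which explains the two uses of
`splitPoint`. Statuses agree since the opposite of a sum of bits, one of which is `true`, is the
other bit. -/
theorem isState_merge [DecidableEq U] (opp : HalfEdge U T → HalfEdge U T) {v w p q : U}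
    (hvw : v ≠ w) (hpq : (p = v ∧ q = w) ∨ (p = w ∧ q = v)) (hp : p = v ∨ p = w)
    (hq : q = v ∨ q = w) (s : HalfEdge U T → Status) (hsp : (s (Sum.inl p)).1 = true)
    (hsq : (s (Sum.inl q)).2 = true) (E : Finset ({x : U // x ≠ w} × {x : U // x ≠ w})) :
    IsState opp s (insertEdge (splitPoint hq) (splitPoint hp) p q E) ↔
      IsState (mergeOpp opp v w hvw) (mergeStatus v w s) E := by
  have hne : p ≠ q := by rcases hpq with ⟨rfl, rfl⟩ | ⟨rfl, rfl⟩; exacts [hvw, hvw.symm]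
  have avoid : ∀ {x y : U}, (x = v ∧ y = w ∨ x = w ∧ y = v) → ∀ (hx : x = v ∨ x = w) z,
      splitPoint hx z ≠ y := by
    rintro x y hxy hx ⟨z, hz⟩
    rw [splitPoint_apply]
    dsimp only
    rcases hxy with ⟨rfl, rfl⟩ | ⟨rfl, rfl⟩ <;> split_ifs with h
    · exact hvw
    · exact hz
    · exact hvw.symm
    · exact h
  have surj : ∀ {x y : U}, (x = v ∧ y = w ∨ x = w ∧ y = v) → ∀ (hx : x = v ∨ x = w) z,
      z ≠ y → ∃ z', splitPoint hx z' = z := by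
    intro x y hxy hx z hz
    by_cases h : z = x
    · exact ⟨⟨v, hvw⟩, by rw [splitPoint_apply, if_pos rfl, h]⟩
    · have h₁ : z ≠ w := by rcases hxy with ⟨rfl, rfl⟩ | ⟨rfl, rfl⟩; exacts [hz, h]
      have h₂ : z ≠ v := by rcases hxy with ⟨rfl, rfl⟩ | ⟨rfl, rfl⟩; exacts [h, hz]
      exact ⟨⟨z, h₁⟩, by rw [splitPoint_apply, if_neg h₂]⟩
  have hqp : (q = v ∧ p = w) ∨ (q = w ∧ p = v) := hpq.symm.imp And.symm And.symm
  unfold IsState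
  rw [isMatching_insertEdge (avoid hqp hq) (surj hqp hq) (avoid hpq hp) (surj hpq hp) _
    (fun x => mergeStatus v w s (Sum.inl x)) ?_ ?_ hsp hsq]
  · refine and_congr_left fun _ => ⟨fun h k => ?_, fun h k => ?_⟩
    · rcases mergeHalf_cases v w hvw k with rfl | rfl | ⟨k, rfl⟩
      · rw [(mergeOpp_new opp v w hvw).1]
        simp [mergeStatus, Status.opposite]
      · rw [(mergeOpp_new opp v w hvw).2]
        simp [mergeStatus, Status.opposite]
      · rw [mergeOpp_mergeHalf, mergeStatus_mergeHalf, mergeStatus_mergeHalf, h]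
    · have := h (mergeHalf v w k)
      rwa [mergeOpp_mergeHalf, mergeStatus_mergeHalf, mergeStatus_mergeHalf] at this
  · rintro ⟨x, hx⟩
    rw [splitPoint_apply]
    by_cases h : x = v
    · rcases hpq with ⟨rfl, rfl⟩ | ⟨rfl, rfl⟩ <;> simp [mergeStatus, h, Status.opposite, hsp]
    · simp [mergeStatus, h]
  · rintro ⟨x, hx⟩
    rw [splitPoint_apply]
    by_cases h : x = v
    · rcases hpq with ⟨rfl, rfl⟩ | ⟨rfl, rfl⟩ <;> simp [mergeStatus, h, Status.opposite, hsq]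
    · simp [mergeStatus, h]

/-- Here `x` and `y` are the statuses at `v` and `w`. The sign of the new trivalent vertex absorbs
the change of the leg signs, up to `1` for an edge from `v` to `w` and `-1` for an edge from `w` to
`v`: the step sign of the contracted edge. -/
theorem triSign_merge (x y : Status) :
    (x ≠ y → x.1 = true → y.2 = true → ((triSign (xor x.1 y.1, xor x.2 y.2) y x : ℝ) *
      legSign (Status.opposite (xor x.1 y.1, xor x.2 y.2)) = legSign x * legSign y)) ∧
    (x ≠ y → y.1 = true → x.2 = true → ((triSign (xor x.1 y.1, xor x.2 y.2) y x : ℝ) *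
      legSign (Status.opposite (xor x.1 y.1, xor x.2 y.2)) = - (legSign x * legSign y))) := by
  obtain ⟨a, b⟩ := x
  obtain ⟨c, d⟩ := y
  cases a <;> cases b <;> cases c <;> cases d <;>
    simp [triSign, legSign, Status.opposite]

/-- Nothing lies between `v` and `w`, so any other point sees them on the same side. -/
theorem stepSign_covBy [LinearOrder U] {v w : U} (hvw : v ⋖ w) {x : U} (hv : x ≠ v) (hw : x ≠ w) :
    stepSign x v = stepSign x w ∧ stepSign v x = stepSign w x := by
  have h : x < v ∨ w < x := by
    rcases lt_or_gt_of_ne hv with h | h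
    · exact Or.inl h
    · exact Or.inr (lt_of_le_of_ne (not_lt.1 fun k => hvw.2 h k) (Ne.symm hw))
  have := hvw.1
  rcases h with h | h
  · simp [stepSign, h, h.trans this, h.not_gt, (h.trans this).not_gt]
  · simp [stepSign, h, this.trans h, h.not_gt, (this.trans h).not_gt]

theorem stepSign_subtype [LinearOrder U] {P : U → Prop} (x y : {x : U // P x}) :
    stepSign x y = stepSign x.1 y.1 := rfl

/-- Contraction preserves weights exactly: components correspond, the other edges keep their step
signs because `v` and `w` are adjacent, and the remaining signs balance by `triSign_merge`. -/
theorem stateWeight_merge [LinearOrder U] [Fintype U] [Fintype T] (f : ℕ → ℝ)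
    (opp : HalfEdge U T → HalfEdge U T) {v w p q : U} [Fintype {x : U // x ≠ w}]
    [Fintype (Option T)] (hvw : v ⋖ w)
    (hpq : (p = v ∧ q = w) ∨ (p = w ∧ q = v)) (hp : p = v ∨ p = w)
    (hq : q = v ∨ q = w) (s : HalfEdge U T → Status) (hsp : (s (Sum.inl p)).1 = true)
    (hsq : (s (Sum.inl q)).2 = true) (hs : s (Sum.inl v) ≠ s (Sum.inl w))
    (E : Finset ({x : U // x ≠ w} × {x : U // x ≠ w})) :
    stateWeight f (mergeOpp opp v w hvw.ne) (mergeStatus v w s) E =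
      stateWeight f opp s (insertEdge (splitPoint hq) (splitPoint hp) p q E) := by
  have hne : p ≠ q := by rcases hpq with ⟨rfl, rfl⟩ | ⟨rfl, rfl⟩; exacts [hvw.ne, hvw.ne']
  unfold stateWeight
  rw [isState_merge opp hvw.ne hpq hp hq s hsp hsq]
  split_ifs with hS
  swap
  · rfl
  rw [componentCount_merge opp hvw.ne hpq hp hq]
  congr 1
  -- A loop at the fused vertex makes both bits there `true`, hence the statuses at `v` and `w`
  -- equal. It has to be excluded: its step sign is `0`, while it would split into the edge `(q, p)`
  -- of sign `±1`.
  have hnv : ∀ e ∈ E, ¬ (e.1.1 = v ∧ e.2.1 = v) := by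
    rintro ⟨⟨x, hx⟩, ⟨y, hy⟩⟩ he ⟨h₁, h₂⟩
    dsimp only at h₁ h₂
    subst h₁
    subst h₂
    have a := (hS.2.src _).2 ⟨_, he⟩
    have b := (hS.2.tgt _).2 ⟨_, he⟩
    simp only [mergeStatus, if_true, Status.opposite] at a b
    apply hs
    rcases hpq with ⟨rfl, rfl⟩ | ⟨rfl, rfl⟩ <;>
      exact Prod.ext (by simp_all) (by simp_all)
  have hE : ∏ e ∈ E.map ((splitPoint hq).prodMap (splitPoint hp)), stepSign e.1 e.2 =
      ∏ e ∈ E, stepSign e.1 e.2 := by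
    rw [Finset.prod_map]
    refine Finset.prod_congr rfl ?_
    rintro ⟨⟨x, hx⟩, ⟨y, hy⟩⟩ he
    have hxy := hnv _ he
    rw [stepSign_subtype]
    simp only [Function.Embedding.prodMap, Function.Embedding.coeFn_mk, Prod.map,
      splitPoint_apply] at hxy ⊢
    by_cases h₁ : x = v
    · have h₂ : y ≠ v := fun h₂ => hxy ⟨h₁, h₂⟩
      have := stepSign_covBy hvw h₂ hy
      rcases hq with rfl | rfl
      · simp [h₁, h₂]
      · simp [h₁, h₂, this]
    · by_cases h₂ : y = v
      · have := stepSign_covBy hvw h₁ hx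
        rcases hp with rfl | rfl
        · simp [h₁, h₂]
        · simp [h₁, h₂, this]
      · simp [h₁, h₂]
  have hins : ∏ e ∈ insertEdge (splitPoint hq) (splitPoint hp) p q E, stepSign e.1 e.2 =
      stepSign p q * ∏ e ∈ E, stepSign e.1 e.2 := by
    rw [Finset.prod_insert, hE]
    intro h
    obtain ⟨⟨x, y⟩, hxy, e⟩ := Finset.mem_map.1 h
    simp only [Function.Embedding.prodMap, Function.Embedding.coeFn_mk, Prod.map, Prod.mk.injEq,
      splitPoint_apply] at e
    rcases hpq with ⟨rfl, rfl⟩ | ⟨rfl, rfl⟩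
    · have := e.1
      split_ifs at this with h
      · exact hne this.symm
      · exact h this
    · have := e.1
      split_ifs at this with h
      · exact hne this.symm
      · exact x.2 this
  rw [hins, ← mul_assoc]
  congr 1
  have hT : ∏ t : Option T, (triSign (mergeStatus v w s (Sum.inr (t, 0)))
      (mergeStatus v w s (Sum.inr (t, 1))) (mergeStatus v w s (Sum.inr (t, 2))) : ℝ) =
      (triSign (xor (s (Sum.inl v)).1 (s (Sum.inl w)).1, xor (s (Sum.inl v)).2 (s (Sum.inl w)).2)
        (s (Sum.inl w)) (s (Sum.inl v)) : ℝ) *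
      ∏ t : T, (triSign (s (Sum.inr (t, 0))) (s (Sum.inr (t, 1))) (s (Sum.inr (t, 2))) : ℝ) := by
    convert Fintype.prod_option _ <;> simp [mergeStatus]
  have hU : (∏ u : {x : U // x ≠ w}, legSign (mergeStatus v w s (Sum.inl u))) *
      (legSign (s (Sum.inl v)) * legSign (s (Sum.inl w))) =
      legSign (Status.opposite (xor (s (Sum.inl v)).1 (s (Sum.inl w)).1,
        xor (s (Sum.inl v)).2 (s (Sum.inl w)).2)) * ∏ u : U, legSign (s (Sum.inl u)) := by
    rw [← Finset.mul_prod_erase Finset.univ _ (Finset.mem_univ w),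
      ← Finset.mul_prod_erase (Finset.univ.erase w) _
        (Finset.mem_erase.2 ⟨hvw.ne, Finset.mem_univ v⟩),
      ← Finset.mul_prod_erase Finset.univ _ (Finset.mem_univ (⟨v, hvw.ne⟩ : {x : U // x ≠ w}))]
    have h₁ : ∏ u ∈ (Finset.univ : Finset {x : U // x ≠ w}).erase ⟨v, hvw.ne⟩,
        legSign (mergeStatus v w s (Sum.inl u)) =
        ∏ u ∈ (Finset.univ.erase w).erase v, legSign (s (Sum.inl u)) := by
      refine Finset.prod_bij (fun x _ => x.1) ?_ ?_ ?_ ?_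
      · rintro ⟨x, hx⟩ h
        simp only [Finset.mem_erase, Finset.mem_univ, ne_eq, Subtype.mk.injEq, and_true] at h ⊢
        exact ⟨h, hx⟩
      · intro x _ y _ h
        exact Subtype.ext h
      · intro x hx
        simp only [Finset.mem_erase, Finset.mem_univ, ne_eq, and_true] at hx
        exact ⟨⟨x, hx.2⟩, by simp [hx.1], rfl⟩
      · rintro ⟨x, hx⟩ h
        simp only [Finset.mem_erase, Finset.mem_univ, ne_eq, Subtype.mk.injEq, and_true] at h
        simp [mergeStatus, h]
    rw [h₁]
    have h₂ : mergeStatus v w s (Sum.inl (⟨v, hvw.ne⟩ : {x : U // x ≠ w})) =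
      Status.opposite (xor (s (Sum.inl v)).1 (s (Sum.inl w)).1,
        xor (s (Sum.inl v)).2 (s (Sum.inl w)).2) := by simp [mergeStatus]
    rw [h₂]
    ring
  rw [hT]
  set x := s (Sum.inl v)
  set y := s (Sum.inl w)
  have hl : ∀ z : Status, legSign z * legSign z = 1 := fun z => by
    unfold legSign; split_ifs <;> norm_num
  have hU' : ∏ u : {x : U // x ≠ w}, legSign (mergeStatus v w s (Sum.inl u)) =
      legSign (Status.opposite (xor x.1 y.1, xor x.2 y.2)) * (∏ u : U, legSign (s (Sum.inl u))) *
        (legSign x * legSign y) := by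
    rw [← hU, mul_assoc, mul_mul_mul_comm (legSign x), hl, hl]; ring
  have hst : stepSign p q * (legSign x * legSign y) = (triSign (xor x.1 y.1, xor x.2 y.2) y x : ℝ) *
      legSign (Status.opposite (xor x.1 y.1, xor x.2 y.2)) := by
    rcases hpq with ⟨rfl, rfl⟩ | ⟨rfl, rfl⟩
    · rw [(triSign_merge x y).1 hs hsp hsq]
      simp [stepSign, hvw.1]
    · rw [(triSign_merge x y).2 hs hsp hsq]
      simp [stepSign, hvw.1, hvw.1.not_gt]
  rw [hU']
  set A := ∏ t : T, (triSign (s (Sum.inr (t, 0))) (s (Sum.inr (t, 1))) (s (Sum.inr (t, 2))) : ℝ)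
  set B := ∏ u : U, legSign (s (Sum.inl u))
  set τ := (triSign (xor x.1 y.1, xor x.2 y.2) y x : ℝ)
  set l := legSign (Status.opposite (xor x.1 y.1, xor x.2 y.2))
  have h3 : legSign x * legSign y * (legSign x * legSign y) = 1 := by
    rw [mul_mul_mul_comm, hl, hl, one_mul]
  calc τ * A * (l * B * (legSign x * legSign y)) = (τ * l) * (A * B * (legSign x * legSign y)) := by
        ring
    _ = stepSign p q * (legSign x * legSign y * (legSign x * legSign y)) * (A * B) := by
        rw [← hst]; ring
    _ = A * B * stepSign p q := by rw [h3]; ring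

end stu

/-! ### Exchange of two adjacent univalent vertices. -/

section swap

variable {U T : Type} [LinearOrder U]

theorem legSwap_apply (v w u : U) : legSwap v w (Sum.inl u : HalfEdge U T) =
    Sum.inl (Equiv.swap v w u) := by
  simp only [legSwap, Equiv.swap_apply_def, Sum.inl.injEq]
  split_ifs <;> rfl

/-- The exchange alters the relative order of the pair `v`, `w` only. -/
theorem stepSign_swap {v w : U} (hvw : v ⋖ w) (x y : U) :
    stepSign (Equiv.swap v w x) (Equiv.swap v w y) =
      stepSign x y * ((if (v, w) = (x, y) then -1 else 1) * (if (w, v) = (x, y) then -1 else 1)) := by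
  have h := hvw.1
  have hne := hvw.ne
  have hne' := hvw.ne'
  by_cases hxv : x = v
  · subst hxv
    by_cases hyv : y = x
    · subst hyv; simp [stepSign]
    by_cases hyw : y = w
    · subst hyw
      simp [stepSign, h, h.not_gt, hne]
    · have := (stepSign_covBy hvw hyv hyw).2
      rw [Equiv.swap_apply_left, Equiv.swap_apply_of_ne_of_ne hyv hyw]
      simp [this, Ne.symm hyw, hne']
  by_cases hxw : x = w
  · subst hxw
    by_cases hyv : y = v
    · subst hyv; simp [stepSign, h, h.not_gt, hne]
    by_cases hyw : y = x
    · subst hyw; simp [stepSign]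
    · have := (stepSign_covBy hvw hyv hyw).2
      rw [Equiv.swap_apply_right, Equiv.swap_apply_of_ne_of_ne hyv hyw]
      simp [this, Ne.symm hyv, hne]
  rw [Equiv.swap_apply_of_ne_of_ne hxv hxw]
  have h1 : (v, w) ≠ (x, y) := fun e => hxv (Prod.mk.inj e).1.symm
  have h2 : (w, v) ≠ (x, y) := fun e => hxw (Prod.mk.inj e).1.symm
  rw [if_neg h1, if_neg h2, mul_one, mul_one]
  have := (stepSign_covBy hvw hxv hxw).1
  by_cases hyv : y = v
  · subst hyv; simp [this]
  by_cases hyw : y = w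
  · subst hyw; simp [this]
  rw [Equiv.swap_apply_of_ne_of_ne hyv hyw]

theorem prod_stepSign_swap {v w : U} (hvw : v ⋖ w) (E : Finset (U × U)) :
    ∏ e ∈ mapMatching (Equiv.swap v w) E, stepSign e.1 e.2 =
      (∏ e ∈ E, stepSign e.1 e.2) *
        ((if (v, w) ∈ E then -1 else 1) * (if (w, v) ∈ E then -1 else 1)) := by
  rw [prod_mapMatching]
  simp only [stepSign_swap hvw, Prod.mk.eta]
  rw [Finset.prod_mul_distrib, Finset.prod_mul_distrib, Finset.prod_ite_eq, Finset.prod_ite_eq]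

/-- The exchanged vertices are already joined by an edge of the matching. -/
theorem componentCount_swap (opp : HalfEdge U T → HalfEdge U T) {v w : U} {E : Finset (U × U)}
    (h : (v, w) ∈ E ∨ (w, v) ∈ E) :
    componentCount opp (mapMatching (Equiv.swap v w) E) = componentCount opp E := by
  have key : ∀ E : Finset (U × U), ((v, w) ∈ E ∨ (w, v) ∈ E) → ∀ u, Relation.EqvGen
      (VertexRel opp E) (Sum.inl (Equiv.swap v w u)) (Sum.inl u) := by
    intro E h u
    have hvw : Relation.EqvGen (VertexRel opp E) (Sum.inl v) (Sum.inl w) := by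
      rcases h with h | h
      · exact .rel _ _ (Or.inr ⟨_, h, rfl, rfl⟩)
      · exact .symm _ _ (.rel _ _ (Or.inr ⟨_, h, rfl, rfl⟩))
    rw [Equiv.swap_apply_def]
    split_ifs with h1 h2
    · rw [h1]; exact hvw.symm
    · rw [h2]; exact hvw
    · exact .refl _
  have mem : ∀ x y, (x, y) ∈ mapMatching (Equiv.swap v w) E ↔
      (Equiv.swap v w x, Equiv.swap v w y) ∈ E := fun x y => by
    conv_lhs => rw [← Equiv.swap_apply_self v w x, ← Equiv.swap_apply_self v w y]
    exact mem_mapMatching _ _ _ _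
  have h' : (v, w) ∈ mapMatching (Equiv.swap v w) E ∨ (w, v) ∈ mapMatching (Equiv.swap v w) E := by
    simpa [mem] using h.symm
  refine card_quot_eq (Equiv.refl _) ?_ ?_
  · rintro x y (⟨k, rfl, rfl⟩ | ⟨⟨a, b⟩, he, rfl, rfl⟩)
    · exact .rel _ _ (Or.inl ⟨k, rfl, rfl⟩)
    · exact ((key E h a).symm).trans _ _ _ (.trans _ _ _
        (.rel _ _ (Or.inr ⟨_, (mem _ _).1 he, rfl, rfl⟩)) (key E h b))
  · rintro x y (⟨k, rfl, rfl⟩ | ⟨⟨a, b⟩, he, rfl, rfl⟩)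
    · exact .rel _ _ (Or.inl ⟨k, rfl, rfl⟩)
    · exact ((key _ h' a).symm).trans _ _ _ (.trans _ _ _
        (.rel _ _ (Or.inr ⟨_, (mem_mapMatching _ _ _ _).2 he, rfl, rfl⟩)) (key _ h' b))

end swap

/-! ### The comparison of the three state sums in STU. -/

section stuSum

variable {U T : Type} [LinearOrder U] [Fintype U] [Fintype T]

theorem isState_of_stateWeight_ne_zero {f : ℕ → ℝ} {opp : HalfEdge U T → HalfEdge U T}
    {s : HalfEdge U T → Status} {E : Finset (U × U)} (h : stateWeight f opp s E ≠ 0) :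
    IsState opp s E := by
  by_contra hS
  exact h (by unfold stateWeight; rw [if_neg hS])

theorem triSign_ne_zero_of_stateWeight_ne_zero {f : ℕ → ℝ} {opp : HalfEdge U T → HalfEdge U T}
    {s : HalfEdge U T → Status} {E : Finset (U × U)} (h : stateWeight f opp s E ≠ 0) (t : T) :
    triSign (s (Sum.inr (t, 0))) (s (Sum.inr (t, 1))) (s (Sum.inr (t, 2))) ≠ 0 := by
  have hS := isState_of_stateWeight_ne_zero h
  intro h0
  apply h
  unfold stateWeight
  rw [if_pos hS, Finset.prod_eq_zero (Finset.mem_univ t) (by rw [h0, Int.cast_zero])]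
  simp

/-- A nonzero sign means that the three statuses are the three nonzero pairs of bits, which add up
to zero. With `z` at `v` and `y` at `w`, the last clause says that exactly one direction of an
internal edge between `v` and `w` is allowed, so that each merged state is a contraction in exactly
one way. -/
theorem triSign_ne_zero {x y z : Status} (h : triSign x y z ≠ 0) :
    x = (xor z.1 y.1, xor z.2 y.2) ∧ z ≠ y ∧
      (¬ (z.1 = true ∧ y.2 = true) ↔ (y.1 = true ∧ z.2 = true)) := by
  revert x y z; decide

theorem stateSum_eq [Fintype (HalfEdge U T → Status)] [Fintype (Finset (U × U))] (f : ℕ → ℝ)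
    (opp : HalfEdge U T → HalfEdge U T) : stateSum f opp =
      ∑ x : (HalfEdge U T → Status) × Finset (U × U), stateWeight f opp x.1 x.2 := by
  unfold stateSum
  congr!

/-- Contraction and insertion of `(p, q)` are inverse bijections between the nonzero terms. The
restriction to nonzero terms matters: only then is the status of the new edge forced by the two
statuses at `v` and `w`. -/
theorem sum_merge_aux (f : ℕ → ℝ) (opp : HalfEdge U T → HalfEdge U T) {v w p q : U}
    [Fintype {x : U // x ≠ w}] [Fintype (Option T)] [DecidableEq (HalfEdge U T)]
    [DecidableEq (HalfEdge {x : U // x ≠ w} (Option T))] (hvw : v ⋖ w)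
    (hpq : (p = v ∧ q = w) ∨ (p = w ∧ q = v)) :
    (∑ x : (HalfEdge U T → Status) × Finset (U × U),
      if (p, q) ∈ x.2 ∧ x.1 (Sum.inl v) ≠ x.1 (Sum.inl w) then stateWeight f opp x.1 x.2 else 0) =
    ∑ x : (HalfEdge {x : U // x ≠ w} (Option T) → Status) ×
        Finset ({x : U // x ≠ w} × {x : U // x ≠ w}),
      if (x.1 (mergeHalf v w (Sum.inl p))).1 = true ∧ (x.1 (mergeHalf v w (Sum.inl q))).2 = true
      then stateWeight f (mergeOpp opp v w hvw.ne) x.1 x.2 else 0 := by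
  have hp : p = v ∨ p = w := hpq.imp And.left And.left
  have hq : q = v ∨ q = w := hpq.symm.imp And.right And.right
  have hσ : ∀ z, splitPoint hq z ≠ p := by
    rintro ⟨z, hz⟩
    rw [splitPoint_apply]
    dsimp only
    rcases hpq with ⟨rfl, rfl⟩ | ⟨rfl, rfl⟩ <;> split_ifs with h
    · exact hvw.ne'
    · exact h
    · exact hvw.ne
    · exact hz
  have surj : ∀ {x y : U}, (x = v ∧ y = w ∨ x = w ∧ y = v) → ∀ (hx : x = v ∨ x = w) z,
      z ≠ y → ∃ z', splitPoint hx z' = z := by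
    intro x y hxy hx z hz
    by_cases h : z = x
    · exact ⟨⟨v, hvw.ne⟩, by rw [splitPoint_apply, if_pos rfl, h]⟩
    · have h₁ : z ≠ w := by rcases hxy with ⟨rfl, rfl⟩ | ⟨rfl, rfl⟩; exacts [hz, h]
      have h₂ : z ≠ v := by rcases hxy with ⟨rfl, rfl⟩ | ⟨rfl, rfl⟩; exacts [h, hz]
      exact ⟨⟨z, h₁⟩, by rw [splitPoint_apply, if_neg h₂]⟩
  have hσ' := surj (hpq.symm.imp And.symm And.symm) hq
  have hρ' := surj hpq hp
  have e₁ : mergeHalf v w (Sum.inl w : HalfEdge U T) = Sum.inr (none, 1) := by simp [mergeHalf]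
  have e₂ : mergeHalf v w (Sum.inl v : HalfEdge U T) = Sum.inr (none, 2) := by
    simp [mergeHalf, hvw.ne]
  refine Finset.sum_bij_ne_zero (fun x _ _ => (mergeStatus v w x.1,
    removeEdge (splitPoint hq) (splitPoint hp) x.2)) (fun _ _ _ => Finset.mem_univ _) ?_ ?_ ?_
  · rintro ⟨s₁, E₁⟩ - h₁ ⟨s₂, E₂⟩ - h₂ h
    obtain ⟨c₁, h₁⟩ := ite_ne_right_iff.1 h₁
    obtain ⟨c₂, h₂⟩ := ite_ne_right_iff.1 h₂
    simp only [Prod.mk.injEq] at h c₁ c₂ h₁ h₂ ⊢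
    refine ⟨?_, ?_⟩
    · funext k
      rw [← mergeStatus_mergeHalf v w s₁, h.1, mergeStatus_mergeHalf]
    · rw [← insertEdge_removeEdge hσ' hρ' (isState_of_stateWeight_ne_zero h₁).2 c₁.1, h.2,
        insertEdge_removeEdge hσ' hρ' (isState_of_stateWeight_ne_zero h₂).2 c₂.1]
  · rintro ⟨s, E⟩ - h
    obtain ⟨c, h⟩ := ite_ne_right_iff.1 h
    dsimp only at c h
    have hS := isState_of_stateWeight_ne_zero h
    have ht := triSign_ne_zero (triSign_ne_zero_of_stateWeight_ne_zero h none)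
    have hs : mergeStatus v w (s ∘ mergeHalf v w) = s := by
      refine mergeStatus_comp v w hvw.ne s ?_ ht.1
      rw [← hS.1, (mergeOpp_new opp v w hvw.ne).2]
    have hne : (s ∘ mergeHalf v w) (Sum.inl v) ≠ (s ∘ mergeHalf v w) (Sum.inl w) := by
      simp only [Function.comp_apply, e₁, e₂]
      exact ht.2.1
    have hW := stateWeight_merge f opp hvw hpq hp hq (s ∘ mergeHalf v w) c.1 c.2 hne E
    rw [hs] at hW
    refine ⟨(s ∘ mergeHalf v w, insertEdge (splitPoint hq) (splitPoint hp) p q E),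
      Finset.mem_univ _, ?_, ?_⟩
    · rw [ite_ne_right_iff]
      dsimp only
      rw [← hW]
      exact ⟨⟨by simp, hne⟩, h⟩
    · simp only [hs, removeEdge_insertEdge hσ]
  · rintro ⟨s, E⟩ - h
    obtain ⟨c, h⟩ := ite_ne_right_iff.1 h
    dsimp only at c h ⊢
    have hS := isState_of_stateWeight_ne_zero h
    have hsp := (hS.2.src p).2 ⟨q, c.1⟩
    have hsq := (hS.2.tgt q).2 ⟨p, c.1⟩
    have c' : (mergeStatus v w s (mergeHalf v w (Sum.inl p))).1 = true ∧
        (mergeStatus v w s (mergeHalf v w (Sum.inl q))).2 = true := by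
      rw [mergeStatus_mergeHalf, mergeStatus_mergeHalf]; exact ⟨hsp, hsq⟩
    rw [if_pos c, if_pos c', stateWeight_merge f opp hvw hpq hp hq s hsp hsq c.2,
      insertEdge_removeEdge hσ' hρ' hS.2 c.1]

open Classical in
-- When `v` and `w` have the same status, exchanging them in the matching alone gives another state
-- on the same half-edge statuses. Exactly one edge joins them, so the sign changes and the terms
-- cancel in pairs.
theorem sum_equal_status (f : ℕ → ℝ) (opp : HalfEdge U T → HalfEdge U T) {v w : U} (hvw : v ⋖ w) :
    (∑ x : (HalfEdge U T → Status) × Finset (U × U),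
      if Xor ((v, w) ∈ x.2) ((w, v) ∈ x.2) ∧ x.1 (Sum.inl v) = x.1 (Sum.inl w)
      then stateWeight f opp x.1 x.2 else 0) = 0 := by
  refine sum_eq_zero_of_equiv ((Equiv.refl _).prodCongr (mapMatching (Equiv.swap v w))) _ ?_
  rintro ⟨s, E⟩
  have hF : ((Equiv.refl (HalfEdge U T → Status)).prodCongr (mapMatching (Equiv.swap v w))) (s, E) =
      (s, mapMatching (Equiv.swap v w) E) := rfl
  rw [hF]
  have mem₁ : (v, w) ∈ mapMatching (Equiv.swap v w) E ↔ (w, v) ∈ E := by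
    have := mem_mapMatching (Equiv.swap v w) E w v
    rwa [Equiv.swap_apply_left, Equiv.swap_apply_right] at this
  have mem₂ : (w, v) ∈ mapMatching (Equiv.swap v w) E ↔ (v, w) ∈ E := by
    have := mem_mapMatching (Equiv.swap v w) E v w
    rwa [Equiv.swap_apply_left, Equiv.swap_apply_right] at this
  simp only [mem₁, mem₂, xor_comm ((w, v) ∈ E)]
  by_cases hc : Xor ((v, w) ∈ E) ((w, v) ∈ E) ∧ s (Sum.inl v) = s (Sum.inl w)
  swap
  · rw [if_neg hc, if_neg hc, add_zero]
  rw [if_pos hc, if_pos hc]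
  have hS : IsState opp s (mapMatching (Equiv.swap v w) E) ↔ IsState opp s E := by
    refine and_congr_right fun _ => ?_
    have hE := isMatching_map (Equiv.swap v w) (fun u => s (Sum.inl u)) E
    have : (fun u => s (Sum.inl ((Equiv.swap v w).symm u))) = fun u => s (Sum.inl u) := by
      funext u
      rw [Equiv.symm_swap, Equiv.swap_apply_def]
      split_ifs with h1 h2
      · rw [h1, hc.2]
      · rw [h2, hc.2]
      · rfl
    rwa [this] at hE
  unfold stateWeight
  rw [hS, prod_stepSign_swap hvw, componentCount_swap opp hc.1.or]
  split_ifs with hx h1 h2 h2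
  · exact (xor_iff_not_iff _ _ |>.1 hc.1 (iff_of_true h1 h2)).elim
  · ring
  · ring
  · exact (xor_iff_not_iff _ _ |>.1 hc.1 (iff_of_false h1 h2)).elim
  · ring

open Classical in
-- States of the two diagrams are matched by exchanging `v` and `w`. Those with exactly one edge
-- between `v` and `w` change sign, hence count twice in the difference; all others drop out. If the
-- two statuses differ, contraction applies; if they agree, the contributions cancel.
theorem stateSum_stu (f : ℕ → ℝ) (opp : HalfEdge U T → HalfEdge U T) {v w : U}
    [Fintype {x : U // x ≠ w}] [Fintype (Option T)] (hvw : v ⋖ w) :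
    stateSum f opp - stateSum f (fun h => legSwap v w (opp ((legSwap v w).symm h))) =
      2 * stateSum f (mergeOpp opp v w hvw.ne) := by
  have hC := sum_equal_status f opp hvw
  have hA := sum_merge_aux f opp hvw (Or.inl ⟨rfl, rfl⟩)
  have hB := sum_merge_aux f opp hvw (Or.inr ⟨rfl, rfl⟩)
  have e₁ : mergeHalf v w (Sum.inl w : HalfEdge U T) = Sum.inr (none, 1) := by simp [mergeHalf]
  have e₂ : mergeHalf v w (Sum.inl v : HalfEdge U T) = Sum.inr (none, 2) := by
    simp [mergeHalf, hvw.ne]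
  -- The states of the merged diagram are sorted by the direction of the contracted edge, which the
  -- new trivalent vertex determines.
  have hM : stateSum f (mergeOpp opp v w hvw.ne) =
      (∑ x : (HalfEdge U T → Status) × Finset (U × U),
        if (v, w) ∈ x.2 ∧ x.1 (Sum.inl v) ≠ x.1 (Sum.inl w) then stateWeight f opp x.1 x.2 else 0) +
      ∑ x : (HalfEdge U T → Status) × Finset (U × U),
        if (w, v) ∈ x.2 ∧ x.1 (Sum.inl v) ≠ x.1 (Sum.inl w) then stateWeight f opp x.1 x.2
        else 0 := by
    rw [hA, hB, ← Finset.sum_add_distrib, stateSum_eq]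
    refine Finset.sum_congr rfl fun x _ => ?_
    by_cases h0 : stateWeight f (mergeOpp opp v w hvw.ne) x.1 x.2 = 0
    · simp [h0]
    · have ht := (triSign_ne_zero (triSign_ne_zero_of_stateWeight_ne_zero h0 none)).2.2
      rw [e₁, e₂]
      by_cases h : (x.1 (Sum.inr (none, 2))).1 = true ∧ (x.1 (Sum.inr (none, 1))).2 = true
      · rw [if_pos h, if_neg (fun h' => ht.2 h' h), add_zero]
      · rw [if_neg h, if_pos (ht.1 h), zero_add]
  rw [stateSum_map (opp' := fun h => legSwap v w (opp ((legSwap v w).symm h)))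
    (Equiv.swap v w) (legSwap v w) f, hM]
  have hS : ∀ s E, IsState (fun h => legSwap v w (opp ((legSwap v w).symm h)))
      (s ∘ (legSwap v w).symm) (mapMatching (Equiv.swap v w) E) ↔ IsState opp s E :=
    isState_map (Equiv.swap v w) (legSwap v w) (legSwap_apply v w) (fun h => by simp)
  have hV : ∀ E, componentCount (fun h => legSwap v w (opp ((legSwap v w).symm h)))
      (mapMatching (Equiv.swap v w) E) = componentCount opp E := by
    refine componentCount_map_of_vertex (Equiv.swap v w) (legSwap v w)
      (Equiv.swap (Sum.inl v) (Sum.inl w)) (fun h => by simp) (fun u => ?_) (fun h => ?_)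
    · simp only [Equiv.swap_apply_def, Sum.inl.injEq]
      split_ifs <;> rfl
    · rw [vertex_legSwap]
      simp only [Equiv.swap_apply_def]
      split_ifs <;> rfl
  have hD : ∀ x : (HalfEdge U T → Status) × Finset (U × U),
      stateWeight f opp x.1 x.2 - stateWeight f
        (fun h => legSwap v w (opp ((legSwap v w).symm h))) (x.1 ∘ (legSwap v w).symm)
        (mapMatching (Equiv.swap v w) x.2) = 2 * ((
        (if (v, w) ∈ x.2 ∧ x.1 (Sum.inl v) ≠ x.1 (Sum.inl w) then stateWeight f opp x.1 x.2 else 0) +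
        (if (w, v) ∈ x.2 ∧ x.1 (Sum.inl v) ≠ x.1 (Sum.inl w) then stateWeight f opp x.1 x.2
          else 0)) +
        (if Xor ((v, w) ∈ x.2) ((w, v) ∈ x.2) ∧ x.1 (Sum.inl v) = x.1 (Sum.inl w)
          then stateWeight f opp x.1 x.2 else 0)) := by
    rintro ⟨s, E⟩
    have h₁ : stateWeight f (fun h => legSwap v w (opp ((legSwap v w).symm h)))
        (s ∘ (legSwap v w).symm) (mapMatching (Equiv.swap v w) E) = stateWeight f opp s E *
          ((if (v, w) ∈ E then -1 else 1) * (if (w, v) ∈ E then -1 else 1)) := by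
      unfold stateWeight
      rw [hS, prod_stepSign_swap hvw, hV, prod_legSign_map _ _ (legSwap_apply v w)]
      have hT : ∀ p : T × Fin 3, (legSwap v w).symm (Sum.inr p) = (Sum.inr p : HalfEdge U T) := by
        intro p
        rw [Equiv.symm_apply_eq]
        simp [legSwap, Equiv.swap_apply_def]
      simp only [Function.comp_apply, hT]
      by_cases hx : IsState opp s E
      · rw [if_pos hx, if_pos hx]; ring
      · rw [if_neg hx, if_neg hx, zero_mul]
    rw [h₁]
    dsimp only
    by_cases h0 : stateWeight f opp s E = 0
    · simp [h0]
    have hM := (isState_of_stateWeight_ne_zero h0).2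
    -- With both edges present all four bits are `true`. Such states do not change sign, and this
    -- shows that the two terms for distinct statuses do not count them.
    have hboth : (v, w) ∈ E → (w, v) ∈ E → s (Sum.inl v) = s (Sum.inl w) := by
      intro k k'
      have a := (hM.src v).2 ⟨_, k⟩
      have b := (hM.tgt w).2 ⟨_, k⟩
      have c := (hM.src w).2 ⟨_, k'⟩
      have d := (hM.tgt v).2 ⟨_, k'⟩
      exact Prod.ext (a.trans c.symm) (d.trans b.symm)
    by_cases k : (v, w) ∈ E <;> by_cases k' : (w, v) ∈ E <;>
      by_cases hs : s (Sum.inl v) = s (Sum.inl w) <;> simp [k, k', hs, Xor]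
    · exact (hs (hboth k k')).elim
    all_goals ring
  have hfin := Finset.sum_congr rfl fun x (_ : x ∈ Finset.univ) => hD x
  rw [Finset.sum_sub_distrib, ← Finset.mul_sum, Finset.sum_add_distrib, Finset.sum_add_distrib, hC,
    add_zero] at hfin
  exact hfin

end stuSum

/-- Merging adds one edge and one trivalent vertex and removes one univalent vertex: the sign
exponent grows by two and the exponent of `2` by one. The resulting factor matches the one in
`stateSum_stu`. -/
theorem normalization_merge {n : ℕ} (t : ℕ) (hn : 1 ≤ n) :
    normalization (n - 1) (t + 1) = 2 * normalization n t := by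
  obtain ⟨n, rfl⟩ := Nat.exists_eq_add_of_le' hn
  have he : edgeNumber (n + 1 - 1) (t + 1) = edgeNumber (n + 1) t + 1 := by
    unfold edgeNumber
    omega
  unfold normalization
  rw [he, Nat.add_sub_cancel]
  have h2 : ((edgeNumber (n + 1) t + 1 : ℕ) : ℤ) - ((n : ℕ) + (t + 1 : ℕ)) =
      ((edgeNumber (n + 1) t : ℤ) - ((n + 1 : ℕ) + t)) + 1 := by push_cast; ring
  have h3 : (-1 : ℝ) ^ (edgeNumber (n + 1) t + 1 + (t + 1)) =
      (-1) ^ (edgeNumber (n + 1) t + t) := by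
    rw [show edgeNumber (n + 1) t + 1 + (t + 1) = edgeNumber (n + 1) t + t + 2 by ring, pow_add]
    norm_num
  rw [h3, h2, zpow_add_one₀ (by norm_num)]
  ring

theorem stateForm_merge (f : ℕ → ℝ) (Γ : JacobiDiagram) {v w : Γ.U} (hvw : v ⋖ w)
    (hne : Γ.opp (Sum.inl v) ≠ Sum.inl w) :
    stateForm f (Γ.merge v w hvw.ne hne) = stateForm f Γ - stateForm f (Γ.swapLegs v w) := by
  classical
  have hU : Fintype.card (Γ.merge v w hvw.ne hne).U = Fintype.card Γ.U - 1 := by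
    rw [← Set.card_ne_eq w]
    exact Fintype.card_congr (Equiv.refl _)
  have hT : Fintype.card (Γ.merge v w hvw.ne hne).T = Fintype.card Γ.T + 1 := by
    rw [← Fintype.card_option]
    exact Fintype.card_congr (Equiv.refl _)
  unfold stateForm
  rw [hU, hT, normalization_merge _ (Fintype.card_pos_iff.2 ⟨v⟩)]
  have h' : stateSum f Γ.opp - stateSum f (Γ.swapLegs v w).opp =
      2 * stateSum f (Γ.merge v w hvw.ne hne).opp :=
    @stateSum_stu Γ.U Γ.T _ _ _ f Γ.opp v w (Γ.merge v w hvw.ne hne).finU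
      (Γ.merge v w hvw.ne hne).finT hvw
  have hswap : normalization (Fintype.card (Γ.swapLegs v w).U) (Fintype.card (Γ.swapLegs v w).T) =
      normalization (Fintype.card Γ.U) (Fintype.card Γ.T) := rfl
  rw [hswap, ← mul_sub, h']
  ring

/-! ## Linear forms given by state sums -/

/-- The linear form on the space of diagrams given by state sums. -/
def stateLinear (f : ℕ → ℝ) : DiagramSpace →ₗ[ℝ] ℝ :=
  Submodule.liftQ _ (Finsupp.linearCombination ℝ (stateForm f)) <| by
    rw [Submodule.span_le]
    rintro x hx
    simp only [SetLike.mem_coe, LinearMap.mem_ker]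
    induction hx with
    | iso Γ Γ' h => simp [stateForm_iso f h]
    | as Γ t => simp [stateForm_reverse]
    | ihx Γ a b hab h₁ h₂ => simpa using stateForm_ihx f Γ a b hab h₁ h₂
    | stu Γ v w hvw hne => simp [stateForm_merge f Γ hvw hne]

theorem stateLinear_cls (f : ℕ → ℝ) (Γ : JacobiDiagram) :
    stateLinear f (cls Γ) = stateForm f Γ := by
  simp [stateLinear, cls]

theorem cls_iso {Γ Γ' : JacobiDiagram} (h : Γ.Iso Γ') : cls Γ = cls Γ' :=
  (Submodule.Quotient.eq _).2 (Submodule.subset_span (IsRelation.iso Γ Γ' h))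

theorem cls_merge {Γ : JacobiDiagram} {v w : Γ.U} (hvw : v ⋖ w)
    (hne : Γ.opp (Sum.inl v) ≠ Sum.inl w) :
    cls (Γ.merge v w hvw.ne hne) = cls Γ - cls (Γ.swapLegs v w) :=
  (Submodule.Quotient.eq _).2 (Submodule.subset_span (IsRelation.stu Γ v w hvw hne))

/-! ## Connectivity -/

namespace JacobiDiagram

/-- A union of components. -/
def IsUnionOfComponents (Γ : JacobiDiagram) (S : Set Γ.Vertex) : Prop :=
  ∀ h : HalfEdge Γ.U Γ.T, h.vertex ∈ S → (Γ.opp h).vertex ∈ S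

theorem IsUnionOfComponents.compl {Γ : JacobiDiagram} {S : Set Γ.Vertex}
    (hS : Γ.IsUnionOfComponents S) : Γ.IsUnionOfComponents Sᶜ := by
  intro h hh hh'
  have := hS _ hh'
  rw [Γ.opp_opp] at this
  exact hh this

theorem graph_adj (Γ : JacobiDiagram) (x y : Γ.Vertex) :
    Γ.graph.Adj x y ↔ ∃ h : HalfEdge Γ.U Γ.T, h.vertex = x ∧ (Γ.opp h).vertex = y := by
  unfold graph
  rw [SimpleGraph.fromRel_adj]
  constructor
  · rintro ⟨-, h | ⟨h, rfl, rfl⟩⟩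
    · exact h
    · exact ⟨Γ.opp h, rfl, by rw [Γ.opp_opp]⟩
  · rintro ⟨h, rfl, rfl⟩
    exact ⟨(Γ.no_loop h).symm, Or.inl ⟨h, rfl, rfl⟩⟩

theorem IsUnionOfComponents.mem_of_reachable {Γ : JacobiDiagram} {S : Set Γ.Vertex}
    (hS : Γ.IsUnionOfComponents S) {x y : Γ.Vertex} (hx : x ∈ S) (h : Γ.graph.Reachable x y) :
    y ∈ S := by
  obtain ⟨p⟩ := h
  induction p with
  | nil => exact hx
  | cons hadj _ ih =>
    obtain ⟨h, rfl, rfl⟩ := (Γ.graph_adj _ _).1 hadj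
    exact ih (hS h hx)

theorem isUnionOfComponents_reachable (Γ : JacobiDiagram) (x : Γ.Vertex) :
    Γ.IsUnionOfComponents {y | Γ.graph.Reachable x y} := fun h hh =>
  SimpleGraph.Reachable.trans hh
    (SimpleGraph.Adj.reachable ((Γ.graph_adj _ _).2 ⟨h, rfl, rfl⟩))

/-- Sets of vertices closed under `opp` are easily pulled back along mergings, exchanges and
restrictions, unlike components as classes of paths. -/
theorem hasTrivalentComponent_iff (Γ : JacobiDiagram) :
    Γ.HasTrivalentComponent ↔
      ∃ S, Γ.IsUnionOfComponents S ∧ S.Nonempty ∧ ∀ u, Sum.inl u ∉ S := by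
  constructor
  · rintro ⟨c, hc⟩
    induction c using SimpleGraph.ConnectedComponent.ind with
    | h x =>
      refine ⟨_, Γ.isUnionOfComponents_reachable x, ⟨x, SimpleGraph.Reachable.refl _⟩, ?_⟩
      intro u hu
      exact hc u (SimpleGraph.ConnectedComponent.eq.2 (SimpleGraph.Reachable.symm hu))
  · rintro ⟨S, hS, ⟨x, hx⟩, hu⟩
    refine ⟨Γ.graph.connectedComponentMk x, fun u h => ?_⟩
    exact hu u (hS.mem_of_reachable hx (SimpleGraph.ConnectedComponent.eq.1 h).symm)

theorem exists_of_not_connected (Γ : JacobiDiagram) (hne : Nonempty Γ.Vertex)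
    (h : ¬ Γ.graph.Connected) : ∃ S, Γ.IsUnionOfComponents S ∧ S.Nonempty ∧ Sᶜ.Nonempty := by
  by_contra hS
  push Not at hS
  apply h
  have := hne
  refine ⟨fun x y => ?_⟩
  have := hS _ (Γ.isUnionOfComponents_reachable x) ⟨x, SimpleGraph.Reachable.refl _⟩
  rw [Set.compl_empty_iff] at this
  exact (Set.eq_univ_iff_forall.1 this) y

end JacobiDiagram

/-! ### Vanishing on diagrams with a trivalent component. -/

theorem triSign_status {x : Fin 3 → Status} (h : triSign (x 0) (x 1) (x 2) ≠ 0) :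
    (∀ i, x i ≠ (false, false)) ∧ ∃ i, x i = (true, true) := by
  have key : ∀ a b c : Status, triSign a b c ≠ 0 → (a ≠ (false, false) ∧ b ≠ (false, false) ∧
      c ≠ (false, false)) ∧ (a = (true, true) ∨ b = (true, true) ∨ c = (true, true)) := by
    decide
  obtain ⟨⟨h0, h1, h2⟩, h3⟩ := key _ _ _ h
  refine ⟨fun i => ?_, ?_⟩
  · fin_cases i
    exacts [h0, h1, h2]
  · rcases h3 with h | h | h
    exacts [⟨0, h⟩, ⟨1, h⟩, ⟨2, h⟩]

/-- In a state of nonzero weight each trivalent vertex receives a leg, whose tail has status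
`(false, false)`. In a component without univalent vertices that tail sits at a trivalent vertex,
where this status is impossible. -/
theorem stateForm_of_hasTrivalentComponent (f : ℕ → ℝ) (Γ : JacobiDiagram)
    (h : Γ.HasTrivalentComponent) : stateForm f Γ = 0 := by
  obtain ⟨S, hS, ⟨x, hx⟩, hu⟩ := (Γ.hasTrivalentComponent_iff).1 h
  rcases x with u | t
  · exact (hu u hx).elim
  refine mul_eq_zero_of_right _ (Finset.sum_eq_zero fun x _ => ?_)
  by_contra h0
  have htri := triSign_ne_zero_of_stateWeight_ne_zero h0
  obtain ⟨i, hi⟩ := (triSign_status (x := fun i => x.1 (Sum.inr (t, i))) (htri t)).2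
  have ho := (isState_of_stateWeight_ne_zero h0).1 (Sum.inr (t, i))
  have hm := hS (Sum.inr (t, i)) hx
  rw [hi] at ho
  rcases hk : Γ.opp (Sum.inr (t, i)) with u | ⟨t', i'⟩
  · rw [hk] at hm; exact hu u hm
  · rw [hk] at ho
    exact (triSign_status (x := fun i => x.1 (Sum.inr (t', i))) (htri t')).1 i' ho

/-! ## Resolution of trivalent vertices -/

section unmerge

variable {U T : Type}

/-- The set `U` with a new element. -/
inductive Inserted {U : Type} (u : U) : Type
  | old : U → Inserted u
  | new : Inserted u

/-- The position of an element: the new element comes just after `u`. -/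
def Inserted.position {u : U} : Inserted u → U ×ₗ Bool
  | .old x => toLex (x, false)
  | .new => toLex (u, true)

theorem Inserted.position_injective (u : U) : Function.Injective (position (u := u)) := by
  rintro (x | _) (y | _) h <;> simp_all [position]

instance [LinearOrder U] (u : U) : LinearOrder (Inserted u) :=
  LinearOrder.lift' _ (Inserted.position_injective u)

theorem Inserted.lt_iff [LinearOrder U] {u : U} (x y : Inserted u) :
    x < y ↔ x.position < y.position := Iff.rfl

instance [Finite U] (u : U) : Finite (Inserted u) :=
  Finite.of_injective (fun x : Inserted u => (ofLex x.position)) fun _ _ h =>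
    Inserted.position_injective u (ofLex.injective h)

theorem Inserted.old_lt_old [LinearOrder U] {u x y : U} :
    (old x : Inserted u) < old y ↔ x < y := by
  simp [lt_iff, position, Prod.Lex.toLex_lt_toLex]

theorem Inserted.covBy [LinearOrder U] (u : U) : (old u : Inserted u) ⋖ new := by
  constructor
  · simp [lt_iff, position, Prod.Lex.toLex_lt_toLex]
  · rintro (x | _) h₁ h₂
    · have h₁' := old_lt_old.1 h₁
      simp only [lt_iff, position, Prod.Lex.toLex_lt_toLex] at h₂
      rcases h₂ with h₂ | ⟨h₂, -⟩
      · exact lt_asymm h₁' h₂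
      · exact h₁'.ne' h₂
    · exact lt_irrefl _ h₂

open Classical in
/-- The half-edges of a diagram, seen in the diagram obtained by resolving the vertex `t`, whose
half-edge `i` ends at `u`. -/
def resolveHalf (t : T) (i : Fin 3) (u : U) :
    HalfEdge U T → HalfEdge (Inserted u) {x : T // x ≠ t}
  | Sum.inl x => Sum.inl (.old x)
  | Sum.inr (s, k) => if h : s = t then (if k = i + 1 then Sum.inl .new else Sum.inl (.old u))
      else Sum.inr (⟨s, h⟩, k)

open Classical in
/-- The half-edges of a resolved diagram, seen in the original diagram. -/
def unresolveHalf (t : T) (i : Fin 3) (u : U) :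
    HalfEdge (Inserted u) {x : T // x ≠ t} → HalfEdge U T
  | Sum.inl .new => Sum.inr (t, i + 1)
  | Sum.inl (.old x) => if x = u then Sum.inr (t, i + 2) else Sum.inl x
  | Sum.inr (s, k) => Sum.inr (s.1, k)

/-- The univalent vertices that remain when the new one is fused with `u`. -/
def Inserted.equiv (u : U) : {x : Inserted u // x ≠ .new} ≃ U where
  toFun
    | ⟨.old x, _⟩ => x
    | ⟨.new, h⟩ => (h rfl).elim
  invFun x := ⟨.old x, by simp⟩
  left_inv := by
    rintro ⟨x | _, h⟩
    · rfl
    · exact (h rfl).elim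
  right_inv _ := rfl

theorem Inserted.equiv_le [LinearOrder U] {u : U} (x y : {x : Inserted u // x ≠ .new}) :
    Inserted.equiv u x ≤ Inserted.equiv u y ↔ x ≤ y := by
  rcases x with ⟨x | _, hx⟩
  · rcases y with ⟨y | _, hy⟩
    · rw [← not_lt, ← not_lt]
      exact not_congr old_lt_old.symm
    · exact (hy rfl).elim
  · exact (hx rfl).elim

open Classical in
/-- The half-edges of the diagram obtained by resolution and fusion. -/
def fuseHalf (t : T) (i : Fin 3) (u : U)  :
    HalfEdge {x : Inserted u // x ≠ .new} (Option {x : T // x ≠ t}) → HalfEdge U T :=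
  Sum.map (Inserted.equiv u) fun p => (Equiv.optionSubtypeNe t p.1,
    p.2 + (fun x : Option {x : T // x ≠ t} => x.elim i fun _ => 0) p.1)

/-- Merging gives the end at `.new` the label `1` and the end at `.old u` the label `2`. Rotated by
`i` these become `i + 1` and `i + 2`, the labels chosen in the resolution. -/
theorem fuseHalf_mergeHalf (t : T) (i : Fin 3) (u : U)
    (h : HalfEdge (Inserted u) {x : T // x ≠ t}) :
    fuseHalf t i u (mergeHalf (.old u) .new h) = unresolveHalf t i u h := by
  rcases h with (x | _) | ⟨⟨s, hs⟩, k⟩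
  · by_cases hx : x = u
    · subst hx
      simp [fuseHalf, mergeHalf, unresolveHalf, add_comm]
    · simp [fuseHalf, mergeHalf, unresolveHalf, hx, Inserted.equiv]
  · simp [fuseHalf, mergeHalf, unresolveHalf, add_comm]
  · simp [fuseHalf, mergeHalf, unresolveHalf]

theorem fuseHalf_new (t : T) (i : Fin 3) (u : U) :
    fuseHalf t i u (Sum.inr (none, 0)) = Sum.inr (t, i) ∧
      fuseHalf t i u (Sum.inl ⟨.old u, by simp⟩) = Sum.inl u := by
  simp [fuseHalf, Inserted.equiv]

theorem resolveHalf_unresolveHalf (t : T) (i : Fin 3) (u : U)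
    (h : HalfEdge (Inserted u) {x : T // x ≠ t}) :
    resolveHalf t i u (unresolveHalf t i u h) = h := by
  rcases h with (x | _) | ⟨⟨s, hs⟩, k⟩
  · by_cases hx : x = u
    · subst hx
      simp [unresolveHalf, resolveHalf]
    · simp [unresolveHalf, resolveHalf, hx]
  · simp [unresolveHalf, resolveHalf]
  · simp [unresolveHalf, resolveHalf, hs]

theorem unresolveHalf_resolveHalf (t : T) (i : Fin 3) (u : U) (h : HalfEdge U T)
    (h₁ : h ≠ Sum.inl u) (h₂ : h ≠ Sum.inr (t, i)) :
    unresolveHalf t i u (resolveHalf t i u h) = h := by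
  rcases h with x | ⟨s, k⟩
  · have : x ≠ u := fun e => h₁ (by rw [e])
    simp [unresolveHalf, resolveHalf, this]
  · by_cases hs : s = t
    · subst hs
      by_cases hk : k = i + 1
      · simp [unresolveHalf, resolveHalf, hk]
      · have hk' : k ≠ i := fun e => h₂ (by rw [e])
        have : k = i + 2 := by
          have : ∀ i k : Fin 3, k ≠ i + 1 → k ≠ i → k = i + 2 := by decide
          exact this i k hk hk'
        simp [unresolveHalf, resolveHalf, this]
    · simp [unresolveHalf, resolveHalf, hs]

theorem unresolveHalf_ne (t : T) (i : Fin 3) (u : U) (h : HalfEdge (Inserted u) {x : T // x ≠ t}) :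
    unresolveHalf t i u h ≠ Sum.inl u ∧ unresolveHalf t i u h ≠ Sum.inr (t, i) := by
  rcases h with (x | _) | ⟨⟨s, hs⟩, k⟩
  · by_cases hx : x = u
    · subst hx
      simp [unresolveHalf]
    · simp [unresolveHalf, hx]
  · simp [unresolveHalf]
  · simp [unresolveHalf, hs]

theorem vertex_resolveHalf (t : T) (i : Fin 3) (u : U) (a b : HalfEdge U T)
    (ha₁ : a ≠ Sum.inl u) (ha₂ : a ≠ Sum.inr (t, i)) (hb₁ : b ≠ Sum.inl u)
    (hb₂ : b ≠ Sum.inr (t, i))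
    (h : (resolveHalf t i u a).vertex = (resolveHalf t i u b).vertex) : a.vertex = b.vertex := by
  have inj : resolveHalf t i u a = resolveHalf t i u b → a = b := fun e => by
    rw [← unresolveHalf_resolveHalf t i u a ha₁ ha₂, e, unresolveHalf_resolveHalf t i u b hb₁ hb₂]
  rcases ka : resolveHalf t i u a with x | ⟨s, k⟩ <;> rcases kb : resolveHalf t i u b with y | ⟨r, l⟩
  · rw [ka, kb] at h
    have : x = y := by simpa [HalfEdge.vertex] using h
    rw [inj (by rw [ka, kb, this])]
  · rw [ka, kb] at h; simp [HalfEdge.vertex] at h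
  · rw [ka, kb] at h; simp [HalfEdge.vertex] at h
  · rw [ka, kb] at h
    have : s = r := by simpa [HalfEdge.vertex] using h
    rw [← unresolveHalf_resolveHalf t i u a ha₁ ha₂, ← unresolveHalf_resolveHalf t i u b hb₁ hb₂,
      ka, kb, this]
    rfl

end unmerge

namespace JacobiDiagram

/-- The resolution of a trivalent vertex `t` whose half-edge `i` is joined to the univalent vertex
`u`: this edge is removed, and the two other edges at `t` end at two adjacent univalent
vertices. -/
def resolve (Γ : JacobiDiagram) (u : Γ.U) (t : Γ.T) (i : Fin 3)
    (h : Γ.opp (Sum.inl u) = Sum.inr (t, i)) : JacobiDiagram where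
  U := Inserted u
  T := {x : Γ.T // x ≠ t}
  finU := Fintype.ofFinite _
  finT := Fintype.ofFinite _
  opp := fun k => resolveHalf t i u (Γ.opp (unresolveHalf t i u k))
  opp_opp := fun k => by
    have h' : Γ.opp (Sum.inr (t, i)) = Sum.inl u := by rw [← h, Γ.opp_opp]
    obtain ⟨h₁, h₂⟩ := unresolveHalf_ne t i u k
    rw [unresolveHalf_resolveHalf, Γ.opp_opp, resolveHalf_unresolveHalf]
    · exact fun e => h₂ (by rw [← Γ.opp_opp (unresolveHalf t i u k), e, h])
    · exact fun e => h₁ (by rw [← Γ.opp_opp (unresolveHalf t i u k), e, h'])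
  no_loop := fun k => by
    have h' : Γ.opp (Sum.inr (t, i)) = Sum.inl u := by rw [← h, Γ.opp_opp]
    obtain ⟨h₁, h₂⟩ := unresolveHalf_ne t i u k
    intro e
    nth_rewrite 2 [← resolveHalf_unresolveHalf t i u k] at e
    refine Γ.no_loop _ (vertex_resolveHalf t i u _ _ ?_ ?_ h₁ h₂ e)
    · exact fun e => h₂ (by rw [← Γ.opp_opp (unresolveHalf t i u k), e, h])
    · exact fun e => h₁ (by rw [← Γ.opp_opp (unresolveHalf t i u k), e, h'])

section resolve

variable (Γ : JacobiDiagram) (u : Γ.U) (t : Γ.T) (i : Fin 3)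
  (h : Γ.opp (Sum.inl u) = Sum.inr (t, i))

/-- An edge between the two new neighbours would have been a loop at `t`. -/
theorem resolve_opp_ne :
    (Γ.resolve u t i h).opp (Sum.inl (.old u : Inserted u)) ≠ Sum.inl (.new : Inserted u) := by
  intro e
  have e₁ : resolveHalf t i u (Γ.opp (unresolveHalf t i u (Sum.inl (.old u)))) = Sum.inl .new := e
  have e₂ : unresolveHalf t i u (Sum.inl (.old u)) = (Sum.inr (t, i + 2) : HalfEdge Γ.U Γ.T) := by
    simp [unresolveHalf]
  have h' : Γ.opp (Sum.inr (t, i)) = Sum.inl u := by rw [← h, Γ.opp_opp]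
  rw [e₂] at e₁
  have e₃ := congrArg (unresolveHalf t i u) e₁
  rw [unresolveHalf_resolveHalf] at e₃
  · exact Γ.no_loop _ (by rw [e₃]; rfl)
  · intro e
    have := congrArg Γ.opp e
    rw [Γ.opp_opp, h] at this
    simp at this
  · intro e
    have := congrArg Γ.opp e
    rw [Γ.opp_opp, h'] at this
    simp at this

theorem card_resolve_T : Fintype.card (Γ.resolve u t i h).T + 1 = Fintype.card Γ.T := by
  classical
  have : Fintype.card (Γ.resolve u t i h).T = Fintype.card Γ.T - 1 := by
    rw [← Set.card_ne_eq t]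
    exact Fintype.card_congr (Equiv.refl _)
  rw [this]
  exact Nat.sub_add_cancel (Fintype.card_pos_iff.2 ⟨t⟩)

/-- Thus a diagram with a trivalent vertex next to a univalent one is, up to isomorphism, the merged
term of an STU relation whose other two diagrams have one trivalent vertex less. -/
theorem merge_resolve : ((Γ.resolve u t i h).merge (.old u : Inserted u) (.new : Inserted u)
    (Inserted.covBy u).ne (Γ.resolve_opp_ne u t i h)).Iso Γ := by
  classical
  refine ⟨⟨Inserted.equiv u, fun {x y} => Inserted.equiv_le x y⟩, Equiv.optionSubtypeNe t,
    fun x => x.elim i fun _ => 0, ?_⟩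
  · have h' : Γ.opp (Sum.inr (t, i)) = Sum.inl u := by rw [← h, Γ.opp_opp]
    obtain ⟨h0, hv⟩ := fuseHalf_new t i u
    let o : HalfEdge (Inserted u) {x : Γ.T // x ≠ t} → HalfEdge (Inserted u) {x : Γ.T // x ≠ t} :=
      fun k => resolveHalf t i u (Γ.opp (unresolveHalf t i u k))
    have hm := mergeOpp_new o (.old u) .new (Inserted.covBy u).ne
    have key : ∀ k, Γ.opp (fuseHalf t i u k) = fuseHalf t i u
        (mergeOpp o (.old u) .new (Inserted.covBy u).ne k) := by
      intro k
      rcases mergeHalf_cases (Inserted.old u) Inserted.new (Inserted.covBy u).ne k with rfl | rfl | ⟨k, rfl⟩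
      · rw [hm.1, hv, h0, h]
      · rw [hm.2, hv, h0, h']
      · rw [mergeOpp_mergeHalf, fuseHalf_mergeHalf, fuseHalf_mergeHalf]
        obtain ⟨h₁, h₂⟩ := unresolveHalf_ne t i u k
        refine (unresolveHalf_resolveHalf t i u _ ?_ ?_).symm
        · exact fun e => h₂ (by rw [← Γ.opp_opp (unresolveHalf t i u k), e, h])
        · exact fun e => h₁ (by rw [← Γ.opp_opp (unresolveHalf t i u k), e, h'])
    intro φ k
    have e : φ = fuseHalf t i u := by
      unfold fuseHalf
      congr!
    rw [e]
    exact key k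

end resolve

/-- Diagrams are determined, up to isomorphism, by chord diagrams, diagrams with trivalent
components and STU. -/
theorem induction_on_trivalent {P : JacobiDiagram → Prop}
    (chord : ∀ Γ : JacobiDiagram, IsEmpty Γ.T → P Γ)
    (trivalent : ∀ Γ : JacobiDiagram, Γ.HasTrivalentComponent → P Γ)
    (iso : ∀ Γ Γ' : JacobiDiagram, Γ.Iso Γ' → P Γ → P Γ')
    (stu : ∀ (Γ : JacobiDiagram) (v w : Γ.U) (hvw : v ⋖ w)
      (hne : Γ.opp (Sum.inl v) ≠ Sum.inl w), P Γ → P (Γ.swapLegs v w) → P (Γ.merge v w hvw.ne hne))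
    (Γ : JacobiDiagram) : P Γ := by
  induction hn : Fintype.card Γ.T generalizing Γ with
  | zero => exact chord Γ (Fintype.card_eq_zero_iff.1 hn)
  | succ n ih =>
    by_cases hT : Γ.HasTrivalentComponent
    · exact trivalent Γ hT
    -- Otherwise the trivalent vertices together would form a union of components without univalent
    -- vertices.
    have : ∃ t i u, Γ.opp (Sum.inr (t, i)) = Sum.inl u := by
      by_contra hno
      push Not at hno
      refine hT (Γ.hasTrivalentComponent_iff.2 ⟨Set.range Sum.inr, ?_, ?_, by simp⟩)
      · rintro (u | ⟨t, i⟩) hk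
        · simp [HalfEdge.vertex] at hk
        · rcases hk : Γ.opp (Sum.inr (t, i)) with u | ⟨s, j⟩
          · exact (hno t i u hk).elim
          · exact ⟨s, rfl⟩
      · obtain ⟨t⟩ := Fintype.card_pos_iff.1 (by omega : 0 < Fintype.card Γ.T)
        exact ⟨_, t, rfl⟩
    obtain ⟨t, i, u, h⟩ := this
    have h' : Γ.opp (Sum.inl u) = Sum.inr (t, i) := by rw [← h, Γ.opp_opp]
    have hc := Γ.card_resolve_T u t i h'
    exact iso _ _ (Γ.merge_resolve u t i h') (stu _ _ _ (Inserted.covBy u) _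
      (ih _ (by omega)) (ih _ (by change Fintype.card (Γ.resolve u t i h').T = n; omega)))

end JacobiDiagram

/-- A linear form is determined by its values on chord diagrams and on diagrams with trivalent
components. -/
theorem eq_of_chord {w w' : DiagramSpace →ₗ[ℝ] ℝ}
    (chord : ∀ Γ : JacobiDiagram, IsEmpty Γ.T → w (cls Γ) = w' (cls Γ))
    (trivalent : ∀ Γ : JacobiDiagram, Γ.HasTrivalentComponent → w (cls Γ) = w' (cls Γ)) :
    w = w' := by
  have key : ∀ Γ : JacobiDiagram, w (cls Γ) = w' (cls Γ) := by
    intro Γ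
    induction Γ using JacobiDiagram.induction_on_trivalent with
    | chord Γ h => exact chord Γ h
    | trivalent Γ h => exact trivalent Γ h
    | iso Γ Γ' h ih => rw [← cls_iso h]; exact ih
    | stu Γ v w hvw hne h₁ h₂ => rw [cls_merge hvw hne, map_sub, map_sub, h₁, h₂]
  refine Submodule.linearMap_qext _ (Finsupp.lhom_ext' fun Γ => LinearMap.ext_ring ?_)
  exact key Γ

/-! ## Products -/

namespace JacobiDiagram

/-- The univalent vertices of a nontrivial union of components precede all other ones. -/
def IsSplit (Γ : JacobiDiagram) : Prop :=
  ∃ S, Γ.IsUnionOfComponents S ∧ (∃ u, Sum.inl u ∈ S) ∧ (∃ u, Sum.inl u ∉ S) ∧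
    ∀ u u', Sum.inl u ∈ S → Sum.inl u' ∉ S → u < u'

theorem IsSplit.of_iso {Γ Γ' : JacobiDiagram} (h : Γ.Iso Γ') (hs : Γ'.IsSplit) : Γ.IsSplit := by
  obtain ⟨f, g, r, ho⟩ := h
  obtain ⟨S, hS, ⟨a, ha⟩, ⟨b, hb⟩, hlt⟩ := hs
  have hv : ∀ k : HalfEdge Γ.U Γ.T, HalfEdge.vertex (Sum.map f (fun p => (g p.1, p.2 + r p.1)) k :
      HalfEdge Γ'.U Γ'.T) = Sum.map f g k.vertex := by
    rintro (u | ⟨t, i⟩) <;> rfl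
  refine ⟨Sum.map f g ⁻¹' S, ?_, ⟨f.symm a, by simpa using ha⟩, ⟨f.symm b, by simpa using hb⟩, ?_⟩
  · intro k hk
    rw [Set.mem_preimage, ← hv] at hk ⊢
    have := hS _ hk
    rwa [ho] at this
  · intro u u' hu hu'
    exact f.lt_iff_lt.1 (hlt _ _ hu hu')

open Classical in
theorem vertex_legSwap_mem {U T : Type} {v w : U} {S : Set (U ⊕ T)}
    (hwv : Sum.inl w ∈ S ↔ Sum.inl v ∈ S) (h : HalfEdge U T) :
    (legSwap v w h).vertex ∈ S ↔ h.vertex ∈ S := by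
  rw [vertex_legSwap]
  by_cases h₁ : h.vertex = Sum.inl v
  · rw [h₁, Equiv.swap_apply_left, hwv]
  · by_cases h₂ : h.vertex = Sum.inl w
    · rw [h₂, Equiv.swap_apply_right, hwv]
    · rw [Equiv.swap_apply_of_ne_of_ne h₁ h₂]

open Classical in
/-- The image of a set of vertices under an exchange of two univalent vertices. -/
def swapSet {U T : Type} (v w : U) (S : Set (U ⊕ T)) : Set (U ⊕ T) :=
  {x | Equiv.swap (Sum.inl v) (Sum.inl w) x ∈ S}

open Classical in
theorem vertex_legSwap_mem_swapSet {U T : Type} (v w : U) (S : Set (U ⊕ T)) (h : HalfEdge U T) :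
    (legSwap v w h).vertex ∈ swapSet v w S ↔ h.vertex ∈ S := by
  rw [vertex_legSwap, swapSet, Set.mem_ofPred_eq, Equiv.swap_apply_self]

theorem inl_mem_swapSet {U T : Type} [DecidableEq U] (v w : U) (S : Set (U ⊕ T)) (u : U) :
    Sum.inl u ∈ swapSet v w S ↔ Sum.inl (Equiv.swap v w u) ∈ S := by
  rw [swapSet, Set.mem_ofPred_eq]
  have : ∀ d : DecidableEq (U ⊕ T), @Equiv.swap _ d (Sum.inl v) (Sum.inl w) (Sum.inl u : U ⊕ T) =
      Sum.inl (Equiv.swap v w u) := fun d => by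
    simp only [Equiv.swap_apply_def, Sum.inl.injEq]
    split_ifs <;> rfl
  rw [this]

theorem IsUnionOfComponents.swapLegs {Γ : JacobiDiagram} {S : Set Γ.Vertex}
    (hS : Γ.IsUnionOfComponents S) (v w : Γ.U) {S' : Set Γ.Vertex}
    (h : ∀ k : HalfEdge Γ.U Γ.T, (legSwap v w k).vertex ∈ S' ↔ k.vertex ∈ S) :
    (Γ.swapLegs v w).IsUnionOfComponents S' := by
  intro k hk
  obtain ⟨k, rfl⟩ := (legSwap v w).surjective k
  have e : (Γ.swapLegs v w).opp (legSwap v w k) = legSwap v w (Γ.opp k) :=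
    congrArg (fun x => legSwap v w (Γ.opp x)) (Equiv.symm_apply_apply _ _)
  rw [e]
  exact (h _).2 (hS _ ((h _).1 hk))

/-- In the pulled back set, `v` and `w` lie on the same side, as both become the new trivalent
vertex. Being adjacent on the line, they compare in the same way with the vertices of the other
side, and exchanging them does no harm. -/
theorem IsSplit.of_merge {Γ : JacobiDiagram} {v w : Γ.U} (hvw : v ⋖ w)
    (hne : Γ.opp (Sum.inl v) ≠ Sum.inl w) (h : (Γ.merge v w hvw.ne hne).IsSplit) :
    Γ.IsSplit ∧ (Γ.swapLegs v w).IsSplit := by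
  obtain ⟨S', hS', ⟨⟨a, ha'⟩, ha⟩, ⟨⟨b, hb'⟩, hb⟩, hlt⟩ := h
  have hopp : ∀ k, (mergeOpp Γ.opp v w hvw.ne k).vertex ∈ S' ↔ k.vertex ∈ S' := fun k => by
    refine ⟨fun hk => ?_, hS' k⟩
    have e : mergeOpp Γ.opp v w hvw.ne (mergeOpp Γ.opp v w hvw.ne k) = k :=
      (Γ.merge v w hvw.ne hne).opp_opp k
    have this : (mergeOpp Γ.opp v w hvw.ne (mergeOpp Γ.opp v w hvw.ne k)).vertex ∈ S' := hS' _ hk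
    rwa [e] at this
  have hnew : (Sum.inr none : {x : Γ.U // x ≠ w} ⊕ Option Γ.T) ∈ S' ↔
      Sum.inl (⟨v, hvw.ne⟩ : {x : Γ.U // x ≠ w}) ∈ S' := by
    have := hopp (Sum.inl ⟨v, hvw.ne⟩)
    rwa [(mergeOpp_new Γ.opp v w hvw.ne).1] at this
  set S : Set Γ.Vertex := {x | mergeVertex v w x ∈ S'} with hSdef
  have hS : Γ.IsUnionOfComponents S := by
    intro k hk
    change mergeVertex v w k.vertex ∈ S' at hk
    change mergeVertex v w (Γ.opp k).vertex ∈ S'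
    rw [mergeVertex_vertex] at hk ⊢
    rw [← mergeOpp_mergeHalf Γ.opp v w hvw.ne]
    exact (hopp _).2 hk
  have hold : ∀ x (hx : x ≠ w), Sum.inl x ∈ S ↔
      Sum.inl (⟨x, hx⟩ : {x : Γ.U // x ≠ w}) ∈ S' := by
    intro x hx
    change mergeVertex v w (Sum.inl x) ∈ S' ↔ _
    by_cases hxv : x = v
    · subst hxv
      simp [mergeVertex, hnew]
    · rw [show mergeVertex v w (Sum.inl x) = Sum.inl ⟨x, hx⟩ by simp [mergeVertex, hx, hxv]]
      exact Iff.rfl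
  have hwv : Sum.inl w ∈ S ↔ Sum.inl v ∈ S := by
    rw [hold v hvw.ne, ← hnew]
    change mergeVertex v w (Sum.inl w) ∈ S' ↔ _
    simp [mergeVertex]
  have hprop : (∃ u, Sum.inl u ∈ S) ∧ (∃ u, Sum.inl u ∉ S) ∧
    ∀ u u', Sum.inl u ∈ S → Sum.inl u' ∉ S → u < u' := by
    refine ⟨⟨a, (hold a ha').2 ha⟩, ⟨b, fun h => hb ((hold b hb').1 h)⟩, ?_⟩
    have key : ∀ u u', u ≠ w → u' ≠ w → Sum.inl u ∈ S → Sum.inl u' ∉ S → u < u' :=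
      fun u u' h h' hu hu' => hlt ⟨u, h⟩ ⟨u', h'⟩ ((hold u h).1 hu)
        fun k => hu' ((hold u' h').2 k)
    intro u u' hu hu'
    by_cases h₁ : u = w
    · subst h₁
      have h₂ : u' ≠ u := fun e => hu' (e ▸ hu)
      have h₃ := key v u' hvw.ne h₂ (hwv.1 hu) hu'
      exact lt_of_le_of_ne (not_lt.1 fun k => hvw.2 h₃ k) h₂.symm
    · by_cases h₂ : u' = w
      · subst h₂
        exact (key u v h₁ hvw.ne hu (fun k => hu' (hwv.2 k))).trans hvw.1
      · exact key u u' h₁ h₂ hu hu'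
  refine ⟨⟨S, hS, hprop⟩, S, hS.swapLegs v w fun k => vertex_legSwap_mem (U := Γ.U) (T := Γ.T) hwv k, hprop⟩

theorem exists_univalent {Γ : JacobiDiagram} (h : ¬ Γ.HasTrivalentComponent) {S : Set Γ.Vertex}
    (hS : Γ.IsUnionOfComponents S) (hne : S.Nonempty) : ∃ u, Sum.inl u ∈ S := by
  by_contra hu
  push Not at hu
  exact h (Γ.hasTrivalentComponent_iff.2 ⟨S, hS, hne, hu⟩)

/-- The hypotheses on components serve to find a univalent vertex in each factor. -/
theorem isSplit_prod {Γ₁ Γ₂ : JacobiDiagram} (h₁ : Nonempty Γ₁.Vertex) (h₂ : Nonempty Γ₂.Vertex)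
    (h₁' : ¬ Γ₁.HasTrivalentComponent) (h₂' : ¬ Γ₂.HasTrivalentComponent) :
    (Γ₁.prod Γ₂).IsSplit := by
  obtain ⟨u₁, -⟩ := exists_univalent h₁' (S := Set.univ) (fun _ _ => trivial) Set.univ_nonempty
  obtain ⟨u₂, -⟩ := exists_univalent h₂' (S := Set.univ) (fun _ _ => trivial) Set.univ_nonempty
  have hl : ∀ k : HalfEdge Γ₁.U Γ₁.T, HalfEdge.vertex (prodInl k :
      HalfEdge (Γ₁.U ⊕ₗ Γ₂.U) (Γ₁.T ⊕ Γ₂.T)) =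
      Sum.map (fun u => toLex (Sum.inl u)) Sum.inl k.vertex := by
    rintro (u | ⟨t, i⟩) <;> rfl
  have hr : ∀ k : HalfEdge Γ₂.U Γ₂.T, HalfEdge.vertex (prodInr k :
      HalfEdge (Γ₁.U ⊕ₗ Γ₂.U) (Γ₁.T ⊕ Γ₂.T)) =
      Sum.map (fun u => toLex (Sum.inr u)) Sum.inr k.vertex := by
    rintro (u | ⟨t, i⟩) <;> rfl
  let S : Set ((Γ₁.U ⊕ₗ Γ₂.U) ⊕ (Γ₁.T ⊕ Γ₂.T)) :=
    Set.range (Sum.map (fun u => toLex (Sum.inl u)) Sum.inl : Γ₁.U ⊕ Γ₁.T → _)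
  have hin : ∀ u : Γ₁.U, (Sum.inl (toLex (Sum.inl u))) ∈ S := fun u => ⟨Sum.inl u, rfl⟩
  have hout : ∀ u : Γ₂.U, (Sum.inl (toLex (Sum.inr u))) ∉ S := by
    rintro u ⟨_ | _, h⟩ <;> simp at h
  refine ⟨S, ?_, ⟨_, hin u₁⟩, ⟨_, hout u₂⟩, ?_⟩
  · intro k hk
    change (prodOpp Γ₁.opp Γ₂.opp k).vertex ∈ S
    rcases prod_cases k with ⟨k, rfl⟩ | ⟨k, rfl⟩
    · rw [prodOpp_inl, hl]
      exact ⟨_, rfl⟩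
    · have hk' : (prodInr k : HalfEdge (Γ₁.U ⊕ₗ Γ₂.U) (Γ₁.T ⊕ Γ₂.T)).vertex ∈ S := hk
      rw [hr] at hk'
      obtain ⟨x, hx⟩ := hk'
      rcases k with u | ⟨t, i⟩ <;> rcases x with y | y <;> simp [HalfEdge.vertex] at hx
  · rintro (u | u) (u' | u') hu hu'
    · exact (hu' (hin u')).elim
    · exact Sum.Lex.inl_lt_inr _ _
    · exact (hout u hu).elim
    · exact (hout u hu).elim

/-! ## Restriction to a union of components -/

section restrict

variable {U T : Type} (S : Set (U ⊕ T))

/-- The half-edges of a restriction. -/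
def restrictHalf : HalfEdge {u : U // Sum.inl u ∈ S} {t : T // Sum.inr t ∈ S} ≃
    {h : HalfEdge U T // h.vertex ∈ S} where
  toFun
    | Sum.inl u => ⟨Sum.inl u.1, u.2⟩
    | Sum.inr (t, i) => ⟨Sum.inr (t.1, i), t.2⟩
  invFun
    | ⟨Sum.inl u, h⟩ => Sum.inl ⟨u, h⟩
    | ⟨Sum.inr (t, i), h⟩ => Sum.inr (⟨t, h⟩, i)
  left_inv := by rintro (u | ⟨t, i⟩) <;> rfl
  right_inv := by rintro ⟨u | ⟨t, i⟩, h⟩ <;> rfl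

/-- The vertices of a restriction. -/
def restrictVertex : {u : U // Sum.inl u ∈ S} ⊕ {t : T // Sum.inr t ∈ S} → U ⊕ T :=
  Sum.map Subtype.val Subtype.val

theorem restrictVertex_injective : Function.Injective (restrictVertex S) :=
  Sum.map_injective.2 ⟨Subtype.val_injective, Subtype.val_injective⟩

theorem vertex_restrictHalf (h : HalfEdge {u : U // Sum.inl u ∈ S} {t : T // Sum.inr t ∈ S}) :
    (restrictHalf S h).1.vertex = restrictVertex S h.vertex := by
  rcases h with u | ⟨t, i⟩ <;> rfl

end restrict

/-- The diagram formed by some components. -/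
def restrict (Γ : JacobiDiagram) (S : Set Γ.Vertex) (hS : Γ.IsUnionOfComponents S) :
    JacobiDiagram where
  U := {u : Γ.U // Sum.inl u ∈ S}
  T := {t : Γ.T // Sum.inr t ∈ S}
  finU := Fintype.ofFinite _
  finT := Fintype.ofFinite _
  opp := fun h => (restrictHalf S).symm
    ⟨Γ.opp (restrictHalf S h).1, hS _ (restrictHalf S h).2⟩
  opp_opp := fun h => by simp [Γ.opp_opp]
  no_loop := fun h e => by
    have := congrArg (restrictVertex S) e
    rw [← vertex_restrictHalf, ← vertex_restrictHalf, Equiv.apply_symm_apply] at this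
    exact Γ.no_loop _ this

theorem restrictHalf_opp (Γ : JacobiDiagram) (S : Set Γ.Vertex) (hS : Γ.IsUnionOfComponents S)
    (h : HalfEdge {u : Γ.U // Sum.inl u ∈ S} {t : Γ.T // Sum.inr t ∈ S}) :
    (restrictHalf S ((Γ.restrict S hS).opp h)).1 = Γ.opp (restrictHalf S h).1 :=
  congrArg Subtype.val (Equiv.apply_symm_apply (restrictHalf S) _)

theorem HasTrivalentComponent.of_restrict {Γ : JacobiDiagram} {S : Set Γ.Vertex}
    {hS : Γ.IsUnionOfComponents S} (h : (Γ.restrict S hS).HasTrivalentComponent) :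
    Γ.HasTrivalentComponent := by
  obtain ⟨S', hS', ⟨x, hx⟩, hu⟩ := (hasTrivalentComponent_iff _).1 h
  refine Γ.hasTrivalentComponent_iff.2 ⟨restrictVertex S '' S', ?_, ⟨_, x, hx, rfl⟩, ?_⟩
  · rintro k ⟨y, hy, e⟩
    have hk : k.vertex ∈ S := by
      rw [← e]
      rcases y with u | t
      exacts [u.2, t.2]
    obtain ⟨l, hl⟩ := (restrictHalf S).surjective ⟨k, hk⟩
    have hl' : (restrictHalf S l).1 = k := by rw [hl]
    have hy' : y = l.vertex := restrictVertex_injective S (by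
      rw [e, ← vertex_restrictHalf, hl'])
    refine ⟨_, hS' l (hy' ▸ hy), ?_⟩
    rw [← hl', ← restrictHalf_opp Γ S hS]
    exact (vertex_restrictHalf S _).symm
  · rintro u ⟨y | y, hy, e⟩
    · exact hu y hy
    · simp [restrictVertex] at e

open Classical in
theorem prod_restrict_iso (Γ : JacobiDiagram) (S : Set Γ.Vertex) (hS : Γ.IsUnionOfComponents S)
    (hlt : ∀ u u', Sum.inl u ∈ S → Sum.inl u' ∉ S → u < u') :
    ((Γ.restrict S hS).prod (Γ.restrict Sᶜ hS.compl)).Iso Γ := by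
  let f : {u : Γ.U // Sum.inl u ∈ S} ⊕ₗ {u : Γ.U // Sum.inl u ∈ Sᶜ} ≃ Γ.U :=
    ofLex.trans (Equiv.sumCompl fun u => Sum.inl u ∈ S)
  let g : {t : Γ.T // Sum.inr t ∈ S} ⊕ {t : Γ.T // Sum.inr t ∈ Sᶜ} ≃ Γ.T :=
    Equiv.sumCompl fun t => Sum.inr t ∈ S
  have hf : ∀ x y, x < y → f x < f y := by
    rintro (x | x) (y | y) h
    · have h' : toLex (Sum.inl x) < toLex (Sum.inl y) := h
      have h'' := Sum.Lex.inl_lt_inl_iff.1 h'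
      exact h''
    · exact hlt _ _ x.2 y.2
    · exact (Sum.Lex.not_inr_lt_inl h).elim
    · have h' : toLex (Sum.inr x) < toLex (Sum.inr y) := h
      have h'' := Sum.Lex.inr_lt_inr_iff.1 h'
      exact h''
  have hf' : StrictMono f := fun x y h => hf x y h
  refine ⟨⟨f, fun {x y} => hf'.le_iff_le⟩, g, fun _ => 0, ?_⟩
  intro φ k
  have hl : ∀ l, φ (prodInl l) = (restrictHalf S l).1 := by
    rintro (u | ⟨t, i⟩)
    · rfl
    · exact congrArg (fun j => Sum.inr (t.1, j)) (add_zero i)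
  have hr : ∀ l, φ (prodInr l) = (restrictHalf Sᶜ l).1 := by
    rintro (u | ⟨t, i⟩)
    · rfl
    · exact congrArg (fun j => Sum.inr (t.1, j)) (add_zero i)
  rcases prod_cases k with ⟨l, rfl⟩ | ⟨l, rfl⟩
  · refine (congrArg Γ.opp (hl l)).trans (Eq.trans ?_ (congrArg φ (prodOpp_inl _ _ l)).symm)
    rw [hl]
    exact (restrictHalf_opp Γ S hS l).symm
  · refine (congrArg Γ.opp (hr l)).trans (Eq.trans ?_ (congrArg φ (prodOpp_inr _ _ l)).symm)
    rw [hr]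
    exact (restrictHalf_opp Γ Sᶜ hS.compl l).symm

end JacobiDiagram

theorem cls_mem_productSpan {Γ : JacobiDiagram} (h : ¬ Γ.HasTrivalentComponent) {S : Set Γ.Vertex}
    (hS : Γ.IsUnionOfComponents S) (h₁ : ∃ u, Sum.inl u ∈ S) (h₂ : ∃ u, Sum.inl u ∉ S)
    (hlt : ∀ u u', Sum.inl u ∈ S → Sum.inl u' ∉ S → u < u') : cls Γ ∈ productSpan := by
  obtain ⟨a, ha⟩ := h₁
  obtain ⟨b, hb⟩ := h₂
  refine Submodule.subset_span (Or.inr ⟨Γ.restrict S hS, Γ.restrict Sᶜ hS.compl,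
    (cls_iso (Γ.prod_restrict_iso S hS hlt)).symm, ⟨Sum.inl ⟨a, ha⟩⟩, ⟨Sum.inl ⟨b, hb⟩⟩,
    fun k => h k.of_restrict, fun k => h k.of_restrict⟩)

/-! ## The decomposition of the space of diagrams -/

/-- Take for `w` the least element of `A` above `x`, and for `v` the greatest element outside `A`
below `w`. -/
theorem exists_covBy_of_lt {U : Type} [LinearOrder U] [Finite U] (A : Set U) {x y : U}
    (hx : x ∉ A) (hy : y ∈ A) (h : x < y) : ∃ v w, v ⋖ w ∧ v ∉ A ∧ w ∈ A := by
  obtain ⟨w, ⟨hw, hxw⟩, hmin⟩ := Set.exists_min_image {z | z ∈ A ∧ x < z} id (Set.toFinite _)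
    ⟨y, hy, h⟩
  obtain ⟨v, ⟨hv, hvw⟩, hmax⟩ := Set.exists_max_image {z | z ∉ A ∧ z < w} id (Set.toFinite _)
    ⟨x, hx, hxw⟩
  refine ⟨v, w, ⟨hvw, fun z h₁ h₂ => ?_⟩, hv, hw⟩
  by_cases hz : z ∈ A
  · exact h₂.not_ge (hmin z ⟨hz, (hmax x ⟨hx, hxw⟩).trans_lt h₁⟩)
  · exact h₁.not_ge (hmax z ⟨hz, h₂⟩)

open Classical in
-- The sum of the ranks of the elements of `A` is the measure that makes the sorting of univalent
-- vertices terminate.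
theorem sum_rank_swap_lt {U : Type} [LinearOrder U] [Fintype U] (A : Set U) {v w : U} (h : v < w)
    (hv : v ∉ A) (hw : w ∈ A) :
    ∑ u with Equiv.swap v w u ∈ A, (Finset.univ.filter (· < u)).card <
      ∑ u with u ∈ A, (Finset.univ.filter (· < u)).card := by
  have h₁ : ∑ u with Equiv.swap v w u ∈ A, (Finset.univ.filter (· < u)).card =
      ∑ u with u ∈ A, (Finset.univ.filter (· < Equiv.swap v w u)).card := by
    rw [Finset.sum_filter, Finset.sum_filter]
    refine Fintype.sum_equiv (Equiv.swap v w) _ _ fun u => ?_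
    rw [Equiv.swap_apply_self]
  rw [h₁]
  have hrank : (Finset.univ.filter (· < v)).card < (Finset.univ.filter (· < w)).card := by
    apply Finset.card_lt_card
    refine ⟨fun x hx => ?_, fun hsub => ?_⟩
    · simp only [Finset.mem_filter, Finset.mem_univ, true_and] at hx ⊢
      exact hx.trans h
    · have := hsub (Finset.mem_filter.2 ⟨Finset.mem_univ v, h⟩)
      simp at this
  refine Finset.sum_lt_sum (fun u hu => ?_) ⟨w, by simpa using hw, ?_⟩
  · simp only [Finset.mem_filter, Finset.mem_univ, true_and] at hu
    have huv : u ≠ v := fun e => hv (e ▸ hu)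
    by_cases huw : u = w
    · subst huw
      rw [Equiv.swap_apply_right]
      exact hrank.le
    · rw [Equiv.swap_apply_of_ne_of_ne huv huw]
  · rw [Equiv.swap_apply_right]
    exact hrank

open Classical in
-- The univalent vertices of `S` are sorted to the front. At an adjacent pair in the wrong order,
-- STU writes the diagram as the exchanged one, which is closer to being sorted, plus the merged
-- one, which has fewer univalent vertices. A sorted diagram is a product.
theorem cls_mem_of_isUnionOfComponents (M : Submodule ℝ DiagramSpace) (n : ℕ)
    (hN : productSpan ≤ M) (hT : trivalentSpan ≤ M)
    (ih : ∀ Γ : JacobiDiagram, Fintype.card Γ.U < n → cls Γ ∈ M)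
    (Γ : JacobiDiagram) (S : Set Γ.Vertex) (hS : Γ.IsUnionOfComponents S)
    (hn : Fintype.card Γ.U = n) (h₁ : ∃ u, Sum.inl u ∈ S) (h₂ : ∃ u, Sum.inl u ∉ S) :
    cls Γ ∈ M := by
  induction hm : ∑ u : Γ.U with Sum.inl u ∈ S, (Finset.univ.filter (· < u)).card
    using Nat.strong_induction_on generalizing Γ with
  | _ m ihm =>
    by_cases htri : Γ.HasTrivalentComponent
    · exact hT (Submodule.subset_span ⟨Γ, rfl, htri⟩)
    by_cases hlt : ∀ u u', Sum.inl u ∈ S → Sum.inl u' ∉ S → u < u'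
    · exact hN (cls_mem_productSpan htri hS h₁ h₂ hlt)
    push Not at hlt
    obtain ⟨y, x, hy, hx, hxy⟩ := hlt
    have hxy' : x < y := lt_of_le_of_ne hxy fun e => hx (e ▸ hy)
    obtain ⟨v, w, hvw, hv, hw⟩ := exists_covBy_of_lt {u | Sum.inl u ∈ S} hx hy hxy'
    -- `v` and `w` lie on different sides of a union of components, so no edge joins them and they
    -- can be merged.
    have hne : Γ.opp (Sum.inl v) ≠ Sum.inl w := by
      intro e
      have h := hS.compl (Sum.inl v) hv
      rw [e] at h
      exact h hw
    have hmerge : cls (Γ.merge v w hvw.ne hne) ∈ M := by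
      apply ih
      have : Fintype.card (Γ.merge v w hvw.ne hne).U = Fintype.card Γ.U - 1 := by
        rw [← Set.card_ne_eq w]
        exact Fintype.card_congr (Equiv.refl _)
      rw [this, hn]
      have : 0 < n := hn ▸ Fintype.card_pos_iff.2 ⟨v⟩
      omega
    have hinl : ∀ u, Sum.inl u ∈ swapSet v w S ↔ Sum.inl (Equiv.swap v w u) ∈ S :=
      inl_mem_swapSet v w S
    have hswap : cls (Γ.swapLegs v w) ∈ M := by
      refine ihm _ ?_ (Γ.swapLegs v w) (swapSet v w S) ?_ hn ?_ ?_ rfl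
      · rw [← hm]
        have := sum_rank_swap_lt {u | Sum.inl u ∈ S} hvw.1 hv hw
        refine lt_of_eq_of_lt ?_ (lt_of_lt_of_eq this ?_)
        · change ∑ u : Γ.U with Sum.inl u ∈ swapSet v w S, _ = _
          refine Finset.sum_congr ?_ fun _ _ => rfl
          ext u
          simp [hinl]
        · rfl
      · exact hS.swapLegs v w (vertex_legSwap_mem_swapSet v w S)
      · obtain ⟨u, hu⟩ := h₁
        exact ⟨Equiv.swap v w u, (hinl _).2 (by rwa [Equiv.swap_apply_self])⟩
      · obtain ⟨u, hu⟩ := h₂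
        exact ⟨Equiv.swap v w u, fun h => hu (by have := (hinl _).1 h; rwa [Equiv.swap_apply_self] at this)⟩
    have := cls_merge hvw hne
    rw [eq_sub_iff_add_eq] at this
    rw [← this]
    exact M.add_mem hmerge hswap

theorem cls_mem_sup (Γ : JacobiDiagram) :
    cls Γ ∈ connectedSpan ⊔ productSpan ⊔ trivalentSpan := by
  induction hn : Fintype.card Γ.U using Nat.strong_induction_on generalizing Γ with
  | _ n ih =>
    have hP : connectedSpan ≤ connectedSpan ⊔ productSpan ⊔ trivalentSpan :=
      le_sup_left.trans le_sup_left
    have hN : productSpan ≤ connectedSpan ⊔ productSpan ⊔ trivalentSpan :=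
      le_sup_right.trans le_sup_left
    have hT : trivalentSpan ≤ connectedSpan ⊔ productSpan ⊔ trivalentSpan := le_sup_right
    by_cases htri : Γ.HasTrivalentComponent
    · exact hT (Submodule.subset_span ⟨Γ, rfl, htri⟩)
    by_cases hne : Nonempty Γ.Vertex
    swap
    · exact hN (Submodule.subset_span (Or.inl ⟨Γ, rfl, not_nonempty_iff.1 hne⟩))
    by_cases hc : Γ.graph.Connected
    · obtain ⟨u, -⟩ := exists_univalent htri (S := Set.univ) (fun _ _ => trivial)
        Set.univ_nonempty
      exact hP (Submodule.subset_span ⟨Γ, rfl, hc, ⟨u⟩⟩)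
    obtain ⟨S, hS, h₁, h₂⟩ := Γ.exists_of_not_connected hne hc
    exact cls_mem_of_isUnionOfComponents _ n hN hT (fun Γ' h => ih _ h Γ' rfl) Γ S hS hn
      (exists_univalent htri hS h₁) (exists_univalent htri hS.compl h₂)

theorem exists_isConnectedPart (x : DiagramSpace) : ∃ p, IsConnectedPart x p := by
  have hx : x ∈ connectedSpan ⊔ productSpan ⊔ trivalentSpan := by
    obtain ⟨y, rfl⟩ := Submodule.Quotient.mk_surjective _ x
    induction y using Finsupp.induction_linear with
    | zero => exact Submodule.zero_mem _
    | add a b ha hb => exact Submodule.add_mem _ ha hb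
    | single Γ c =>
      have : (Submodule.Quotient.mk (Finsupp.single Γ c) : DiagramSpace) = c • cls Γ := by
        rw [cls, ← Submodule.Quotient.mk_smul, Finsupp.smul_single, smul_eq_mul, mul_one]
      rw [this]
      exact Submodule.smul_mem _ _ (cls_mem_sup Γ)
  obtain ⟨y, hy, t, ht, rfl⟩ := Submodule.mem_sup.1 hx
  obtain ⟨p, hp, n, hn, rfl⟩ := Submodule.mem_sup.1 hy
  exact ⟨p, hp, n, hn, t, ht, rfl⟩

/-! ## States of chord diagrams -/

section chord

variable {U T C : Type} [IsEmpty T] (e : C × Bool ≃ U)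

/-- The status of the ends of the chords `c`, where an internal edge leaves the end `y c` and an
internal edge arrives at the end `x c`. -/
def chordStatus (x y : C → Bool) : HalfEdge U T → Status :=
  Sum.elim (fun u => ((e.symm u).2 == y (e.symm u).1, (e.symm u).2 == x (e.symm u).1))
    fun p => isEmptyElim p.1

theorem chordStatus_inl (x y : C → Bool) (c : C) (b : Bool) :
    chordStatus (T := T) e x y (Sum.inl (e (c, b))) = (b == y c, b == x c) := by
  simp [chordStatus]

/-- The internal edges of a permutation of the chords. -/
def chordEdges [Fintype C] (x y : C → Bool) (σ : Equiv.Perm C) : Finset (U × U) :=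
  Finset.univ.map ⟨fun c => (e (c, y c), e (σ c, x (σ c))), fun c c' h => by
    simp only [Prod.mk.injEq, EmbeddingLike.apply_eq_iff_eq] at h
    exact h.1.1⟩

theorem mem_chordEdges [Fintype C] (x y : C → Bool) (σ : Equiv.Perm C) (p q : U) :
    (p, q) ∈ chordEdges e x y σ ↔ ∃ c, e (c, y c) = p ∧ e (σ c, x (σ c)) = q := by
  simp only [chordEdges, Finset.mem_map, Finset.mem_univ, true_and]
  exact exists_congr fun c => Prod.mk_inj

variable [Fintype C]

theorem chordState_injective : Function.Injective
    (fun d : Equiv.Perm C × (C → Bool) × (C → Bool) =>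
      ((chordStatus e d.2.2 d.2.1 : HalfEdge U T → Status), chordEdges e d.2.2 d.2.1 d.1)) := by
  rintro ⟨σ, y, x⟩ ⟨σ', y', x'⟩ h
  have h₁ : (chordStatus e x y : HalfEdge U T → Status) = chordStatus e x' y' :=
    congrArg Prod.fst h
  have h₂ : chordEdges e x y σ = chordEdges e x' y' σ' := congrArg Prod.snd h
  have h₃ : ∀ c, y c = y' c ∧ x c = x' c := by
    intro c
    have := congrFun h₁ (Sum.inl (e (c, true)))
    rw [chordStatus_inl, chordStatus_inl] at this
    simpa using this
  obtain rfl : y = y' := funext fun c => (h₃ c).1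
  obtain rfl : x = x' := funext fun c => (h₃ c).2
  have h₄ : σ = σ' := by
    ext c
    have : (e (c, y c), e (σ c, x (σ c))) ∈ chordEdges e x y σ' := by
      rw [← h₂, mem_chordEdges]
      exact ⟨c, rfl, rfl⟩
    rw [mem_chordEdges] at this
    obtain ⟨c', h, h'⟩ := this
    have hc : c' = c := congrArg Prod.fst (e.injective h)
    subst hc
    exact (congrArg Prod.fst (e.injective h')).symm
  rw [h₄]

variable {opp : HalfEdge U T → HalfEdge U T}

theorem isState_chord (hopp : ∀ c b, opp (Sum.inl (e (c, b))) = Sum.inl (e (c, !b)))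
    (x y : C → Bool) (σ : Equiv.Perm C) :
    IsState opp (chordStatus e x y) (chordEdges e x y σ) := by
  have hs : ∀ c b, chordStatus (T := T) e x y (Sum.inl (e (c, b))) = (b == y c, b == x c) :=
    chordStatus_inl e x y
  refine ⟨?_, ?_, ?_, ?_, ?_⟩
  · rintro (u | ⟨t, -⟩)
    · obtain ⟨⟨c, b⟩, rfl⟩ := e.surjective u
      rw [hopp, hs, hs]
      cases b <;> cases y c <;> cases x c <;> rfl
    · exact isEmptyElim t
  · intro p
    obtain ⟨⟨c, b⟩, rfl⟩ := e.surjective p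
    simp only [hs, mem_chordEdges, beq_iff_eq]
    constructor
    · rintro rfl
      exact ⟨_, c, rfl, rfl⟩
    · rintro ⟨q, c', h, -⟩
      have := e.injective h
      simp only [Prod.mk.injEq] at this
      rw [← this.1, this.2]
  · intro p
    obtain ⟨⟨c, b⟩, rfl⟩ := e.surjective p
    simp only [hs, mem_chordEdges, beq_iff_eq]
    constructor
    · rintro rfl
      exact ⟨_, σ.symm c, rfl, by simp⟩
    · rintro ⟨q, c', -, h⟩
      have := e.injective h
      simp only [Prod.mk.injEq] at this
      rw [← this.1, this.2]
  · intro p q q' h h'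
    rw [mem_chordEdges] at h h'
    obtain ⟨c, hc, rfl⟩ := h
    obtain ⟨c', hc', rfl⟩ := h'
    have : c = c' := congrArg Prod.fst (e.injective (hc.trans hc'.symm))
    rw [this]
  · intro p p' q h h'
    rw [mem_chordEdges] at h h'
    obtain ⟨c, rfl, hc⟩ := h
    obtain ⟨c', rfl, hc'⟩ := h'
    have : c = c' := σ.injective (congrArg Prod.fst (e.injective (hc.trans hc'.symm)))
    rw [this]

/-- The two ends of a chord have opposite statuses, so exactly one end emits an internal edge and
exactly one receives one. Read on chords, the matching is therefore a permutation. -/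
theorem exists_chord_of_isState (hopp : ∀ c b, opp (Sum.inl (e (c, b))) = Sum.inl (e (c, !b)))
    {s : HalfEdge U T → Status} {E : Finset (U × U)} (h : IsState opp s E) :
    ∃ x y σ, chordStatus e x y = s ∧ chordEdges e x y σ = E := by
  obtain ⟨ho, hE⟩ := h
  set y : C → Bool := fun c => (s (Sum.inl (e (c, true)))).1 with hy
  set x : C → Bool := fun c => (s (Sum.inl (e (c, true)))).2 with hx
  have hs : ∀ c b, s (Sum.inl (e (c, b))) = (b == y c, b == x c) := by
    intro c b
    cases b
    · have := ho (Sum.inl (e (c, true)))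
      rw [hopp] at this
      rw [show false = !true from rfl, this]
      simp [Status.opposite, hy, hx]
    · simp [hy, hx]
  have h₁ : ∀ c, ∃ d, (e (c, y c), e (d, x d)) ∈ E := by
    intro c
    obtain ⟨q, hq⟩ := (hE.src (e (c, y c))).1 (by rw [hs]; simp)
    obtain ⟨⟨d, b⟩, rfl⟩ := e.surjective q
    have h₂ := (hE.tgt (e (d, b))).2 ⟨_, hq⟩
    rw [hs] at h₂
    simp only [beq_iff_eq] at h₂
    exact ⟨d, h₂ ▸ hq⟩
  choose σ hσ using h₁
  have hinj : Function.Injective σ := by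
    intro c c' h
    have h₂ := hσ c'
    rw [← h] at h₂
    exact congrArg Prod.fst (e.injective (hE.tgt_unique _ _ _ (hσ c) h₂))
  refine ⟨x, y, Equiv.ofBijective σ (Finite.injective_iff_bijective.1 hinj), ?_, ?_⟩
  · funext h
    rcases h with u | ⟨t, -⟩
    · obtain ⟨⟨c, b⟩, rfl⟩ := e.surjective u
      rw [chordStatus_inl, hs]
    · exact isEmptyElim t
  · ext ⟨p, q⟩
    rw [mem_chordEdges]
    constructor
    · rintro ⟨c, rfl, rfl⟩
      exact hσ c
    · intro h
      obtain ⟨⟨c, b⟩, rfl⟩ := e.surjective p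
      have h₂ := (hE.src (e (c, b))).2 ⟨_, h⟩
      rw [hs] at h₂
      simp only [beq_iff_eq] at h₂
      subst h₂
      exact ⟨c, rfl, hE.src_unique _ _ _ (hσ c) h⟩

/-- The two ends of a chord are always connected, so components are orbits of `σ` on chords. -/
theorem componentCount_chord (hopp : ∀ c b, opp (Sum.inl (e (c, b))) = Sum.inl (e (c, !b)))
    (x y : C → Bool) (σ : Equiv.Perm C) :
    componentCount opp (chordEdges e x y σ) = Nat.card (Quot fun c d => σ c = d) := by
  have hb : ∀ c b b', Quot.mk (VertexRel opp (chordEdges e x y σ)) (Sum.inl (e (c, b))) =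
      Quot.mk _ (Sum.inl (e (c, b'))) := by
    have : ∀ c b, Quot.mk (VertexRel opp (chordEdges e x y σ)) (Sum.inl (e (c, b))) =
        Quot.mk _ (Sum.inl (e (c, !b))) := fun c b =>
      Quot.sound (Or.inl ⟨Sum.inl (e (c, b)), rfl, by rw [hopp]; rfl⟩)
    intro c b b'
    have h := this c true
    cases b <;> cases b'
    exacts [rfl, h.symm, h, rfl]
  refine Nat.card_congr ⟨Quot.lift (fun v => Quot.mk _ (e.symm (Sum.elim id isEmptyElim v)).1) ?_,
    Quot.lift (fun c => Quot.mk _ (Sum.inl (e (c, true)))) ?_, ?_, ?_⟩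
  · rintro v w (⟨u | ⟨t, -⟩, rfl, rfl⟩ | ⟨⟨p, q⟩, hp, rfl, rfl⟩)
    · obtain ⟨⟨c, b⟩, rfl⟩ := e.surjective u
      rw [hopp]
      simp [HalfEdge.vertex]
    · exact isEmptyElim t
    · rw [mem_chordEdges] at hp
      obtain ⟨c, rfl, rfl⟩ := hp
      apply Quot.sound
      simp
  · rintro c d rfl
    rw [hb c true (y c), hb (σ c) true (x (σ c))]
    refine Quot.sound (Or.inr ⟨(e (c, y c), e (σ c, x (σ c))), ?_, rfl, rfl⟩)
    rw [mem_chordEdges]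
    exact ⟨c, rfl, rfl⟩
  · rintro ⟨u | t⟩
    · obtain ⟨⟨c, b⟩, rfl⟩ := e.surjective u
      simpa using hb c true b
    · exact isEmptyElim t
  · rintro ⟨c⟩
    simp

/-- The sign of an end of a chord. -/
def endSign (b : Bool) : ℝ := if b then -1 else 1

/-- The intersection matrix of a family of chords. -/
def intersection [LinearOrder U] (c d : C) : ℝ :=
  (∑ b : Bool, ∑ b' : Bool, endSign b * endSign b' * stepSign (e (c, b)) (e (d, b'))) / 2

theorem normalization_chord (m : ℕ) : normalization (m * 2) 0 = ((-1) / 2) ^ m := by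
  have : edgeNumber (m * 2) 0 = m := by simp [edgeNumber]
  rw [normalization, this, div_pow]
  have : ((m : ℤ) - ((m * 2 : ℕ) + (0 : ℕ))) = -(m : ℤ) := by push_cast; ring
  rw [this, zpow_neg, zpow_natCast, add_zero, div_eq_mul_inv]

/-- Rewrites the weight as a product over chords in which the departure and arrival ends enter
through separate signs. This prepares the factorization of the sum. -/
theorem stateWeight_chord [LinearOrder U] [Fintype U] [Fintype T] (f : ℕ → ℝ)
    (hopp : ∀ c b, opp (Sum.inl (e (c, b))) = Sum.inl (e (c, !b)))
    (x y : C → Bool) (σ : Equiv.Perm C) :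
    stateWeight f opp (chordStatus e x y) (chordEdges e x y σ) =
      (-1) ^ Fintype.card C * (f (Nat.card (Quot fun c d => σ c = d)) *
        ∏ c, endSign (y c) * endSign (x (σ c)) * stepSign (e (c, y c)) (e (σ c, x (σ c)))) := by
  have h₁ : ∏ u : U, legSign (chordStatus (T := T) e x y (Sum.inl u)) =
      (-1) ^ Fintype.card C * ((∏ c, endSign (y c)) * ∏ c, endSign (x (σ c))) := by
    rw [← Fintype.prod_equiv e (fun p => legSign (chordStatus (T := T) e x y (Sum.inl (e p)))) _
      fun _ => rfl, Fintype.prod_prod_type, Equiv.prod_comp σ (fun c => endSign (x c)),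
      ← Finset.prod_mul_distrib, ← Finset.card_univ, ← Finset.prod_const,
      ← Finset.prod_mul_distrib]
    -- A chord contributes `-1` if its edges leave and arrive at the same end, and `1` otherwise.
    -- This is minus the product of the two end signs.
    refine Finset.prod_congr rfl fun c _ => ?_
    simp only [chordStatus_inl, Fintype.prod_bool]
    cases y c <;> cases x c <;> simp [legSign, endSign]
  have h₂ : ∏ p ∈ chordEdges e x y σ, stepSign p.1 p.2 =
      ∏ c, stepSign (e (c, y c)) (e (σ c, x (σ c))) := by
    rw [chordEdges, Finset.prod_map]
    rfl
  rw [stateWeight, if_pos (isState_chord e hopp x y σ), h₁, h₂, componentCount_chord e hopp,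
    Finset.univ_eq_empty, Finset.prod_empty, Finset.prod_mul_distrib, Finset.prod_mul_distrib]
  ring

/-- For a fixed permutation the ends at which edges leave and arrive are chosen independently, so
the sum over them factors into intersection numbers. -/
theorem stateSum_chord [LinearOrder U] [Fintype U] [Fintype T] [DecidableEq C] (f : ℕ → ℝ)
    (hopp : ∀ c b, opp (Sum.inl (e (c, b))) = Sum.inl (e (c, !b))) :
    normalization (Fintype.card U) (Fintype.card T) * stateSum f opp =
      ∑ σ : Equiv.Perm C, f (Nat.card (Quot fun c d => σ c = d)) * ∏ c, intersection e c (σ c) := by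
  classical
  have hU : Fintype.card U = Fintype.card C * 2 := by
    rw [← Fintype.card_congr e, Fintype.card_prod, Fintype.card_bool]
  have hsum : stateSum f opp = ∑ d : Equiv.Perm C × (C → Bool) × (C → Bool),
      (-1) ^ Fintype.card C * (f (Nat.card (Quot fun c c' => d.1 c = c')) *
        ∏ c, endSign (d.2.1 c) * endSign (d.2.2 (d.1 c)) *
          stepSign (e (c, d.2.1 c)) (e (d.1 c, d.2.2 (d.1 c)))) := by
    rw [stateSum_eq]
    refine (Fintype.sum_of_injective _ (chordState_injective (T := T) e) _ _ ?_ ?_).symm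
    · rintro ⟨s, E⟩ hs
      by_contra h
      obtain ⟨x, y, σ, rfl, rfl⟩ := exists_chord_of_isState e hopp
        (isState_of_stateWeight_ne_zero h)
      exact hs ⟨(σ, y, x), rfl⟩
    · rintro ⟨σ, y, x⟩
      exact (stateWeight_chord e f hopp x y σ).symm
  rw [hsum, Fintype.card_eq_zero (α := T), hU, normalization_chord, ← Finset.mul_sum, ← mul_assoc,
    ← mul_pow,
    Fintype.sum_prod_type, Finset.mul_sum]
  refine Finset.sum_congr rfl fun σ _ => ?_
  have h₁ : ∏ c, intersection e c (σ c) = ((1 : ℝ) / 2) ^ Fintype.card C *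
      ∑ z : C → Bool × Bool, ∏ c, endSign (z c).1 * endSign (z c).2 *
        stepSign (e (c, (z c).1)) (e (σ c, (z c).2)) := by
    have : ∀ c, intersection e c (σ c) = 1 / 2 * ∑ z : Bool × Bool,
        endSign z.1 * endSign z.2 * stepSign (e (c, z.1)) (e (σ c, z.2)) := fun c => by
      rw [Fintype.sum_prod_type, intersection]; ring
    rw [Finset.prod_congr rfl fun c _ => this c, Finset.prod_mul_distrib, Finset.prod_const,
      Finset.card_univ, Finset.prod_univ_sum, Fintype.piFinset_univ]
  -- The sign in the normalization cancels the one from the leg signs; the powers of `1 / 2` go into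
  -- the intersection numbers.
  rw [h₁, show (-1 / 2 * -1 : ℝ) = 1 / 2 by norm_num]
  have h₂ : ∑ z : C → Bool × Bool, ∏ c, endSign (z c).1 * endSign (z c).2 *
        stepSign (e (c, (z c).1)) (e (σ c, (z c).2)) =
      ∑ y : C → Bool, ∑ x : C → Bool, ∏ c, endSign (y c) * endSign (x (σ c)) *
        stepSign (e (c, y c)) (e (σ c, x (σ c))) := by
    rw [← Fintype.sum_prod_type']
    -- In the factored product an arrival end is indexed by the chord the edge comes from; `σ`
    -- reindexes it by the chord it reaches.
    let F : (C → Bool × Bool) ≃ (C → Bool) × (C → Bool) :=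
      (Equiv.arrowProdEquivProdArrow C (fun _ => Bool) (fun _ => Bool)).trans
        ((Equiv.refl _).prodCongr (σ.arrowCongr (Equiv.refl Bool)))
    refine Fintype.sum_equiv F _ _ fun z => ?_
    refine Finset.prod_congr rfl fun c _ => ?_
    simp [F, Equiv.arrowProdEquivProdArrow]
  rw [h₂, Fintype.sum_prod_type]
  simp only [Finset.mul_sum]
  refine Finset.sum_congr rfl fun y _ => Finset.sum_congr rfl fun x _ => ?_
  ring

end chord

/-! ## The sign of a permutation -/

section sign

variable {C : Type} [Fintype C] (σ : Equiv.Perm C)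

theorem quot_mk_eq_iff (x y : C) :
    Quot.mk (fun c d => σ c = d) x = Quot.mk _ y ↔ σ.SameCycle x y := by
  constructor
  · intro h
    induction Quot.eqvGen_exact h with
    | rel x y h' => exact ⟨1, by simpa using h'⟩
    | refl => exact .refl _ _
    | symm x y _ ih => exact (ih (Quot.eqvGen_sound (by assumption))).symm
    | trans x y z _ _ ih ih' =>
      exact (ih (Quot.eqvGen_sound (by assumption))).trans (ih' (Quot.eqvGen_sound (by assumption)))
  · intro h
    obtain ⟨n, -, rfl⟩ := h.exists_pow_eq'
    clear h
    induction n with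
    | zero => rfl
    | succ n ih =>
      rw [ih]
      exact Quot.sound (by rw [pow_succ', Equiv.Perm.mul_apply])

variable [DecidableEq C]

/-- Orbits are the fixed points together with the nontrivial cycles, each represented by a chosen
point of its support. -/
theorem card_quot_perm : Nat.card (Quot fun c d => σ c = d) =
    Fintype.card C - σ.support.card + σ.cycleFactorsFinset.card := by
  have hne : ∀ c : σ.cycleFactorsFinset, ∃ x, x ∈ c.1.support := fun c =>
    Finset.nonempty_iff_ne_empty.2 fun h =>
      (Equiv.Perm.mem_cycleFactorsFinset_iff.1 c.2).1.ne_one (Equiv.Perm.support_eq_empty_iff.1 h)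
  choose r hr using hne
  have hr' : ∀ c : σ.cycleFactorsFinset, σ.cycleOf (r c) = c.1 := fun c =>
    (Equiv.Perm.cycle_is_cycleOf (hr c) c.2).symm
  have hmoved : ∀ c : σ.cycleFactorsFinset, σ (r c) ≠ r c := fun c =>
    Equiv.Perm.mem_support.1 (Equiv.Perm.mem_cycleFactorsFinset_support_le c.2 (hr c))
  let F : {x // x ∈ σ.supportᶜ} ⊕ σ.cycleFactorsFinset → Quot fun c d => σ c = d :=
    Sum.elim (fun x => Quot.mk _ x.1) fun c => Quot.mk _ (r c)
  have hfix : ∀ x y, σ.SameCycle x y → σ x = x → x = y := by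
    rintro x y ⟨n, rfl⟩ h
    exact (Equiv.Perm.zpow_apply_eq_self_of_apply_eq_self h n).symm
  have hF : Function.Bijective F := by
    constructor
    · rintro (⟨x, hx⟩ | c) (⟨y, hy⟩ | d) h
      · have := hfix _ _ ((quot_mk_eq_iff σ _ _).1 h) (by simpa using hx)
        exact congrArg Sum.inl (Subtype.ext this)
      · have := hfix _ _ ((quot_mk_eq_iff σ _ _).1 h) (by simpa using hx)
        exact (hmoved d (by rw [← this]; simpa using hx)).elim
      · have := hfix _ _ ((quot_mk_eq_iff σ _ _).1 h).symm (by simpa using hy)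
        exact (hmoved c (by rw [← this]; simpa using hy)).elim
      · have := ((quot_mk_eq_iff σ _ _).1 h).cycleOf_eq
        rw [hr', hr'] at this
        rw [Subtype.ext this]
    · rintro ⟨x⟩
      by_cases hx : x ∈ σ.support
      · have hc := Equiv.Perm.cycleOf_mem_cycleFactorsFinset_iff.2 hx
        refine ⟨Sum.inr ⟨_, hc⟩, (quot_mk_eq_iff σ _ _).2 ?_⟩
        have := hr ⟨_, hc⟩
        rw [Equiv.Perm.mem_support_cycleOf_iff] at this
        exact this.1.symm
      · exact ⟨Sum.inl ⟨x, by simpa using hx⟩, rfl⟩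
  rw [← Nat.card_congr (Equiv.ofBijective F hF), Nat.card_sum, Nat.card_eq_fintype_card,
    Nat.card_eq_fintype_card, Fintype.card_coe, Fintype.card_coe, Finset.card_compl]

theorem sign_eq_pow_card_quot : ((Equiv.Perm.sign σ : ℤ) : ℝ) =
    (-1) ^ Fintype.card C * (-1) ^ Nat.card (Quot fun c d => σ c = d) := by
  have h := Finset.card_le_univ σ.support
  rw [card_quot_perm, Equiv.Perm.sign_of_cycleType, Equiv.Perm.sum_cycleType,
    Equiv.Perm.cycleType_def, Multiset.card_map, ← pow_add]
  push_cast
  change _ ^ (_ + σ.cycleFactorsFinset.card) = _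
  rw [← Nat.sub_add_cancel h, Nat.add_sub_cancel]
  generalize Fintype.card C - σ.support.card = a
  rw [show a + σ.support.card + (a + σ.cycleFactorsFinset.card) =
    2 * a + (σ.support.card + σ.cycleFactorsFinset.card) by ring, pow_add _ (2 * a), pow_mul]
  simp

end sign

/-! ## The determinant of a surgery -/

section relation

variable {U : Type} [LinearOrder U]

/-- The surgery of the line along the pairs of an involution. -/
def SurgeryRel (o : U → U) (a b : WithBot U) : Prop :=
  ∃ z : U, a ⋖ (o z : WithBot U) ∧ b = z

theorem surgeryRel_coe (o : U → U) (p z : U) :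
    SurgeryRel o (p : WithBot U) z ↔ p ⋖ o z := by
  rw [← WithBot.coe_covBy_coe]
  constructor
  · rintro ⟨y, h, e⟩
    rw [WithBot.coe_inj.1 e]
    exact h
  · exact fun h => ⟨z, h, rfl⟩

theorem SurgeryRel.left_unique {o : U → U} {a a' b : WithBot U} (h : SurgeryRel o a b)
    (h' : SurgeryRel o a' b) : a = a' := by
  obtain ⟨z, hz, rfl⟩ := h
  obtain ⟨z', hz', e⟩ := h'
  rw [← WithBot.coe_inj.1 e] at hz'
  exact hz.unique_left hz'

end relation

section surgery

variable {U : Type} [LinearOrder U] [Fintype U]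

open Classical in
/-- The successor matrix. -/
def succMatrix : Matrix U U ℝ := Matrix.of fun p q => if p ⋖ q then 1 else 0

/-- The strict order matrix. -/
def ltMatrix : Matrix U U ℝ := Matrix.of fun p q => if p < q then 1 else 0

/-- An element is above `p` if and only if it is the successor of `p` or lies above that successor.
-/
theorem succMatrix_mul_ltMatrix : (1 - succMatrix) * ltMatrix = (succMatrix : Matrix U U ℝ) := by
  ext p q
  rw [sub_mul, one_mul, Matrix.sub_apply, Matrix.mul_apply]
  simp only [succMatrix, ltMatrix, Matrix.of_apply, ite_mul, one_mul, zero_mul]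
  by_cases hp : ∃ r, p ⋖ r
  · obtain ⟨r, hr⟩ := hp
    have : ∀ x, p ⋖ x ↔ x = r := fun x => ⟨fun h => h.unique_right hr, fun h => h ▸ hr⟩
    simp only [this, Finset.sum_ite_eq', Finset.mem_univ, if_true]
    rcases lt_trichotomy r q with h | h | h
    · rw [if_pos (hr.lt.trans h), if_pos h, if_neg h.ne', sub_self]
    · subst h
      simp [hr.lt]
    · have h' : ¬ p < q := fun h' => hr.2 h' h
      simp [h', h.not_gt, h.ne]
  · have h' : ∀ x, ¬ p ⋖ x := fun x h => hp ⟨x, h⟩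
    have : ¬ p < q := fun h => hp ((Set.toFinite (Set.Ioi p)).exists_minimal ⟨q, h⟩ |>.imp
      fun x hx => ⟨hx.1, fun z hz hzx => hzx.not_ge (hx.2 hz hzx.le)⟩)
    simp [h', this]

theorem det_one_sub_succMatrix : (1 - succMatrix : Matrix U U ℝ).det = 1 := by
  rw [Matrix.det_of_isUpperTriangular]
  · exact Finset.prod_eq_one fun p _ => by simp [succMatrix]
  · intro p q h
    have h₁ : ¬ p ⋖ q := fun h' => lt_asymm h'.lt h
    have h₂ : p ≠ q := fun e => lt_irrefl _ (e ▸ h)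
    simp [succMatrix, h₁, h₂]

open Classical in
/-- The surgery matrix of an involution `o`. -/
def surgeryMatrix (o : U → U) : Matrix U U ℝ :=
  1 - Matrix.of fun p q => if p ⋖ o q then 1 else 0

/-- With `S` the successor matrix, `L` the order matrix and `O` the matrix of `o`, the relation `(1
- S) L = S` gives `(1 - S) + S (1 - O) = 1 - S O`. -/
theorem surgeryMatrix_eq (o : U → U) (ho : ∀ u, o (o u) = u) : surgeryMatrix o =
    (1 - succMatrix) * (1 + ltMatrix * (1 - Matrix.of fun p q => if o p = q then 1 else 0)) := by
  rw [mul_add, ← mul_assoc, succMatrix_mul_ltMatrix, mul_one, mul_sub, mul_one,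
    sub_add_sub_cancel, surgeryMatrix]
  congr 1
  ext p q
  rw [Matrix.mul_apply]
  have : ∀ r, o r = q ↔ r = o q := fun r => ⟨fun h => by rw [← h, ho], fun h => by rw [h, ho]⟩
  simp [succMatrix, this]

theorem exists_surgeryRel (o : U → U) (z : U) : ∃ a, SurgeryRel o a z := by
  obtain ⟨a, ha⟩ := (Set.toFinite (Set.Iio (o z : WithBot U))).exists_maximal
    ⟨⊥, WithBot.bot_lt_coe _⟩
  exact ⟨a, z, ⟨ha.1, fun x hx hx' => hx.not_ge (ha.2 hx' hx.le)⟩, rfl⟩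

/-- Only the identity contributes to the determinant. An off-diagonal factor says that one arc is
continued by another, so a nontrivial permutation with nonzero product would exhibit closed circles
that avoid the arc `⊥`. The diagonal entries are `1`, since an arc continued by itself would also be
such a circle. -/
theorem det_surgeryMatrix_of_connected (o : U → U) (ho : ∀ u, o (o u) = u)
    (h : ∀ S : Set (WithBot U), (∀ a b, SurgeryRel o a b → (a ∈ S ↔ b ∈ S)) → ⊥ ∉ S → S = ∅) :
    (surgeryMatrix o).det = 1 := by
  rw [Matrix.det_apply, Finset.sum_eq_single 1]
  · have : ∀ p : U, ¬ p ⋖ o p := by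
      intro p hp
      have hS : ∀ a b, SurgeryRel o a b → (a ∈ ({(p : WithBot U)} : Set _) ↔ b ∈ ({(p : WithBot U)} : Set _)) := by
        intro a b hab
        have hpp : SurgeryRel o (p : WithBot U) p := (surgeryRel_coe o p p).2 hp
        simp only [Set.mem_singleton_iff]
        constructor
        · rintro rfl
          obtain ⟨z, hz, rfl⟩ := hab
          have h₂ := (surgeryRel_coe o p z).1 ⟨z, hz, rfl⟩
          have := congrArg o (h₂.unique_right hp)
          rw [ho, ho] at this
          rw [this]
        · rintro rfl
          exact hab.left_unique hpp
      have := h _ hS (by simp)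
      simp at this
    simp [surgeryMatrix, this]
  · intro σ _ hσ
    by_contra hne
    have hprod : ∀ p, surgeryMatrix o (σ p) p ≠ 0 := by
      intro p hp
      refine hne ?_
      have : ∏ q, surgeryMatrix o (σ q) q = 0 := Finset.prod_eq_zero (Finset.mem_univ p) hp
      rw [this, smul_zero]
    have hmoved : ∀ p, σ p ≠ p → SurgeryRel o (σ p : WithBot U) p := by
      intro p hp
      rw [surgeryRel_coe]
      by_contra hc
      exact hprod p (by simp [surgeryMatrix, hp, hc])
    -- For each arc `p` moved by `σ`, the arc `σ p` is moved too and is continued by `p`; hence the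
    -- moved arcs form a union of circles.
    have := h {a | ∃ p, σ p ≠ p ∧ a = (p : WithBot U)} ?_ (by simp)
    · exact hσ (Equiv.ext fun p => by
        by_contra hp
        have hmem : (p : WithBot U) ∈ {a | ∃ p, σ p ≠ p ∧ a = (p : WithBot U)} := ⟨p, hp, rfl⟩
        rw [this] at hmem
        exact hmem)
    · intro a b hab
      constructor
      · rintro ⟨p, hp, rfl⟩
        obtain ⟨z, hz, rfl⟩ := hab
        have h₁ := (surgeryRel_coe o p z).1 ⟨z, hz, rfl⟩
        obtain ⟨q, rfl⟩ := σ.surjective p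
        have hq : σ q ≠ q := fun e => hp (congrArg σ e)
        have h₂ := (surgeryRel_coe o _ _).1 (hmoved q hq)
        have := congrArg o (h₂.unique_right h₁)
        rw [ho, ho] at this
        exact ⟨q, hq, by rw [this]⟩
      · rintro ⟨p, hp, rfl⟩
        exact ⟨σ p, fun e => hp (σ.injective e), hab.left_unique (hmoved p hp)⟩
  · simp

/-- The indicator of `S` is a left null vector: every arc continues exactly one arc, and the two lie
in `S` together. The arc `⊥` has no row in the matrix, but it is not in `S` either. -/
theorem det_surgeryMatrix_of_not_connected (o : U → U) {S : Set (WithBot U)}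
    (hS : ∀ a b, SurgeryRel o a b → (a ∈ S ↔ b ∈ S)) (hbot : ⊥ ∉ S) (hne : S.Nonempty) :
    (surgeryMatrix o).det = 0 := by
  classical
  rw [← Matrix.exists_vecMul_eq_zero_iff]
  refine ⟨fun p => if (p : WithBot U) ∈ S then 1 else 0, ?_, ?_⟩
  · obtain ⟨a, ha⟩ := hne
    intro h0
    induction a with
    | bot => exact hbot ha
    | coe a =>
      have := congrFun h0 a
      simp [ha] at this
  · funext q
    rw [surgeryMatrix, Matrix.vecMul_sub, Matrix.vecMul_one]
    obtain ⟨a, ha⟩ := exists_surgeryRel o q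
    have hq := hS _ _ ha
    simp only [Pi.sub_apply, Pi.zero_apply, sub_eq_zero, Matrix.vecMul, dotProduct, Matrix.of_apply]
    have key : ∀ p : U, p ⋖ o q ↔ (p : WithBot U) = a := fun p => by
      rw [← surgeryRel_coe]
      exact ⟨fun h => h.left_unique ha, fun h => h ▸ ha⟩
    simp only [key]
    induction a with
    | bot => simp [← hq, hbot]
    | coe a => simp [hq]

end surgery

/-! ## The intersection matrix -/

section endMatrix

variable {U C : Type} [DecidableEq C] (e : C × Bool ≃ U)

/-- The signed incidence matrix of the chords and their ends. -/
def endMatrix : Matrix C U ℝ :=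
  Matrix.of fun c u => if (e.symm u).1 = c then endSign (e.symm u).2 else 0

theorem endMatrix_apply (c d : C) (b : Bool) :
    endMatrix e c (e (d, b)) = if d = c then endSign b else 0 := by
  simp [endMatrix]

variable [Fintype C]

theorem endMatrix_transpose_mul [DecidableEq U] (o : U → U) (ho : ∀ c b, e (c, !b) = o (e (c, b))) :
    (endMatrix e).transpose * endMatrix e =
      1 - Matrix.of fun p q => if o p = q then 1 else 0 := by
  ext p q
  obtain ⟨⟨c, b⟩, rfl⟩ := e.surjective p
  obtain ⟨⟨d, b'⟩, rfl⟩ := e.surjective q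
  simp only [Matrix.mul_apply, Matrix.transpose_apply, endMatrix_apply, ← ho, Matrix.sub_apply,
    Matrix.one_apply, Matrix.of_apply, e.apply_eq_iff_eq, Prod.mk.injEq, ite_mul, zero_mul,
    Finset.sum_ite_eq, Finset.mem_univ, if_true]
  by_cases hcd : c = d
  · subst hcd
    cases b <;> cases b' <;> simp [endSign]
  · simp [hcd, Ne.symm hcd]

theorem sum_endMatrix [Fintype U] (c : C) (g : U → ℝ) :
    ∑ u, endMatrix e c u * g u = ∑ b, endSign b * g (e (c, b)) := by
  rw [← Fintype.sum_equiv e (fun p => endMatrix e c (e p) * g (e p)) _ fun _ => rfl,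
    Fintype.sum_prod_type, Finset.sum_eq_single c]
  · simp [endMatrix_apply]
  · intro d _ hd
    simp [endMatrix_apply, hd]
  · simp

end endMatrix

section intersection

variable {U C : Type} [LinearOrder U] (e : C × Bool ≃ U)

theorem stepSign_eq (p q : U) :
    stepSign p q = 2 * (if p < q then 1 else 0) - 1 + if p = q then 1 else 0 := by
  unfold stepSign
  rcases lt_trichotomy p q with h | rfl | h
  · rw [if_pos h, if_pos h, if_neg h.ne]; norm_num
  · simp
  · rw [if_neg h.not_gt, if_pos h, if_neg h.not_gt, if_neg h.ne']; norm_num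

theorem stepSign_comm (p q : U) : stepSign q p = - stepSign p q := by
  unfold stepSign
  rcases lt_trichotomy p q with h | rfl | h
  · simp [h, h.not_gt]
  · simp
  · simp [h, h.not_gt]

theorem intersection_comm (c d : C) : intersection e d c = - intersection e c d := by
  simp only [intersection, Fintype.sum_bool, stepSign_comm (e (c, _)) (e (d, _))]
  ring

/-- The intersection number of chords vanishes if one precedes the other. -/
theorem intersection_eq_zero {c d : C} {k : ℝ} (h : ∀ b b', stepSign (e (c, b)) (e (d, b')) = k) :
    intersection e c d = 0 := by
  simp [intersection, h, endSign]

variable [Fintype C] [DecidableEq C]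

/-- The sign of a permutation is `(-1)` to the number of chords minus the number of cycles. The
factor from the number of chords is absorbed by antisymmetry of the matrix. -/
theorem sum_perm_intersection :
    ∑ σ : Equiv.Perm C, (-1 : ℝ) ^ Nat.card (Quot fun c d => σ c = d) *
      ∏ c, intersection e c (σ c) = (Matrix.of (intersection e)).det := by
  have h : -(Matrix.of (intersection e)).transpose = Matrix.of (intersection e) := by
    ext c d
    simp [intersection_comm e c d]
  rw [← h, Matrix.det_neg, Matrix.det_apply, Finset.mul_sum]
  refine Finset.sum_congr rfl fun σ _ => ?_
  have h₁ : (Equiv.Perm.sign σ • ∏ c, (Matrix.of (intersection e)).transpose (σ c) c : ℝ) =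
      ((Equiv.Perm.sign σ : ℤ) : ℝ) * ∏ c, intersection e c (σ c) := by
    rw [Units.smul_def, zsmul_eq_mul]
    rfl
  rw [h₁, sign_eq_pow_card_quot, ← mul_assoc, ← mul_assoc, ← mul_pow]
  simp

variable [Fintype U]

/-- The step sign is `2 [p < q] - 1 + [p = q]`. The constant cancels in the signed sum over ends,
and the equality term yields the identity matrix. -/
theorem intersection_eq :
    Matrix.of (intersection e) = 1 + endMatrix e * ((ltMatrix : Matrix U U ℝ) * (endMatrix e).transpose) := by
  ext c d
  rw [Matrix.add_apply, Matrix.mul_apply, sum_endMatrix]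
  have h : ∀ u, ((ltMatrix : Matrix U U ℝ) * (endMatrix e).transpose) u d =
      ∑ b, endSign b * ltMatrix u (e (d, b)) := by
    intro u
    rw [Matrix.mul_apply, ← sum_endMatrix]
    exact Finset.sum_congr rfl fun _ _ => mul_comm _ _
  simp only [h]
  simp only [Matrix.of_apply, intersection, stepSign_eq, e.apply_eq_iff_eq, Prod.mk.injEq,
    ltMatrix, Fintype.sum_bool, endSign, Matrix.one_apply]
  by_cases hcd : c = d
  · simp only [hcd, true_and, if_true, if_false, Bool.false_eq_true, Bool.true_eq_false, lt_irrefl]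
    ring
  · simp only [hcd, false_and, if_true, if_false, Bool.false_eq_true]
    ring

/-- Moving the incidence matrix to the other side replaces a determinant over chords by one over
ends, where `endMatrix_transpose_mul` and the factorization `surgeryMatrix_eq` apply. -/
theorem det_intersection (o : U → U) (ho : ∀ c b, e (c, !b) = o (e (c, b)))
    (ho' : ∀ u, o (o u) = u) : (Matrix.of (intersection e)).det = (surgeryMatrix o).det := by
  rw [surgeryMatrix_eq o ho', Matrix.det_mul, det_one_sub_succMatrix, one_mul, intersection_eq,
    Matrix.det_one_add_mul_comm, Matrix.mul_assoc, endMatrix_transpose_mul e o ho]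

end intersection

/-! ## Values on chord diagrams -/

/-- A chord is represented by its smaller end, which carries the label `false`. -/
theorem exists_chords {U : Type} [LinearOrder U] [Fintype U] (o : U → U) (ho : ∀ u, o (o u) = u)
    (hne : ∀ u, o u ≠ u) : ∃ e : {u : U // u < o u} × Bool ≃ U,
      ∀ c b, e (c, !b) = o (e (c, b)) := by
  have hlt : ∀ u, ¬ u < o u → o u < o (o u) := fun u h => by
    rw [ho]
    exact lt_of_le_of_ne (not_lt.1 h) (hne u)
  refine ⟨⟨fun p => if p.2 then o p.1 else p.1,
    fun u => if h : u < o u then (⟨u, h⟩, false) else (⟨o u, hlt u h⟩, true), ?_, ?_⟩, ?_⟩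
  · rintro ⟨⟨u, hu⟩, _ | _⟩
    · simp [hu]
    · simp [ho, hu.not_gt]
  · intro u
    by_cases h : u < o u <;> simp [h, ho]
  · rintro c (_ | _) <;> simp [ho]

namespace JacobiDiagram

theorem exists_involution (Γ : JacobiDiagram) [IsEmpty Γ.T] : ∃ o : Γ.U → Γ.U,
    (∀ u, Γ.opp (Sum.inl u) = Sum.inl (o u)) ∧ (∀ u, o (o u) = u) ∧ ∀ u, o u ≠ u := by
  have h : ∀ u, ∃ v, Γ.opp (Sum.inl u) = Sum.inl v := by
    intro u
    rcases hu : Γ.opp (Sum.inl u) with v | ⟨t, -⟩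
    · exact ⟨v, rfl⟩
    · exact isEmptyElim t
  choose o ho using h
  refine ⟨o, ho, fun u => ?_, fun u hu => Γ.opp_ne (Sum.inl u) (by rw [ho, hu])⟩
  have := Γ.opp_opp (Sum.inl u)
  rw [ho, ho] at this
  exact Sum.inl_injective this

theorem stateForm_chord (f : ℕ → ℝ) (Γ : JacobiDiagram) [IsEmpty Γ.T] {C : Type} [Fintype C]
    [DecidableEq C] (e : C × Bool ≃ Γ.U) (o : Γ.U → Γ.U)
    (ho : ∀ u, Γ.opp (Sum.inl u) = Sum.inl (o u)) (he : ∀ c b, e (c, !b) = o (e (c, b))) :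
    stateForm f Γ = ∑ σ : Equiv.Perm C, f (Nat.card (Quot fun c d => σ c = d)) *
      ∏ c, intersection e c (σ c) :=
  stateSum_chord e f fun c b => by rw [ho, he]

/-- The subtraction is truncated, so the condition is that there is at most one class. Finiteness is
needed because `Nat.card` is `0` on infinite types. -/
theorem circleCount_eq_zero_iff (Γ : JacobiDiagram) :
    Γ.circleCount = 0 ↔ Subsingleton (Quot Γ.surgeryRel) := by
  have : Finite (WithBot Γ.U) := inferInstanceAs (Finite (Option Γ.U))
  have : Finite (Quot Γ.surgeryRel) := Finite.of_surjective _ Quot.mk_surjective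
  rw [← Finite.card_le_one_iff_subsingleton, circleCount]
  omega

theorem stateForm_chord_conway (Γ : JacobiDiagram) [IsEmpty Γ.T] :
    stateForm (fun n => (-1) ^ n) Γ = if Γ.circleCount = 0 then 1 else 0 := by
  obtain ⟨o, ho, ho', hne⟩ := Γ.exists_involution
  obtain ⟨e, he⟩ := exists_chords o ho' hne
  have hrel : ∀ a b, SurgeryRel o a b ↔ Γ.surgeryRel a b := by
    intro a b
    constructor
    · rintro ⟨z, h, rfl⟩
      exact ⟨o z, z, h, by rw [ho, ho'], rfl⟩
    · rintro ⟨y, z, h, hyz, rfl⟩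
      rw [ho, Sum.inl.injEq] at hyz
      exact ⟨z, by rwa [← hyz, ho'], rfl⟩
  rw [Γ.stateForm_chord _ e o ho he, sum_perm_intersection, det_intersection e o he ho']
  have hmk : ∀ a b, SurgeryRel o a b → Quot.mk Γ.surgeryRel a = Quot.mk _ b := fun a b h =>
    Quot.sound ((hrel a b).1 h)
  by_cases h : Γ.circleCount = 0
  · rw [if_pos h]
    rw [circleCount_eq_zero_iff] at h
    refine det_surgeryMatrix_of_connected o ho' fun S hS hbot => ?_
    refine Set.eq_empty_of_forall_notMem fun x hx => hbot ?_
    have h₁ : Quot.lift (· ∈ S) (fun a b hab => propext (hS a b ((hrel a b).2 hab)))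
        (Quot.mk Γ.surgeryRel x) := hx
    rwa [Subsingleton.elim (Quot.mk Γ.surgeryRel x) (Quot.mk _ ⊥)] at h₁
  · rw [if_neg h]
    rw [circleCount_eq_zero_iff] at h
    -- The set `S` consists of the arcs on the circles, that is, those not in the component of `⊥`.
    refine det_surgeryMatrix_of_not_connected o
      (S := {x | Quot.mk Γ.surgeryRel x ≠ Quot.mk _ ⊥}) ?_ (by simp) ?_
    · intro a b hab
      simp only [Set.mem_ofPred_eq, hmk a b hab]
    · by_contra hno
      rw [Set.not_nonempty_iff_eq_empty, Set.eq_empty_iff_forall_notMem] at hno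
      refine h ⟨?_⟩
      have : ∀ x, Quot.mk Γ.surgeryRel x = Quot.mk _ ⊥ := fun x => not_not.1 (hno x)
      rintro ⟨x⟩ ⟨y⟩
      rw [this x, this y]

end JacobiDiagram

/-! ### Connected states: products, the empty diagram, connected diagrams. -/

/-- The weight of the number of components that selects the connected states. -/
def indicatorOne (n : ℕ) : ℝ := if n = 1 then 1 else 0

namespace JacobiDiagram

/-- A permutation that preserves the chords in `S` has at least two cycles and is discarded by
`indicatorOne`. Any other permutation sends a chord across the splitting, and the intersection
number of two chords, one of which precedes the other, is zero. -/
theorem IsSplit.stateForm_chord {Γ : JacobiDiagram} [IsEmpty Γ.T] (h : Γ.IsSplit) :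
    stateForm indicatorOne Γ = 0 := by
  obtain ⟨S, hS, ⟨u, hu⟩, ⟨v, hv⟩, hlt⟩ := h
  obtain ⟨o, ho, ho', hne⟩ := Γ.exists_involution
  obtain ⟨e, he⟩ := exists_chords o ho' hne
  rw [Γ.stateForm_chord _ e o ho he]
  have hmem : ∀ c b b', Sum.inl (e (c, b)) ∈ S → Sum.inl (e (c, b')) ∈ S := by
    intro c b b' h
    have h' := hS (Sum.inl (e (c, b))) h
    rw [ho, ← he] at h'
    cases b <;> cases b'
    exacts [h, h', h', h]
  refine Finset.sum_eq_zero fun σ _ => ?_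
  by_cases hσ : ∀ c, Sum.inl (e (c, true)) ∈ S ↔ Sum.inl (e (σ c, true)) ∈ S
  · have : Nat.card (Quot fun c d => σ c = d) ≠ 1 := by
      intro h
      have hsub := (Nat.card_eq_one_iff_unique.1 h).1
      obtain ⟨⟨c, b⟩, rfl⟩ := e.surjective u
      obtain ⟨⟨d, b'⟩, rfl⟩ := e.surjective v
      have h₁ : Quot.lift (fun c => Sum.inl (e (c, true)) ∈ S)
          (fun a b hab => by rw [← hab]; exact propext (hσ a))
          (Quot.mk (fun c d => σ c = d) c) := hmem _ _ _ hu
      rw [Subsingleton.elim (Quot.mk (fun c d => σ c = d) c) (Quot.mk _ d)] at h₁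
      exact hv (hmem _ _ _ h₁)
    rw [indicatorOne, if_neg this, zero_mul]
  · push Not at hσ
    obtain ⟨c, hc⟩ := hσ
    rw [Finset.prod_eq_zero (Finset.mem_univ c), mul_zero]
    rcases hc with ⟨h₁, h₂⟩ | ⟨h₁, h₂⟩
    · refine intersection_eq_zero e (k := 1) fun b b' => ?_
      exact if_pos (hlt _ _ (hmem _ _ _ h₁) fun h => h₂ (hmem _ _ _ h))
    · refine intersection_eq_zero e (k := -1) fun b b' => ?_
      have := hlt _ _ (hmem _ _ b' h₂) fun h => h₁ (hmem _ b _ h)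
      rw [stepSign, if_neg this.not_gt, if_pos this]

/-- Being split passes from a merged diagram to both other terms of STU, so induction reduces the
claim to chord diagrams. -/
theorem IsSplit.stateForm_eq_zero {Γ : JacobiDiagram} (h : Γ.IsSplit) :
    stateForm indicatorOne Γ = 0 := by
  induction Γ using induction_on_trivalent with
  | chord Γ hT => exact h.stateForm_chord
  | trivalent Γ hT => exact stateForm_of_hasTrivalentComponent _ _ hT
  | iso Γ Γ' hi ih => rw [← stateForm_iso _ hi, ih (h.of_iso hi)]
  | stu Γ v w hvw hne h₁ h₂ =>
    obtain ⟨h₃, h₄⟩ := h.of_merge hvw hne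
    rw [stateForm_merge _ _ hvw hne, h₁ h₃, h₂ h₄, sub_zero]

/-- On the empty diagram every state has zero components, not one. -/
theorem stateForm_of_isEmpty {Γ : JacobiDiagram} (h : IsEmpty Γ.Vertex) :
    stateForm indicatorOne Γ = 0 := by
  rw [stateForm, stateSum, Finset.sum_eq_zero, mul_zero]
  intro x _
  have : componentCount Γ.opp x.2 = 0 := by
    have : IsEmpty (Quot (VertexRel Γ.opp x.2)) := ⟨by rintro ⟨x⟩; exact h.false x⟩
    exact Nat.card_of_isEmpty
  rw [stateWeight, this]
  simp [indicatorOne]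

theorem card_quot_of_connected {V : Type} {G : SimpleGraph V} (h : G.Connected) {r : V → V → Prop}
    (hr : ∀ x y, G.Adj x y → Quot.mk r x = Quot.mk r y) : Nat.card (Quot r) = 1 := by
  have hmk : ∀ x y, G.Reachable x y → Quot.mk r x = Quot.mk r y := by
    intro x y hxy
    induction hxy.some with
    | nil => rfl
    | cons hadj p ih => rw [← ih p.reachable, hr _ _ hadj]
  refine Nat.card_eq_one_iff_unique.2 ⟨⟨?_⟩, ?_⟩
  · rintro ⟨x⟩ ⟨y⟩
    exact hmk x y (h.preconnected x y)
  · obtain ⟨x⟩ := h.nonempty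
    exact ⟨Quot.mk _ x⟩

/-- A connected diagram stays connected whatever internal edges are added, so only `f 1` enters. -/
theorem stateForm_of_connected (f : ℕ → ℝ) {Γ : JacobiDiagram} (h : Γ.graph.Connected) :
    stateForm f Γ = f 1 * stateForm indicatorOne Γ := by
  have hc : ∀ E, componentCount Γ.opp E = 1 := by
    intro E
    refine card_quot_of_connected h fun x y hxy => ?_
    rw [graph_adj] at hxy
    obtain ⟨k, hk, hk'⟩ := hxy
    exact Quot.sound (Or.inl ⟨k, hk, hk'⟩)
  rw [stateForm, stateForm, stateSum, stateSum, Finset.mul_sum, Finset.mul_sum, Finset.mul_sum]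
  refine Finset.sum_congr rfl fun x _ => ?_
  rw [stateWeight, stateWeight, hc]
  split_ifs
  · simp only [indicatorOne, if_true]
    ring
  · simp

end JacobiDiagram

/-! ## The logarithm of the Conway weight system -/

theorem isConwayWeightSystem_stateLinear : IsConwayWeightSystem (stateLinear fun n => (-1) ^ n) where
  chord Γ _ := by rw [stateLinear_cls, Γ.stateForm_chord_conway]
  trivalent Γ h := by rw [stateLinear_cls, stateForm_of_hasTrivalentComponent _ _ h]

theorem existsUnique_isConwayWeightSystem :
    ∃! w : DiagramSpace →ₗ[ℝ] ℝ, IsConwayWeightSystem w :=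
  ⟨_, isConwayWeightSystem_stateLinear, fun w hw => eq_of_chord
    (fun Γ h => by rw [hw.chord Γ h, isConwayWeightSystem_stateLinear.chord Γ h])
    fun Γ h => by rw [hw.trivalent Γ h, isConwayWeightSystem_stateLinear.trivalent Γ h]⟩

theorem conwayWeight_eq : conwayWeight = stateLinear fun n => (-1) ^ n :=
  existsUnique_isConwayWeightSystem.unique
    (Classical.epsilon_spec existsUnique_isConwayWeightSystem.exists)
    isConwayWeightSystem_stateLinear

/-- The form for `indicatorOne` kills products and trivalent components, and it is minus the Conway
form on connected diagrams. As `p` is arbitrary, this also gives independence of the choice of `p`.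
-/
theorem stateLinear_of_isConnectedPart {x p : DiagramSpace} (h : IsConnectedPart x p) :
    stateLinear indicatorOne x = - conwayWeight p := by
  obtain ⟨hp, n, hn, t, ht, rfl⟩ := h
  have hn' : productSpan ≤ LinearMap.ker (stateLinear indicatorOne) := by
    refine Submodule.span_le.2 ?_
    rintro _ (⟨Γ, rfl, h⟩ | ⟨Γ₁, Γ₂, rfl, h₁, h₂, h₁', h₂'⟩)
    · rw [SetLike.mem_coe, LinearMap.mem_ker, stateLinear_cls, stateForm_of_isEmpty h]
    · rw [SetLike.mem_coe, LinearMap.mem_ker, stateLinear_cls,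
        (isSplit_prod h₁ h₂ h₁' h₂').stateForm_eq_zero]
  have ht' : trivalentSpan ≤ LinearMap.ker (stateLinear indicatorOne) := by
    refine Submodule.span_le.2 ?_
    rintro _ ⟨Γ, rfl, h⟩
    rw [SetLike.mem_coe, LinearMap.mem_ker, stateLinear_cls,
      stateForm_of_hasTrivalentComponent _ _ h]
  have hp' : connectedSpan ≤ LinearMap.ker (stateLinear indicatorOne + conwayWeight) := by
    refine Submodule.span_le.2 ?_
    rintro _ ⟨Γ, rfl, h, -⟩
    rw [SetLike.mem_coe, LinearMap.mem_ker, LinearMap.add_apply, conwayWeight_eq, stateLinear_cls,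
      stateLinear_cls, stateForm_of_connected (fun n => (-1) ^ n) h]
    ring
  rw [map_add, map_add, LinearMap.mem_ker.1 (hn' hn), LinearMap.mem_ker.1 (ht' ht)]
  have := LinearMap.mem_ker.1 (hp' hp)
  rw [LinearMap.add_apply] at this
  linarith

theorem logConwayWeight_eq (x : DiagramSpace) :
    logConwayWeight x = - stateLinear indicatorOne x := by
  have h : IsConnectedPart x (connectedPart x) := Classical.epsilon_spec (exists_isConnectedPart x)
  rw [stateLinear_of_isConnectedPart h, neg_neg, logConwayWeight]

/-! ## Legs of BCR diagrams -/

theorem sum_inDeg {V : Type} [Fintype V] (E : Set (V × V)) : ∑ v, inDeg E v = E.ncard := by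
  classical
  rw [Set.ncard_eq_toFinset_card' E, Finset.card_eq_sum_card_fiberwise (f := Prod.snd)
    (t := Finset.univ) (by simp)]
  refine Finset.sum_congr rfl fun v _ => ?_
  rw [inDeg, Set.ncard_eq_toFinset_card']
  congr 1
  ext e
  simp

theorem sum_outDeg {V : Type} [Fintype V] (E : Set (V × V)) : ∑ v, outDeg E v = E.ncard := by
  classical
  rw [Set.ncard_eq_toFinset_card' E, Finset.card_eq_sum_card_fiberwise (f := Prod.fst)
    (t := Finset.univ) (by simp)]
  refine Finset.sum_congr rfl fun v _ => ?_
  rw [outDeg, Set.ncard_eq_toFinset_card']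
  congr 1
  ext e
  simp

namespace BCRDiagram

variable {I X : Type} (G : BCRDiagram I X)

theorem exists_leg (v : I ⊕ X) (h : valency G.internalEdges G.externalEdges v = 3) :
    ∃ e : G.externalEdges, e.1.2 = v ∧ G.IsUnivalent e.1.1 := by
  cases hr : G.rule v with
  | externalTrivalent x h₁ h₂ h₃ h₄ h₅ =>
    obtain ⟨e, he, hv, hu⟩ := exists_of_ncard h₅
    exact ⟨⟨e, he⟩, hv, hu⟩
  | internalTrivalent v h₁ h₂ h₃ h₄ h₅ =>
    obtain ⟨e, he, hv⟩ := exists_of_ncard h₃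
    exact ⟨⟨e, he⟩, hv, h₅ e he hv⟩
  | univalent v h₁ h₂ h₃ h₄ => rw [valency, h₁, h₂, h₃, h₄] at h; omega
  | externalToInternal v h₁ h₂ h₃ h₄ => rw [valency, h₁, h₂, h₃, h₄] at h; omega
  | internalToExternal v h₁ h₂ h₃ h₄ => rw [valency, h₁, h₂, h₃, h₄] at h; omega

open Classical in
-- Univalent vertices are the only ones with an excess of outgoing edges, trivalent ones the only
-- ones with an excess of incoming edges, each by one. Summation shows that they are equally many.
theorem degree_balance (v : I ⊕ X) : inDeg G.internalEdges v + inDeg G.externalEdges v +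
    (if G.IsUnivalent v then 1 else 0) = outDeg G.internalEdges v + outDeg G.externalEdges v +
      if valency G.internalEdges G.externalEdges v = 3 then 1 else 0 := by
  unfold IsUnivalent valency
  cases G.rule v with
  | externalTrivalent x h₁ h₂ h₃ h₄ h₅ => simp [h₁, h₂, h₃, h₄]
  | internalTrivalent v h₁ h₂ h₃ h₄ h₅ => simp [h₁, h₂, h₃, h₄]
  | univalent v h₁ h₂ h₃ h₄ => simp [h₁, h₂, h₃, h₄]
  | externalToInternal v h₁ h₂ h₃ h₄ => simp [h₁, h₂, h₃, h₄]
  | internalToExternal v h₁ h₂ h₃ h₄ => simp [h₁, h₂, h₃, h₄]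

theorem not_isUnivalent_inr (t : X) : ¬ G.IsUnivalent (Sum.inr t) := by
  unfold IsUnivalent valency
  cases G.rule (Sum.inr t) with
  | externalTrivalent _ h₁ h₂ h₃ h₄ => rw [h₁, h₂, h₃, h₄]; decide

open Classical in
/-- The status of the ends of the external edges. -/
def endStatus (p : G.externalEdges × Bool) : Status := (p.2, p.2 == decide (G.IsUnivalent p.1.1.1))

theorem endStatus_inr {p : G.externalEdges × Bool} {t : X} {i : Fin 3}
    (h : G.ends p = Sum.inr (t, i)) :
    G.endStatus p = ![(true, false), (true, true), (false, true)] i := by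
  obtain ⟨e, b⟩ := p
  cases b
  · have h' : G.tail e = Sum.inr (t, i) := h
    unfold tail at h'
    split at h' <;> simp only [reduceCtorEq, Sum.inr.injEq, Prod.mk.injEq] at h'
    rename_i x hx
    rw [← h'.2]
    have := G.not_isUnivalent_inr x
    simp [endStatus, hx, this]
  · have h' : G.head e = Sum.inr (t, i) := h
    unfold head at h'
    split at h' <;> simp only [reduceCtorEq, Sum.inr.injEq, Prod.mk.injEq] at h'
    rw [← h'.2]
    by_cases hu : G.IsUnivalent e.1.1 <;> simp [endStatus, hu]

section internal

variable [Fintype I]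

open Classical in
/-- The status of the internal vertices. -/
def internalStatus (u : I) : Status :=
  (decide (outDeg G.internalEdges (Sum.inl u) = 1), decide (inDeg G.internalEdges (Sum.inl u) = 1))

open Classical in
/-- The internal edges, as pairs of internal vertices. -/
def internalPairs : Finset (I × I) :=
  Finset.univ.filter fun p => (Sum.inl p.1, Sum.inl p.2) ∈ G.internalEdges

theorem mem_internalPairs (p q : I) :
    (p, q) ∈ G.internalPairs ↔ (Sum.inl p, Sum.inl q) ∈ G.internalEdges := by
  simp [internalPairs]

theorem prod_legSign : ∏ u, legSign (G.internalStatus u) =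
    (-1) ^ (Finset.univ.filter fun u => G.internalStatus u = (true, true)).card := by
  simp only [legSign]
  rw [Finset.prod_ite, Finset.prod_const, Finset.prod_const_one, mul_one]

end internal

variable [Fintype I] [Fintype X]

theorem card_univalent : Nat.card {v // G.IsUnivalent v} =
    Nat.card {v // valency G.internalEdges G.externalEdges v = 3} := by
  classical
  have h := Finset.sum_congr (rfl : (Finset.univ : Finset (I ⊕ X)) = Finset.univ) fun v _ => G.degree_balance v
  simp only [Finset.sum_add_distrib, sum_inDeg, sum_outDeg] at h
  rw [Nat.card_eq_fintype_card, Nat.card_eq_fintype_card, Fintype.card_subtype,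
    Fintype.card_subtype, Finset.card_filter, Finset.card_filter]
  exact Nat.add_left_cancel h

/-- The external edges that come from univalent vertices end at trivalent vertices. -/
theorem valency_of_isUnivalent (e : G.externalEdges) (h : G.IsUnivalent e.1.1) :
    valency G.internalEdges G.externalEdges e.1.2 = 3 := by
  -- The rules do not say directly where a leg ends. But every trivalent vertex receives a leg,
  -- distinct ones from distinct univalent vertices, and there are as many univalent as trivalent
  -- vertices; so all legs are accounted for.
  choose leg hleg hu using fun v : {v // valency G.internalEdges G.externalEdges v = 3} =>
    G.exists_leg v.1 v.2
  let τ : {v // valency G.internalEdges G.externalEdges v = 3} → {v // G.IsUnivalent v} :=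
    fun v => ⟨(leg v).1.1, hu v⟩
  have hinj : Function.Injective τ := by
    intro v w hvw
    have := G.out_unique (leg v) (leg w) (congrArg Subtype.val hvw)
    exact Subtype.ext (by rw [← hleg v, ← hleg w, this])
  have hτ : Function.Bijective τ :=
    hinj.bijective_of_nat_card_le G.card_univalent.le
  obtain ⟨v, hv⟩ := hτ.2 ⟨e.1.1, h⟩
  have := G.out_unique (leg v) e (congrArg Subtype.val hv)
  rw [← this, hleg]
  exact v.2

theorem exists_of_mem_internalEdges {x : (I ⊕ X) × (I ⊕ X)} (hx : x ∈ G.internalEdges) :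
    ∃ p q, x = (Sum.inl p, Sum.inl q) := by
  obtain ⟨a, b⟩ := x
  have h : ∀ t : X, inDeg G.internalEdges (Sum.inr t) = 0 ∧
      outDeg G.internalEdges (Sum.inr t) = 0 := by
    intro t
    cases G.rule (Sum.inr t) with
    | externalTrivalent _ h₁ h₂ => exact ⟨h₁, h₂⟩
  rcases a with p | t
  · rcases b with q | t
    · exact ⟨p, q, rfl⟩
    · exact (false_of_ncard (h t).1 (a := (Sum.inl p, Sum.inr t)) ⟨hx, rfl⟩).elim
  · exact (false_of_ncard (h t).2 (a := (Sum.inr t, b)) ⟨hx, rfl⟩).elim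

theorem isMatching_internalPairs : IsMatching G.internalStatus G.internalPairs := by
  have hout : ∀ u : I, outDeg G.internalEdges (Sum.inl u) = 1 ∨
      outDeg G.internalEdges (Sum.inl u) = 0 := fun u => by
    cases G.rule (Sum.inl u) <;> simp_all
  have hin : ∀ u : I, inDeg G.internalEdges (Sum.inl u) = 1 ∨
      inDeg G.internalEdges (Sum.inl u) = 0 := fun u => by
    cases G.rule (Sum.inl u) <;> simp_all
  have hout' : ∀ p q, (Sum.inl p, Sum.inl q) ∈ G.internalEdges →
      outDeg G.internalEdges (Sum.inl p) = 1 := fun p q h =>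
    (hout p).resolve_right fun h₀ => false_of_ncard h₀ ⟨h, rfl⟩
  have hin' : ∀ p q, (Sum.inl p, Sum.inl q) ∈ G.internalEdges →
      inDeg G.internalEdges (Sum.inl q) = 1 := fun p q h =>
    (hin q).resolve_right fun h₀ => false_of_ncard h₀ ⟨h, rfl⟩
  refine ⟨fun p => ?_, fun q => ?_, fun p q q' h h' => ?_, fun p p' q h h' => ?_⟩
  · simp only [internalStatus, decide_eq_true_eq, mem_internalPairs]
    constructor
    · intro h
      obtain ⟨x, hx, hxp⟩ := exists_of_ncard h
      obtain ⟨p', q, rfl⟩ := G.exists_of_mem_internalEdges hx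
      obtain rfl := Sum.inl_injective hxp
      exact ⟨q, hx⟩
    · rintro ⟨q, hq⟩
      exact hout' p q hq
  · simp only [internalStatus, decide_eq_true_eq, mem_internalPairs]
    constructor
    · intro h
      obtain ⟨x, hx, hxp⟩ := exists_of_ncard h
      obtain ⟨p, q', rfl⟩ := G.exists_of_mem_internalEdges hx
      obtain rfl := Sum.inl_injective hxp
      exact ⟨p, hx⟩
    · rintro ⟨p, hp⟩
      exact hin' p q hp
  · rw [mem_internalPairs] at h h'
    have := eq_of_ncard (hout' p q h) (a := (Sum.inl p, Sum.inl q)) (b := (Sum.inl p, Sum.inl q'))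
      ⟨h, rfl⟩ ⟨h', rfl⟩
    simpa using this
  · rw [mem_internalPairs] at h h'
    have := eq_of_ncard (hin' p q h) (a := (Sum.inl p, Sum.inl q)) (b := (Sum.inl p', Sum.inl q))
      ⟨h, rfl⟩ ⟨h', rfl⟩
    simpa using this

/-- At a univalent vertex of the Jacobi diagram the status is defined twice, by the external edge
and by the internal edges. The vertex rules make the two agree. -/
theorem endStatus_inl {p : G.externalEdges × Bool} {u : I} (h : G.ends p = Sum.inl u) :
    G.endStatus p = G.internalStatus u := by
  obtain ⟨e, b⟩ := p
  have hv : (G.ends (e, b)).vertex = Sum.inl u := by rw [h]; rfl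
  cases b
  · have hv' : e.1.1 = Sum.inl u := by
      rw [← G.vertex_tail e, ← hv]; rfl
    have ho : outDeg G.externalEdges (Sum.inl u) ≠ 0 := fun h₀ => false_of_ncard h₀ ⟨e.2, hv'⟩
    simp only [endStatus, internalStatus, hv', IsUnivalent, valency]
    cases G.rule (Sum.inl u) with
    | internalTrivalent _ h₁ h₂ h₃ h₄ => exact (ho h₄).elim
    | univalent _ h₁ h₂ h₃ h₄ => simp [h₁, h₂, h₃, h₄]
    | externalToInternal _ h₁ h₂ h₃ h₄ => exact (ho h₄).elim
    | internalToExternal _ h₁ h₂ h₃ h₄ => simp [h₁, h₂, h₃, h₄]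
  · have hv' : e.1.2 = Sum.inl u := by
      rw [← G.vertex_head e, ← hv]; rfl
    have ho : inDeg G.externalEdges (Sum.inl u) ≠ 0 := fun h₀ => false_of_ncard h₀ ⟨e.2, hv'⟩
    have hval := G.valency_of_isUnivalent e
    rw [hv'] at hval
    simp only [endStatus, internalStatus]
    cases G.rule (Sum.inl u) with
    | internalTrivalent _ h₁ h₂ h₃ h₄ h₅ =>
      have : G.IsUnivalent e.1.1 := h₅ e.1 e.2 hv'
      simp [h₁, h₂, this]
    | univalent _ h₁ h₂ h₃ h₄ => exact (ho h₃).elim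
    -- The rule for this type does not forbid a leg; legs are excluded because they end at trivalent
    -- vertices.
    | externalToInternal _ h₁ h₂ h₃ h₄ =>
      have : ¬ G.IsUnivalent e.1.1 := fun h => by
        have := hval h
        rw [valency, h₁, h₂, h₃, h₄] at this
        omega
      simp [h₁, h₂, this]
    | internalToExternal _ h₁ h₂ h₃ h₄ => exact (ho h₃).elim

theorem ncard_externalEdges :
    G.externalEdges.ncard * 2 = Fintype.card I + 3 * Fintype.card X := by
  have h := Nat.card_congr G.endsEquiv
  rw [Nat.card_prod, Nat.card_coe_set_eq, Nat.card_eq_fintype_card (α := Bool), Fintype.card_bool,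
    Nat.card_eq_fintype_card (α := HalfEdge I X), Fintype.card_sum, Fintype.card_prod,
    Fintype.card_fin] at h
  omega

theorem trivalentCount_eq : G.trivalentCount = Fintype.card X +
    (Finset.univ.filter fun u => G.internalStatus u = (true, true)).card := by
  classical
  have h : {v | valency G.internalEdges G.externalEdges v = 3} =
      ((Finset.univ.filter fun u => G.internalStatus u = (true, true)).disjSum
        (Finset.univ : Finset X) : Set (I ⊕ X)) := by
    ext v
    rw [Set.mem_ofPred_eq, Finset.mem_coe, Finset.mem_disjSum, valency]
    simp only [Finset.mem_filter, Finset.mem_univ, true_and, internalStatus, Prod.mk.injEq,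
      decide_eq_true_eq]
    cases G.rule v <;> simp_all
  rw [trivalentCount, h, Set.ncard_coe_finset, Finset.card_disjSum, Finset.card_univ, add_comm]

theorem sign₂_eq [LinearOrder I] : G.sign₂ = ∏ e ∈ G.internalPairs, stepSign e.1 e.2 := by
  have himg : G.internalEdges = Prod.map Sum.inl Sum.inl '' (G.internalPairs : Set (I × I)) := by
    ext x
    constructor
    · intro hx
      obtain ⟨p, q, rfl⟩ := G.exists_of_mem_internalEdges hx
      exact ⟨(p, q), (G.mem_internalPairs p q).2 hx, rfl⟩
    · rintro ⟨⟨p, q⟩, h, rfl⟩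
      exact (G.mem_internalPairs p q).1 h
  rw [sign₂, himg, finprod_mem_image (Function.Injective.injOn
    (Sum.inl_injective.prodMap Sum.inl_injective)), finprod_mem_coe_finset]
  refine Finset.prod_congr rfl fun ⟨p, q⟩ h => ?_
  have hne := G.ne _ (Or.inl ((G.mem_internalPairs p q).1 h))
  have hne' : p ≠ q := fun e => hne (by rw [e])
  simp only [Prod.map, orderSign, stepSign]
  rcases lt_or_gt_of_ne hne' with h | h
  · simp [h]
  · simp [h, h.not_gt]

end BCRDiagram

/-! ## The state of a lift -/

/-- The permutation `shuffle π` of the half-edges. -/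
def shuffleEquiv {U T : Type} (π : T → Equiv.Perm (Fin 3)) : HalfEdge U T ≃ HalfEdge U T where
  toFun := shuffle π
  invFun := shuffle fun t => (π t).symm
  left_inv := by rintro (u | ⟨t, i⟩) <;> simp [shuffle]
  right_inv := by rintro (u | ⟨t, i⟩) <;> simp [shuffle]

theorem vertex_shuffle {U T : Type} (π : T → Equiv.Perm (Fin 3)) (h : HalfEdge U T) :
    (shuffle π h).vertex = h.vertex := by
  rcases h with u | ⟨t, i⟩ <;> rfl

theorem BCRDiagram.toJacobi_opp_ends {I X : Type} [LinearOrder I] [Fintype I] [Fintype X]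
    (G : BCRDiagram I X) (e : G.externalEdges) (b : Bool) :
    G.toJacobi.opp (G.ends (e, b)) = G.ends (e, !b) :=
  congrArg (fun p => G.ends (Prod.map id not p)) (G.endsEquiv.symm_apply_apply (e, b))

theorem triSign_perm (π : Equiv.Perm (Fin 3)) :
    triSign (![(true, false), (true, true), (false, true)] (π.symm 0))
      (![(true, false), (true, true), (false, true)] (π.symm 1))
      (![(true, false), (true, true), (false, true)] (π.symm 2)) = Equiv.Perm.sign π := by
  revert π; decide

theorem JacobiDiagram.card_edge (Γ : JacobiDiagram) :
    Nat.card Γ.Edge * 2 = Fintype.card Γ.U + 3 * Fintype.card Γ.T := by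
  classical
  have hsurj : Function.Surjective Γ.edge := by
    rintro ⟨_, h, rfl⟩; exact ⟨h, rfl⟩
  have : Finite Γ.Edge := Finite.of_surjective _ hsurj
  have : Fintype Γ.Edge := Fintype.ofFinite _
  have key : Fintype.card (HalfEdge Γ.U Γ.T) = Fintype.card Γ.Edge * 2 := by
    rw [← Finset.card_univ, ← Finset.card_univ,
      Finset.card_eq_sum_card_fiberwise (f := Γ.edge) (t := Finset.univ) (by simp),
      Finset.sum_const_nat]
    intro e _
    obtain ⟨h, rfl⟩ := hsurj e
    have : Finset.univ.filter (fun a => Γ.edge a = Γ.edge h) = {h, Γ.opp h} := by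
      ext a
      simp [Γ.edge_eq_iff]
    rw [this, Finset.card_pair (Γ.opp_ne h).symm]
  rw [Nat.card_eq_fintype_card, ← key]
  simp only [Fintype.card_sum, Fintype.card_prod, Fintype.card_fin]
  ring

namespace Lift

variable {Γ : JacobiDiagram} {j : Γ.Numbering} (L : Lift Γ j)

/-- The half-edges of `Γ` are the ends of the external edges. -/
def ends : L.diagram.externalEdges × Bool ≃ HalfEdge Γ.U Γ.T :=
  L.diagram.endsEquiv.trans (shuffleEquiv L.perm)

theorem ends_apply (p : L.diagram.externalEdges × Bool) :
    L.ends p = shuffle L.perm (L.diagram.ends p) := rfl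

theorem opp_ends (e : L.diagram.externalEdges) (b : Bool) :
    Γ.opp (L.ends (e, b)) = L.ends (e, !b) := by
  rw [ends_apply, L.opp_eq, ends_apply, BCRDiagram.toJacobi_opp_ends]

theorem vertex_ends_false (e : L.diagram.externalEdges) :
    (L.ends (e, false)).vertex = e.1.1 := by
  rw [ends_apply, vertex_shuffle]
  exact L.diagram.vertex_tail e

theorem vertex_ends_true (e : L.diagram.externalEdges) :
    (L.ends (e, true)).vertex = e.1.2 := by
  rw [ends_apply, vertex_shuffle]
  exact L.diagram.vertex_head e

/-- The statuses of the half-edges. -/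
def status (h : HalfEdge Γ.U Γ.T) : Status := L.diagram.endStatus (L.ends.symm h)

theorem status_ends (p : L.diagram.externalEdges × Bool) :
    L.status (L.ends p) = L.diagram.endStatus p := by
  rw [status, Equiv.symm_apply_apply]

theorem status_inl (u : Γ.U) : L.status (Sum.inl u) = L.diagram.internalStatus u := by
  obtain ⟨p, hp⟩ := L.ends.surjective (Sum.inl u)
  rw [← hp, status_ends]
  refine L.diagram.endStatus_inl ((shuffleEquiv L.perm).injective ?_)
  exact hp

theorem status_inr (t : Γ.T) (i : Fin 3) : L.status (Sum.inr (t, i)) =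
    ![(true, false), (true, true), (false, true)] ((L.perm t).symm i) := by
  obtain ⟨p, hp⟩ := L.ends.surjective (Sum.inr (t, i))
  rw [← hp, status_ends]
  refine L.diagram.endStatus_inr (t := t) ((shuffleEquiv L.perm).injective (hp.trans ?_))
  simp [shuffleEquiv, shuffle]

theorem isState : IsState Γ.opp L.status L.diagram.internalPairs := by
  constructor
  · intro h
    obtain ⟨⟨e, b⟩, rfl⟩ := L.ends.surjective h
    rw [opp_ends, status_ends, status_ends]
    cases b <;> simp [BCRDiagram.endStatus, Status.opposite]
  · have : (fun u => L.status (Sum.inl u)) = L.diagram.internalStatus := funext L.status_inl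
    rw [this]
    exact L.diagram.isMatching_internalPairs

theorem componentCount : componentCount Γ.opp L.diagram.internalPairs = 1 := by
  have key : ∀ x ∈ L.diagram.internalEdges ∪ L.diagram.externalEdges,
      VertexRel Γ.opp L.diagram.internalPairs x.1 x.2 := by
    rintro x (hx | hx)
    · obtain ⟨p, q, rfl⟩ := L.diagram.exists_of_mem_internalEdges hx
      exact Or.inr ⟨(p, q), (L.diagram.mem_internalPairs p q).2 hx, rfl, rfl⟩
    · refine Or.inl ⟨L.ends (⟨x, hx⟩, false), L.vertex_ends_false _, ?_⟩
      rw [opp_ends]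
      exact L.vertex_ends_true _
  refine card_quot_of_connected L.diagram.connected fun x y h => ?_
  rw [SimpleGraph.fromRel_adj] at h
  rcases h.2 with h | h
  · exact Quot.sound (key _ h)
  · exact (Quot.sound (key _ h)).symm

/-- The sign of the number of external edges and of external trivalent vertices is in the
normalization, that of internal trivalent vertices in the leg signs; `sign₂` is the product of step
signs and `sign₃` that of the signs at trivalent vertices. -/
theorem weight_eq : L.diagram.sign₁ * L.diagram.sign₂ * L.sign₃ /
    (2 : ℝ) ^ (2 * (Γ.degree : ℤ) - (Nat.card Γ.Edge : ℤ)) =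
      normalization (Fintype.card Γ.U) (Fintype.card Γ.T) *
        stateWeight indicatorOne Γ.opp L.status L.diagram.internalPairs := by
  have h₁ : ∏ t : Γ.T, (triSign (L.status (Sum.inr (t, 0))) (L.status (Sum.inr (t, 1)))
      (L.status (Sum.inr (t, 2))) : ℝ) = L.sign₃ := by
    rw [sign₃]
    refine Finset.prod_congr rfl fun t _ => ?_
    rw [status_inr, status_inr, status_inr, triSign_perm]
  have hE := L.diagram.ncard_externalEdges
  have hE' := Γ.card_edge
  have h₂ : edgeNumber (Fintype.card Γ.U) (Fintype.card Γ.T) = Nat.card Γ.Edge := by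
    rw [edgeNumber]; omega
  have h₃ : L.diagram.externalEdges.ncard = Nat.card Γ.Edge := by omega
  -- The degree is defined by a truncated division; the count of half-edges shows that the number of
  -- vertices is even.
  have h₄ : 2 * (Γ.degree : ℤ) = Fintype.card Γ.U + Fintype.card Γ.T := by
    have : 2 * Γ.degree = Fintype.card Γ.U + Fintype.card Γ.T := by
      rw [degree, Fintype.card_sum]; omega
    exact_mod_cast this
  rw [stateWeight, if_pos L.isState, h₁, L.componentCount, BCRDiagram.sign₂_eq, normalization, h₂,
    BCRDiagram.sign₁, h₃, h₄, L.diagram.trivalentCount_eq,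
    Finset.prod_congr rfl fun u _ => congrArg legSign (L.status_inl u), L.diagram.prod_legSign,
    div_eq_mul_inv, ← zpow_neg, neg_sub, indicatorOne, if_pos rfl, ← add_assoc, pow_add]
  ring

theorem mem_externalEdges (x : Γ.Vertex × Γ.Vertex) : x ∈ L.diagram.externalEdges ↔
    ∃ h, (L.status h).1 = false ∧ h.vertex = x.1 ∧ (Γ.opp h).vertex = x.2 := by
  constructor
  · intro hx
    refine ⟨L.ends (⟨x, hx⟩, false), ?_, L.vertex_ends_false _, ?_⟩
    · rw [status_ends]; rfl
    · rw [opp_ends]; exact L.vertex_ends_true _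
  · rintro ⟨h, hs, h₁, h₂⟩
    obtain ⟨⟨e, b⟩, rfl⟩ := L.ends.surjective h
    rw [status_ends] at hs
    obtain rfl : b = false := hs
    rw [vertex_ends_false] at h₁
    rw [opp_ends] at h₂
    have h₂' := (L.vertex_ends_true e).symm.trans h₂
    have : x = e.1 := Prod.ext h₁.symm h₂'.symm
    rw [this]
    exact e.2

theorem ends_eq_of_status {L L' : Lift Γ j} (h : L.status = L'.status)
    (e : L.diagram.externalEdges) (e' : L'.diagram.externalEdges) (he : e.1 = e'.1) :
    L.ends (e, false) = L'.ends (e', false) := by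
  obtain ⟨⟨d, b⟩, hd⟩ := L'.ends.surjective (L.ends (e, false))
  have hb := congrArg Prod.fst (congrFun h (L.ends (e, false)))
  rw [status_ends, ← hd, status_ends] at hb
  obtain rfl : false = b := hb
  have hv := L.vertex_ends_false e
  rw [← hd, vertex_ends_false, he] at hv
  rw [← hd, L'.diagram.out_unique d e' hv]

/-- The statuses orient the edges of `Γ`, hence give the external edges, and `j` then dictates their
numbers. The relabellings are determined by `Lift.eq_of_diagram_number`. -/
theorem eq_of_status {L L' : Lift Γ j} (h : L.status = L'.status)
    (h' : L.diagram.internalPairs = L'.diagram.internalPairs) : L = L' := by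
  have h₁ : L.diagram.externalEdges = L'.diagram.externalEdges := by
    ext x
    rw [mem_externalEdges, mem_externalEdges, h]
  have hsub : ∀ {L L' : Lift Γ j}, L.diagram.internalPairs = L'.diagram.internalPairs →
      L.diagram.internalEdges ⊆ L'.diagram.internalEdges := by
    intro L L' h' x hx
    obtain ⟨p, q, rfl⟩ := L.diagram.exists_of_mem_internalEdges hx
    rwa [← BCRDiagram.mem_internalPairs, ← h', BCRDiagram.mem_internalPairs]
  have h₂ : L.diagram.internalEdges = L'.diagram.internalEdges :=
    (hsub h').antisymm (hsub h'.symm)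
  have h₃ : ∀ (e : L.diagram.externalEdges) (e' : L'.diagram.externalEdges), e.1 = e'.1 →
      L.number e = L'.number e' := by
    intro e e' he
    rw [← L.number_eq, ← L'.number_eq]
    have := ends_eq_of_status h e e' he
    exact congrArg (fun k => j (Γ.edge k)) this
  obtain ⟨⟨Ei, Ee, _, _, _, _⟩, σ, π, _, _⟩ := L
  obtain ⟨⟨Ei', Ee', _, _, _, _⟩, σ', π', _, _⟩ := L'
  obtain rfl : Ei = Ei' := h₂
  obtain rfl : Ee = Ee' := h₁
  refine eq_of_diagram_number _ _ rfl (heq_of_eq ?_)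
  ext e
  exact congrArg Fin.val (h₃ e e rfl)

end Lift

/-! ## The lift of a state -/

/-- The states that come from BCR diagrams. -/
structure IsBCRState {U T : Type} (opp : HalfEdge U T → HalfEdge U T) (s : HalfEdge U T → Status)
    (E : Finset (U × U)) (π : T → Equiv.Perm (Fin 3)) : Prop where
  opp_opp : ∀ h, opp (opp h) = h
  no_loop : ∀ h, (opp h).vertex ≠ h.vertex
  isState : IsState opp s E
  status_perm : ∀ t i, s (Sum.inr (t, π t i)) = ![(true, false), (true, true), (false, true)] i
  ne : ∀ p q, (p, q) ∈ E → p ≠ q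
  componentCount : componentCount opp E = 1

theorem exists_perm_of_triSign_ne_zero {x y z : Status} (h : triSign x y z ≠ 0) :
    ∃ π : Equiv.Perm (Fin 3), ∀ i,
      ![x, y, z] (π i) = ![(true, false), (true, true), (false, true)] i := by
  revert x y z; decide

/-- Each condition comes from one nonzero factor: the signs at trivalent vertices give the
relabellings, the step signs exclude loops, and `indicatorOne` forces connectedness. -/
theorem exists_isBCRState (Γ : JacobiDiagram) {s : HalfEdge Γ.U Γ.T → Status}
    {E : Finset (Γ.U × Γ.U)} (h : stateWeight indicatorOne Γ.opp s E ≠ 0) :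
    ∃ π, IsBCRState Γ.opp s E π := by
  have hS := isState_of_stateWeight_ne_zero h
  choose π hπ using fun t =>
    exists_perm_of_triSign_ne_zero (triSign_ne_zero_of_stateWeight_ne_zero h t)
  refine ⟨π, Γ.opp_opp, Γ.no_loop, hS, fun t i => ?_, fun p q hp hpq => ?_, ?_⟩
  · rw [← hπ]
    have : ∀ k : Fin 3, s (Sum.inr (t, k)) =
        ![s (Sum.inr (t, 0)), s (Sum.inr (t, 1)), s (Sum.inr (t, 2))] k := by
      intro k
      fin_cases k <;> rfl
    exact this _
  · refine h ?_
    rw [stateWeight, if_pos hS, Finset.prod_eq_zero hp (by simp [stepSign, hpq])]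
    simp
  · by_contra hc
    refine h ?_
    rw [stateWeight, if_pos hS, indicatorOne, if_neg hc, mul_zero]

/-- The external edges of a state. -/
def externalEdges {U T : Type} (opp : HalfEdge U T → HalfEdge U T) (s : HalfEdge U T → Status) :
    Set ((U ⊕ T) × (U ⊕ T)) :=
  (fun h => (h.vertex, (opp h).vertex)) '' {h | (s h).1 = false}

/-- The internal edges of a state. -/
def internalEdges {U : Type} (T : Type) (E : Finset (U × U)) : Set ((U ⊕ T) × (U ⊕ T)) :=
  Prod.map Sum.inl Sum.inl '' (E : Set (U × U))

theorem vertex_eq_inl {U T : Type} {h : HalfEdge U T} {u : U} (hv : h.vertex = Sum.inl u) :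
    h = Sum.inl u := by
  rcases h with v | ⟨t, i⟩
  · exact congrArg Sum.inl (Sum.inl_injective hv)
  · simp [HalfEdge.vertex] at hv

namespace IsBCRState

variable {U T : Type} {opp : HalfEdge U T → HalfEdge U T} {s : HalfEdge U T → Status}
  {E : Finset (U × U)} {π : T → Equiv.Perm (Fin 3)}

theorem eq_of_vertex_eq_inr (π : T → Equiv.Perm (Fin 3)) {h : HalfEdge U T} {t : T} (hv : h.vertex = Sum.inr t) :
    ∃ i, h = Sum.inr (t, π t i) := by
  rcases h with v | ⟨t', i⟩
  · simp [HalfEdge.vertex] at hv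
  · obtain rfl : t' = t := Sum.inr_injective hv
    exact ⟨(π t').symm i, by simp⟩

theorem eq_of_status (H : IsBCRState opp s E π) {h k : HalfEdge U T} (hv : h.vertex = k.vertex) (hs : s h = s k) : h = k := by
  rcases hk : k.vertex with u | t
  · rw [vertex_eq_inl hk, vertex_eq_inl (hv.trans hk)]
  · obtain ⟨i, rfl⟩ := eq_of_vertex_eq_inr π hk
    obtain ⟨i', rfl⟩ := eq_of_vertex_eq_inr π (hv.trans hk)
    rw [H.status_perm, H.status_perm] at hs
    have aux : ∀ i i' : Fin 3, ![((true, false) : Status), (true, true), (false, true)] i' =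
        ![(true, false), (true, true), (false, true)] i → i' = i := by decide
    rw [aux i i' hs]

theorem tail_unique (H : IsBCRState opp s E π) {h k : HalfEdge U T} (hv : h.vertex = k.vertex) (hs : (s h).1 = false)
    (hk' : (s k).1 = false) : h = k := by
  rcases hk : k.vertex with u | t
  · rw [vertex_eq_inl hk, vertex_eq_inl (hv.trans hk)]
  · obtain ⟨i, rfl⟩ := eq_of_vertex_eq_inr π hk
    obtain ⟨i', rfl⟩ := eq_of_vertex_eq_inr π (hv.trans hk)
    rw [H.status_perm] at hs hk'
    have aux : ∀ i : Fin 3, (![((true, false) : Status), (true, true), (false, true)] i).1 = false →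
        i = 2 := by decide
    rw [aux i hk', aux i' hs]

theorem ncard_externalEdges (H : IsBCRState opp s E π) (P : (U ⊕ T) × (U ⊕ T) → Prop) :
    {e ∈ externalEdges opp s | P e}.ncard =
      {h | (s h).1 = false ∧ P (h.vertex, (opp h).vertex)}.ncard := by
  have : {e ∈ externalEdges opp s | P e} = (fun h => (h.vertex, (opp h).vertex)) ''
      {h | (s h).1 = false ∧ P (h.vertex, (opp h).vertex)} := by
    ext e
    constructor
    · rintro ⟨⟨h, hs, rfl⟩, hP⟩
      exact ⟨h, ⟨hs, hP⟩, rfl⟩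
    · rintro ⟨h, ⟨hs, hP⟩, rfl⟩
      exact ⟨⟨h, hs, rfl⟩, hP⟩
  rw [this]
  have hinj : Set.InjOn (fun h => (h.vertex, (opp h).vertex))
      {h | (s h).1 = false ∧ P (h.vertex, (opp h).vertex)} := fun h hh k hk e =>
    H.tail_unique (congrArg Prod.fst e) hh.1 hk.1
  exact hinj.ncard_image

theorem outDeg_externalEdges (H : IsBCRState opp s E π) (v : U ⊕ T) : outDeg (externalEdges opp s) v =
    {h : HalfEdge U T | (s h).1 = false ∧ h.vertex = v}.ncard :=
  H.ncard_externalEdges fun e => e.1 = v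

theorem status_opp (H : IsBCRState opp s E π) (h : HalfEdge U T) : s (opp h) = (s h).opposite := H.isState.1 h

theorem inDeg_externalEdges (H : IsBCRState opp s E π) (v : U ⊕ T) : inDeg (externalEdges opp s) v =
    {h : HalfEdge U T | (s h).1 = true ∧ h.vertex = v}.ncard := by
  refine (H.ncard_externalEdges fun e => e.2 = v).trans ?_
  have hinj : Function.Injective opp := Function.LeftInverse.injective H.opp_opp
  rw [← Set.ncard_image_of_injective _ hinj]
  congr 1
  ext h
  constructor
  · rintro ⟨k, ⟨hk, hv⟩, rfl⟩
    exact ⟨by rw [H.status_opp]; simp [Status.opposite, hk], hv⟩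
  · rintro ⟨hk, hv⟩
    exact ⟨opp h, ⟨by rw [H.status_opp]; simp [Status.opposite, hk], by simpa [H.opp_opp] using hv⟩,
      H.opp_opp h⟩

theorem ncard_inl (u : U) (b : Bool) :
    {h : HalfEdge U T | (s h).1 = b ∧ h.vertex = Sum.inl u}.ncard =
      if (s (Sum.inl u)).1 = b then 1 else 0 := by
  split_ifs with hb
  · rw [Set.ncard_eq_one]
    refine ⟨Sum.inl u, Set.eq_singleton_iff_unique_mem.2 ⟨⟨hb, rfl⟩, ?_⟩⟩
    exact fun h hh => vertex_eq_inl hh.2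
  · have : {h : HalfEdge U T | (s h).1 = b ∧ h.vertex = Sum.inl u} = ∅ := by
      refine Set.eq_empty_of_forall_notMem fun h hh => hb ?_
      rw [← vertex_eq_inl hh.2]
      exact hh.1
    rw [this, Set.ncard_empty]

theorem outDeg_external_inr (H : IsBCRState opp s E π) (t : T) : outDeg (externalEdges opp s) (Sum.inr t) = 1 := by
  rw [H.outDeg_externalEdges, Set.ncard_eq_one]
  refine ⟨Sum.inr (t, π t 2), Set.eq_singleton_iff_unique_mem.2 ⟨⟨?_, rfl⟩, ?_⟩⟩
  · rw [H.status_perm]; rfl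
  · rintro h ⟨hs, hv⟩
    exact H.tail_unique hv hs (by rw [H.status_perm]; rfl)

theorem inDeg_external_inr (H : IsBCRState opp s E π) (t : T) : inDeg (externalEdges opp s) (Sum.inr t) = 2 := by
  have hne : (Sum.inr (t, π t 0) : HalfEdge U T) ≠ Sum.inr (t, π t 1) := by simp
  rw [H.inDeg_externalEdges, ← Set.ncard_pair hne]
  congr 1
  ext h
  simp only [Set.mem_ofPred_eq, Set.mem_insert_iff, Set.mem_singleton_iff]
  constructor
  · rintro ⟨hs, hv⟩
    obtain ⟨i, rfl⟩ := eq_of_vertex_eq_inr π hv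
    rw [H.status_perm] at hs
    fin_cases i
    · exact Or.inl rfl
    · exact Or.inr rfl
    · simp at hs
  · rintro (rfl | rfl)
    · exact ⟨by rw [H.status_perm]; rfl, rfl⟩
    · exact ⟨by rw [H.status_perm]; rfl, rfl⟩

theorem degree_internal_inr (t : T) : inDeg (internalEdges T E) (Sum.inr t) = 0 ∧
    outDeg (internalEdges T E) (Sum.inr t) = 0 := by
  constructor
  · refine (congrArg Set.ncard (Set.eq_empty_of_forall_notMem ?_)).trans (Set.ncard_empty _)
    rintro _ ⟨⟨e, he, rfl⟩, h⟩
    simp at h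
  · refine (congrArg Set.ncard (Set.eq_empty_of_forall_notMem ?_)).trans (Set.ncard_empty _)
    rintro _ ⟨⟨e, he, rfl⟩, h⟩
    simp at h

theorem outDeg_internal_inl (H : IsBCRState opp s E π) (u : U) : outDeg (internalEdges T E) (Sum.inl u) =
    if (s (Sum.inl u)).1 = true then 1 else 0 := by
  have hE := H.isState.2
  split_ifs with hu
  · obtain ⟨q, hq⟩ := (hE.src u).1 hu
    refine Set.ncard_eq_one.2 ⟨(Sum.inl u, Sum.inl q),
      Set.eq_singleton_iff_unique_mem.2 ⟨⟨⟨(u, q), hq, rfl⟩, rfl⟩, ?_⟩⟩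
    rintro _ ⟨⟨⟨p, q'⟩, he, rfl⟩, h⟩
    obtain rfl : p = u := Sum.inl_injective h
    rw [hE.src_unique p q q' hq he]
    rfl
  · refine (congrArg Set.ncard (Set.eq_empty_of_forall_notMem ?_)).trans (Set.ncard_empty _)
    rintro _ ⟨⟨⟨p, q'⟩, he, rfl⟩, h⟩
    obtain rfl : p = u := Sum.inl_injective h
    exact hu ((hE.src p).2 ⟨_, he⟩)

theorem inDeg_internal_inl (H : IsBCRState opp s E π) (u : U) : inDeg (internalEdges T E) (Sum.inl u) =
    if (s (Sum.inl u)).2 = true then 1 else 0 := by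
  have hE := H.isState.2
  split_ifs with hu
  · obtain ⟨q, hq⟩ := (hE.tgt u).1 hu
    refine Set.ncard_eq_one.2 ⟨(Sum.inl q, Sum.inl u),
      Set.eq_singleton_iff_unique_mem.2 ⟨⟨⟨(q, u), hq, rfl⟩, rfl⟩, ?_⟩⟩
    rintro _ ⟨⟨⟨q', p⟩, he, rfl⟩, h⟩
    obtain rfl : p = u := Sum.inl_injective h
    rw [hE.tgt_unique q q' p hq he]
    rfl
  · refine (congrArg Set.ncard (Set.eq_empty_of_forall_notMem ?_)).trans (Set.ncard_empty _)
    rintro _ ⟨⟨⟨q', p⟩, he, rfl⟩, h⟩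
    obtain rfl : p = u := Sum.inl_injective h
    exact hu ((hE.tgt p).2 ⟨_, he⟩)

/-- Identifies the legs of the diagram to be built: among tails, the status `(false, false)` occurs
exactly at univalent vertices. -/
theorem valency_eq_one_iff (H : IsBCRState opp s E π) {h : HalfEdge U T} (hs : (s h).1 = false) :
    valency (internalEdges T E) (externalEdges opp s) h.vertex = 1 ↔ s h = (false, false) := by
  rcases h with u | ⟨t, i⟩
  · change valency _ _ (Sum.inl u) = 1 ↔ _
    rw [valency, H.outDeg_internal_inl, H.inDeg_internal_inl, H.inDeg_externalEdges,
      H.outDeg_externalEdges, ncard_inl, ncard_inl, hs]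
    rcases hb : s (Sum.inl u) with ⟨a, b⟩
    rw [hb] at hs
    obtain rfl : a = false := hs
    cases b <;> simp
  · change valency _ _ (Sum.inr t) = 1 ↔ _
    obtain ⟨k, hk⟩ := eq_of_vertex_eq_inr π (h := Sum.inr (t, i)) rfl
    rw [valency, H.outDeg_external_inr, H.inDeg_external_inr, (degree_internal_inr t).1,
      (degree_internal_inr t).2, hk, H.status_perm]
    constructor
    · intro h; omega
    · have aux : ∀ k : Fin 3, ![((true, false) : Status), (true, true), (false, true)] k ≠
          (false, false) := by decide
      exact fun h => (aux k h).elim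

/-- The four statuses of a univalent vertex of the Jacobi diagram are the four types of internal
vertices. -/
theorem vertexRule (H : IsBCRState opp s E π) (v : U ⊕ T) : VertexRule (internalEdges T E) (externalEdges opp s) v := by
  rcases v with u | t
  · have h₁ := H.inDeg_internal_inl u
    have h₂ := H.outDeg_internal_inl u
    have h₃ := H.inDeg_externalEdges (Sum.inl u)
    have h₄ := H.outDeg_externalEdges (Sum.inl u)
    rw [ncard_inl] at h₃ h₄
    rcases hu : s (Sum.inl u) with ⟨_ | _, _ | _⟩ <;> rw [hu] at h₁ h₂ h₃ h₄
    · exact .univalent u h₁ h₂ h₃ h₄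
    · exact .internalToExternal u h₁ h₂ h₃ h₄
    · exact .externalToInternal u h₁ h₂ h₃ h₄
    · refine .internalTrivalent u h₁ h₂ h₃ h₄ ?_
      -- The head has status `(true, true)`, so the tail has status `(false, false)`, that of a leg.
      rintro _ ⟨h, hs, rfl⟩ hv
      refine (H.valency_eq_one_iff hs).2 ?_
      have := H.status_opp h
      rw [vertex_eq_inl hv, hu] at this
      revert this
      generalize s h = x
      revert x
      decide
  · refine .externalTrivalent t (degree_internal_inr t).1 (degree_internal_inr t).2
      (H.inDeg_external_inr t) (H.outDeg_external_inr t) ?_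
    refine (H.ncard_externalEdges _).trans (Set.ncard_eq_one.2 ⟨opp (Sum.inr (t, π t 1)),
      Set.eq_singleton_iff_unique_mem.2 ⟨⟨?_, ?_, ?_⟩, ?_⟩⟩)
    · rw [H.status_opp, H.status_perm]; rfl
    · rw [H.opp_opp]; rfl
    · rw [H.valency_eq_one_iff] <;> rw [H.status_opp, H.status_perm] <;> rfl
    · rintro h ⟨hs, hv, h₁⟩
      have h₁' := (H.valency_eq_one_iff hs).1 h₁
      rw [← H.eq_of_status (h := opp h) (k := Sum.inr (t, π t 1)) hv ?_, H.opp_opp]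
      rw [H.status_opp, h₁', H.status_perm]
      rfl

/-- The BCR diagram of a state. -/
def diagram (H : IsBCRState opp s E π) : BCRDiagram U T where
  internalEdges := internalEdges T E
  externalEdges := externalEdges opp s
  disjoint := by
    -- An internal edge leaves `p` only if the single half-edge at `p` is the head of an external
    -- edge; an external edge leaving `p` would need it to be a tail.
    rw [Set.disjoint_left]
    rintro _ ⟨⟨p, q⟩, he, rfl⟩ ⟨h, hs, e⟩
    have h₁ := (H.isState.2.src p).2 ⟨q, he⟩
    have h₂ : h = Sum.inl p := vertex_eq_inl (congrArg Prod.fst e)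
    rw [Set.mem_ofPred_eq, h₂] at hs
    rw [hs] at h₁
    exact Bool.false_ne_true h₁
  ne := by
    rintro _ (⟨⟨p, q⟩, he, rfl⟩ | ⟨h, hs, rfl⟩)
    · exact fun e => H.ne p q he (Sum.inl_injective e)
    · exact (H.no_loop h).symm
  connected := by
    set G : SimpleGraph (U ⊕ T) :=
      SimpleGraph.fromRel fun v w => (v, w) ∈ internalEdges T E ∪ externalEdges opp s
    have hadj : ∀ v w, v ≠ w → (v, w) ∈ internalEdges T E ∪ externalEdges opp s →
        G.Reachable v w := fun v w hne h =>
      SimpleGraph.Adj.reachable ((SimpleGraph.fromRel_adj _ _ _).2 ⟨hne, Or.inl h⟩)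
    have hrel : ∀ v w, VertexRel opp E v w → G.Reachable v w := by
      rintro _ _ (⟨h, rfl, rfl⟩ | ⟨⟨p, q⟩, he, rfl, rfl⟩)
      · rcases hs : (s h).1
        · exact hadj _ _ (H.no_loop h).symm (Or.inr ⟨h, hs, rfl⟩)
        · refine (hadj _ _ (H.no_loop h) (Or.inr ⟨opp h, ?_, ?_⟩)).symm
          · rw [Set.mem_ofPred_eq, H.status_opp]
            simp [Status.opposite, hs]
          · simp only [H.opp_opp]
      · exact hadj _ _ (fun e => H.ne p q he (Sum.inl_injective e)) (Or.inl ⟨(p, q), he, rfl⟩)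
    obtain ⟨hsub, ⟨x⟩⟩ := Nat.card_eq_one_iff_unique.1 H.componentCount
    have hpre : G.Preconnected := by
      intro v w
      have := Quot.eqvGen_exact (Subsingleton.elim (Quot.mk (VertexRel opp E) v) (Quot.mk _ w))
      induction this with
      | rel v w h => exact hrel v w h
      | refl v => exact .refl v
      | symm v w _ ih => exact ih.symm
      | trans v w x _ _ ih ih' => exact ih.trans ih'
    obtain ⟨v, -⟩ := Quot.exists_rep x
    have : Nonempty (U ⊕ T) := ⟨v⟩
    exact ⟨hpre⟩
  rule := H.vertexRule

theorem shuffle_ends (H : IsBCRState opp s E π) (e : H.diagram.externalEdges) {h : HalfEdge U T} (hs : (s h).1 = false)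
    (he : (h.vertex, (opp h).vertex) = e.1) : shuffle π (H.diagram.ends (e, false)) = h ∧
      shuffle π (H.diagram.ends (e, true)) = opp h := by
  have hu : H.diagram.IsUnivalent e.1.1 ↔ s h = (false, false) := by
    rw [← he]
    exact H.valency_eq_one_iff hs
  have h₁ : (H.diagram.tail e).vertex = h.vertex := by
    rw [BCRDiagram.vertex_tail, ← he]
  have h₂ : (H.diagram.head e).vertex = (opp h).vertex := by
    rw [BCRDiagram.vertex_head, ← he]
  constructor
  · refine H.tail_unique ((vertex_shuffle _ _).trans h₁) ?_ hs
    change (s (shuffle π (H.diagram.tail e))).1 = false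
    unfold BCRDiagram.tail
    split
    · rename_i v hv
      rw [vertex_eq_inl (h := h) (u := v) (by rw [← hv, ← he])] at hs
      exact hs
    · exact congrArg Prod.fst (H.status_perm _ 2)
  · refine H.eq_of_status ((vertex_shuffle _ _).trans h₂) ?_
    change s (shuffle π (H.diagram.head e)) = s (opp h)
    unfold BCRDiagram.head
    split
    · rename_i v hv
      rw [vertex_eq_inl (h := opp h) (u := v) (by rw [← hv, ← he])]
      rfl
    · rename_i x hx
      change s (Sum.inr (x, π x _)) = _
      rw [H.status_perm, H.status_opp]
      have hk : ∃ i, opp h = Sum.inr (x, π x i) :=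
        eq_of_vertex_eq_inr π (by rw [← hx, ← he])
      obtain ⟨i, hi⟩ := hk
      have h₃ := H.status_opp h
      rw [hi, H.status_perm] at h₃
      split_ifs with huv
      · rw [hu.1 huv]; rfl
      · rw [hu] at huv
        rw [← h₃]
        have aux : ∀ (y : Status) (i : Fin 3), y.1 = false → y ≠ (false, false) →
            ![((true, false) : Status), (true, true), (false, true)] i = y.opposite →
            ![((true, false) : Status), (true, true), (false, true)] 0 =
              ![(true, false), (true, true), (false, true)] i := by decide
        exact aux _ _ hs huv h₃

end IsBCRState

/-- The numbering of the external edges is read off from `j` on the corresponding edges of `Γ`. It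
is injective because the two halves of an edge have opposite statuses, and only one of them is a
tail. -/
theorem exists_lift {Γ : JacobiDiagram} (j : Γ.Numbering) {s : HalfEdge Γ.U Γ.T → Status}
    {E : Finset (Γ.U × Γ.U)} {π : Γ.T → Equiv.Perm (Fin 3)} (H : IsBCRState Γ.opp s E π) :
    ∃ L : Lift Γ j, L.status = s ∧ L.diagram.internalPairs = E := by
  have hex : ∀ e : H.diagram.externalEdges, ∃ h, (s h).1 = false ∧
      (h.vertex, (Γ.opp h).vertex) = e.1 := fun e => e.2
  choose r hr hr' using hex
  have hends := fun e => H.shuffle_ends e (hr e) (hr' e)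
  let L : Lift Γ j :=
    { diagram := H.diagram
      number := ⟨fun e => j (Γ.edge (r e)), fun e e' h => by
        rcases (Γ.edge_eq_iff _ _).1 (j.injective h) with h | h
        · exact Subtype.ext (by rw [← hr' e, ← hr' e', h])
        · have h₁ := hr e
          rw [h, H.status_opp] at h₁
          simp [Status.opposite, hr e'] at h₁⟩
      perm := π
      opp_eq := fun h => by
        obtain ⟨⟨e, b⟩, rfl⟩ := H.diagram.endsEquiv.surjective h
        change Γ.opp (shuffle π (H.diagram.ends (e, b))) =
          shuffle π (H.diagram.toJacobi.opp (H.diagram.ends (e, b)))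
        rw [BCRDiagram.toJacobi_opp_ends]
        cases b
        · rw [(hends e).1]
          exact (hends e).2.symm
        · rw [(hends e).2, Γ.opp_opp]
          exact (hends e).1.symm
      number_eq := fun e => congrArg (fun h => j (Γ.edge h)) (hends e).1 }
  refine ⟨L, ?_, ?_⟩
  · classical
    have hs : ∀ e, s (r e) = (false, false == decide (H.diagram.IsUnivalent e.1.1)) := by
      intro e
      have hu : H.diagram.IsUnivalent e.1.1 ↔ s (r e) = (false, false) := by
        rw [← hr' e]
        exact H.valency_eq_one_iff (hr e)
      by_cases h : H.diagram.IsUnivalent e.1.1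
      · rw [decide_eq_true h, hu.1 h]
        rfl
      · rw [decide_eq_false h]
        rw [hu] at h
        have aux : ∀ y : Status, y.1 = false → y ≠ (false, false) → y = (false, true) := by decide
        exact aux _ (hr e) h
    funext h
    obtain ⟨⟨e, b⟩, rfl⟩ := L.ends.surjective h
    rw [L.status_ends]
    change _ = s (shuffle π (H.diagram.ends (e, b)))
    cases b
    · rw [(hends e).1, hs]
      rfl
    · rw [(hends e).2, H.status_opp, hs]
      change (true, true == decide (H.diagram.IsUnivalent e.1.1)) = _
      simp [Status.opposite]
  · ext ⟨p, q⟩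
    rw [BCRDiagram.mem_internalPairs]
    change (Sum.inl p, Sum.inl q) ∈ internalEdges Γ.T E ↔ _
    constructor
    · rintro ⟨⟨p', q'⟩, h, e⟩
      simp only [Prod.map, Prod.mk.injEq, Sum.inl.injEq] at e
      rwa [← e.1, ← e.2]
    · exact fun h => ⟨(p, q), h, rfl⟩

/-- Lifts inject into states with the same weight, and every state of nonzero weight is reached. The
value of the sum over states does not involve `j`. -/
theorem weightBCR_eq (Γ : JacobiDiagram) (j : Γ.Numbering) :
    weightBCR Γ j = stateForm indicatorOne Γ := by
  classical
  have : Fintype (Lift Γ j) := Fintype.ofFinite _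
  rw [weightBCR, finsum_eq_sum_of_fintype, stateForm, stateSum_eq, Finset.mul_sum]
  refine Fintype.sum_of_injective (fun L : Lift Γ j => (L.status, L.diagram.internalPairs)) ?_ _ _
    ?_ fun L => L.weight_eq
  · exact fun L L' h => Lift.eq_of_status (congrArg Prod.fst h) (congrArg Prod.snd h)
  · rintro ⟨s, E⟩ h
    by_contra h₀
    obtain ⟨π, H⟩ := exists_isBCRState Γ (right_ne_zero_of_mul h₀)
    obtain ⟨L, hs, hE⟩ := exists_lift j H
    exact h ⟨L, Prod.ext hs hE⟩

end BCR

end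

theorem proposition3p3 :
    (∃! w : BCR.DiagramSpace →ₗ[ℝ] ℝ, BCR.IsConwayWeightSystem w) ∧
    (∀ x : BCR.DiagramSpace, ∃ p, BCR.IsConnectedPart x p) ∧
    (∀ x p : BCR.DiagramSpace, BCR.IsConnectedPart x p →
      BCR.logConwayWeight x = BCR.conwayWeight p) ∧
    ∀ (Γ : BCR.JacobiDiagram) (j : Γ.Numbering),
      BCR.weightBCR Γ j = - BCR.logConwayWeight (BCR.cls Γ) := by
  refine ⟨BCR.existsUnique_isConwayWeightSystem, BCR.exists_isConnectedPart, fun x p h => ?_,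
    fun Γ j => ?_⟩
  · rw [BCR.logConwayWeight_eq, BCR.stateLinear_of_isConnectedPart h, neg_neg]
  · rw [BCR.weightBCR_eq, BCR.logConwayWeight_eq, neg_neg, BCR.stateLinear_cls]
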